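/- **Setting.** Let $S\subseteq D$ with $|S|=n\ge 1$, let $f:S\to\{0,1\}^k$, fix a real $c>2$, let $m\ge 2^k$ be an integer, and embed $\{0,1\}^k$ in $\mathbb Z/m\mathbb Z$ as $\{0,\dots,2^k-1\}$. Put $V=\{0,\dots,\lceil cn\rceil-1\}$. Hash functions are ideal: all values of a sequence of pairs $h_1,h_2:D\to V$ and of $h_3:D\to\mathbb Z/m\mathbb Z$ are independent and uniform. Time is counted on a random access machine on which an elementary operation, an evaluation of a hash function, and the choice of a new pair of hash functions take unit time. Let $K$ be a positive integer constant. *Creation.* Go through the independent pairs $h_1,h_2:D\to V$ until the graph $G$ on $V$ with the $n$ edges $\{h_1(s),h_2(s)\}$, $s\in S$, is simple and acyclic, and every connected component of $G$ has at most $L=K(\lfloor\log_2 n\rfloor+1)$ vertices. Then choose $h_3$ and compute, by back-substitution along the components of $G$, a table $g:V\to\mathbb Z/m\mathbb Z$ with $g(h_1(s))+g(h_2(s))+h_3(s)=f(s)$ in $\mathbb{Z}/m\mathbb{Z}$ for all $s\in S$. The table is stored in $\lceil cn\rceil$ cells of $\lceil\log_2 m\rceil$ bits. The graph $G$ is retained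 as adjacency lists. *Query at $x\in D$.* Compute $g(h_1(x))+g(h_2(x))+h_3(x)$ in $\mathbb Z/m\mathbb Z$; output it if it lies in $\{0,1\}^k$, and otherwise output $\bot$. *Update.* Given $y\in S$ and $z\in\{0,1\}^k$, replace the value at $y$ by $z$ ($S$ stays fixed): find the edge $\{h_1(y),h_2(y)\}$ in $G$ and recompute $g$ within the component of this edge. **Theorem.** For every $c>2$ there is $K_0$ such that for every $K\ge K_0$ there is a constant $A$, depending only on $c$ and $K$, such that the following holds for all $n\ge1$, $k$, $m\ge2^k$, $D$, $S$ and $f$. 1. Creation halts almost surely, and its expected time is at most $A n$. It ends with the first pair $h_1,h_2$ that meets the requirement on $G$. 2. (Changes.) After creation and any finite sequence of updates, any further update of a value $f(y)$, $y\in S$, takes time at most $A\log(n+1)$. 3. After creation and any finite sequence of updates (possibly none), fixed in advance for the last claim below, let $f'$ be the current function on $S$. The hash functions are still the same, and $g(h_1(s))+g(h_2(s))+h_3(s)=f'(s)$ in $\mathbb{Z}/m\mathbb{Z}$ for all $s\in S$. Moreover: - the table $g$ uses $\lceil cn\rceil\lceil\log_2 m\rceil$ bits; - a query at any $x\in D$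 takes time at most an absolute constant, with exactly $3$ hash function evaluations and $2$ memory lookups; - a query at $x\in S$ outputs $f'(x)$; - for each fixed $x\in D\setminus S$, a query at $x$ outputs $\bot$ with probability exactly $1-2^k/m$. -/

import Mathlib

open MeasureTheory
open scoped ENNReal

universe uD

namespace Bloomier

/-! ## A random access machine with a structured programming language

The machine has numeric registers, numeric arrays, a read-only sequence of keys from the universe
`D`, and access to hash functions.  Every evaluated node of an expression and every executed
statement costs one step; hash evaluations and array reads are in addition counted separately. -/

/-- Registers. -/
inductive Var
  | numKeys | numCells | maxComp | numVals | newVal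
  | ok | i | p | q | r | u | v | e | a | d | start | res | bot
  deriving DecidableEq

/-- Arrays. `tab` is the table `g`, `val` the list of values of `f`; `head`, `next`, `tgt` hold the
adjacency lists of the graph; the others are working space. -/
inductive Arr
  | val | tab | head | next | tgt | seen | via | pred | queue | shift
  deriving DecidableEq

/-- Binary operations: addition, truncated subtraction, addition and subtraction in `ℤ/mℤ`,
and the tests `<`, `=` and `≠` (with values `0` and `1`). -/
inductive BinOp
  | add | sub | addMod | subMod | lt | eq | ne
  deriving DecidableEq

/-- Expressions. `hash1 j`, `hash2 j`, `hash3 j` apply a hash function to the key number `j`. -/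
inductive Expr
  | lit (k : ℕ)
  | var (x : Var)
  | get (b : Arr) (j : Expr)
  | half (x : Expr)
  | bin (o : BinOp) (x y : Expr)
  | hash1 (j : Expr)
  | hash2 (j : Expr)
  | hash3 (j : Expr)

/-- Statements. `redraw` discards the current pair of hash functions `h₁, h₂` and
switches to a fresh one. -/
inductive Stmt
  | skip
  | set (x : Var) (y : Expr)
  | store (b : Arr) (j y : Expr)
  | redraw
  | seq (s t : Stmt)
  | ite (b : Expr) (s t : Stmt)
  | while (b : Expr) (s : Stmt)

/-- Steps, hash evaluations and array reads. -/
@[ext]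
structure Cost where
  steps : ℕ
  hashes : ℕ
  reads : ℕ

instance : Add Cost :=
  ⟨fun x y => ⟨x.steps + y.steps, x.hashes + y.hashes, x.reads + y.reads⟩⟩

/-- What a program cannot change: the modulus, the keys, and the hash functions (the pair
`h₁, h₂` comes in a sequence of versions). -/
structure Env (D : Type uD) where
  m : ℕ
  key : ℕ → D
  h1 : ℕ → D → ℕ
  h2 : ℕ → D → ℕ
  h3 : D → ℕ

/-- Registers, arrays, and the number of the pair `h₁, h₂` that is in use. -/
structure State where
  reg : Var → ℕ
  arr : Arr → ℕ → ℕ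
  trial : ℕ

/-- Value of a binary operation. -/
def BinOp.eval (m : ℕ) : BinOp → ℕ → ℕ → ℕ
  | .add, x, y => x + y
  | .sub, x, y => x - y
  | .addMod, x, y => ((x : ZMod m) + (y : ZMod m)).val
  | .subMod, x, y => ((x : ZMod m) - (y : ZMod m)).val
  | .lt, x, y => if x < y then 1 else 0
  | .eq, x, y => if x = y then 1 else 0
  | .ne, x, y => if x = y then 0 else 1

/-- Value of an expression. -/
def Expr.eval {D : Type uD} (E : Env D) (σ : State) : Expr → ℕ
  | .lit k => k
  | .var x => σ.reg x
  | .get b j => σ.arr b (j.eval E σ)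
  | .half x => x.eval E σ / 2
  | .bin o x y => o.eval E.m (x.eval E σ) (y.eval E σ)
  | .hash1 j => E.h1 σ.trial (E.key (j.eval E σ))
  | .hash2 j => E.h2 σ.trial (E.key (j.eval E σ))
  | .hash3 j => E.h3 (E.key (j.eval E σ))

/-- Cost of the evaluation of an expression. -/
def Expr.cost : Expr → Cost
  | .lit _ => ⟨1, 0, 0⟩
  | .var _ => ⟨1, 0, 0⟩
  | .get _ j => j.cost + ⟨1, 0, 1⟩
  | .half x => x.cost + ⟨1, 0, 0⟩
  | .bin _ x y => x.cost + y.cost + ⟨1, 0, 0⟩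
  | .hash1 j => j.cost + ⟨1, 1, 0⟩
  | .hash2 j => j.cost + ⟨1, 1, 0⟩
  | .hash3 j => j.cost + ⟨1, 1, 0⟩

/-- Writing a register. -/
def State.setReg (σ : State) (x : Var) (y : ℕ) : State :=
  { σ with reg := Function.update σ.reg x y }

/-- Writing an array cell. -/
def State.setArr (σ : State) (b : Arr) (j y : ℕ) : State :=
  { σ with arr := Function.update σ.arr b (Function.update (σ.arr b) j y) }

/-- `Exec E s σ τ c`: started in the state `σ`, the program `s` halts in the state `τ`
after a computation of cost `c`. -/
inductive Exec {D : Type uD} (E : Env D) : Stmt → State → State → Cost → Prop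
  | skip (σ : State) : Exec E .skip σ σ ⟨1, 0, 0⟩
  | set (x : Var) (y : Expr) (σ : State) :
      Exec E (.set x y) σ (σ.setReg x (y.eval E σ)) (y.cost + ⟨1, 0, 0⟩)
  | store (b : Arr) (j y : Expr) (σ : State) :
      Exec E (.store b j y) σ (σ.setArr b (j.eval E σ) (y.eval E σ))
        (j.cost + y.cost + ⟨1, 0, 0⟩)
  | redraw (σ : State) : Exec E .redraw σ { σ with trial := σ.trial + 1 } ⟨1, 0, 0⟩
  | seq {s t : Stmt} {σ τ υ : State} {c d : Cost} :
      Exec E s σ τ c → Exec E t τ υ d → Exec E (.seq s t) σ υ (c + d)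
  | ite_true {b : Expr} {s t : Stmt} {σ τ : State} {c : Cost} :
      b.eval E σ ≠ 0 → Exec E s σ τ c → Exec E (.ite b s t) σ τ (b.cost + ⟨1, 0, 0⟩ + c)
  | ite_false {b : Expr} {s t : Stmt} {σ τ : State} {c : Cost} :
      b.eval E σ = 0 → Exec E t σ τ c → Exec E (.ite b s t) σ τ (b.cost + ⟨1, 0, 0⟩ + c)
  | while_true {b : Expr} {s : Stmt} {σ τ υ : State} {c d : Cost} :
      b.eval E σ ≠ 0 → Exec E s σ τ c → Exec E (.while b s) τ υ d →
      Exec E (.while b s) σ υ (b.cost + ⟨1, 0, 0⟩ + c + d)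
  | while_false {b : Expr} {s : Stmt} {σ : State} :
      b.eval E σ = 0 → Exec E (.while b s) σ σ (b.cost + ⟨1, 0, 0⟩)

/-- The machine is deterministic. -/
theorem Exec.det {D : Type uD} {E : Env D} {s : Stmt} {σ τ τ₂ : State} {c c₂ : Cost}
    (h : Exec E s σ τ c) (h₂ : Exec E s σ τ₂ c₂) : τ = τ₂ ∧ c = c₂ := by
  induction h generalizing τ₂ c₂ with
  | skip => cases h₂; exact ⟨rfl, rfl⟩
  | set => cases h₂; exact ⟨rfl, rfl⟩
  | store => cases h₂; exact ⟨rfl, rfl⟩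
  | redraw => cases h₂; exact ⟨rfl, rfl⟩
  | seq _ _ ih1 ih2 =>
    cases h₂ with
    | seq k1 k2 =>
      obtain ⟨rfl, rfl⟩ := ih1 k1
      obtain ⟨rfl, rfl⟩ := ih2 k2
      exact ⟨rfl, rfl⟩
  | ite_true hb _ ih =>
    cases h₂ with
    | ite_true _ k => obtain ⟨rfl, rfl⟩ := ih k; exact ⟨rfl, rfl⟩
    | ite_false hb2 _ => exact absurd hb2 hb
  | ite_false hb _ ih =>
    cases h₂ with
    | ite_true hb2 _ => exact absurd hb hb2
    | ite_false _ k => obtain ⟨rfl, rfl⟩ := ih k; exact ⟨rfl, rfl⟩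
  | while_true hb _ _ ih1 ih2 =>
    cases h₂ with
    | while_true _ k1 k2 =>
      obtain ⟨rfl, rfl⟩ := ih1 k1
      obtain ⟨rfl, rfl⟩ := ih2 k2
      exact ⟨rfl, rfl⟩
    | while_false hb2 => exact absurd hb2 hb
  | while_false hb =>
    cases h₂ with
    | while_true hb2 _ _ => exact absurd hb hb2
    | while_false _ => exact ⟨rfl, rfl⟩

/-! ## The three programs -/

/-- Sequential composition of a list of statements. -/
def block : List Stmt → Stmt
  | [] => .skip
  | [s] => s
  | s :: t :: l => .seq s (block (t :: l))

/-- Increment of a register. -/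
def incr (x : Var) : Stmt := .set x (.bin .add (.var x) (.lit 1))

/-- `x < y` for registers. -/
def ltVar (x y : Var) : Expr := .bin .lt (.var x) (.var y)

/-- The number (counted from `1`) of the edge to which the half-edge `x` belongs: edge number `j`
consists of the half-edges `2 * j - 1` and `2 * j`. The result is `0` for `x = 0` (no edge). -/
def edgeOf (x : Expr) : Expr := .half (.bin .add x (.lit 1))

/-- Builds the adjacency lists of the multigraph with the edges `h₁(s) h₂(s)`, `s ∈ S`: the
half-edges out of `w` are `head[w]`, `next[head[w]]`, ..., up to `0`, and `tgt` gives the endpoint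
of a half-edge. All vertices are marked as not seen. -/
def buildGraph : Stmt := block [
  .set .i (.lit 0),
  .while (ltVar .i .numCells) (block [
    .store .head (.var .i) (.lit 0),
    .store .seen (.var .i) (.lit 0),
    incr .i]),
  .set .i (.lit 0),
  .set .e (.lit 1),
  .while (ltVar .i .numKeys) (block [
    .set .u (.hash1 (.var .i)),
    .set .v (.hash2 (.var .i)),
    .store .tgt (.var .e) (.var .v),
    .store .next (.var .e) (.get .head (.var .u)),
    .store .head (.var .u) (.var .e),
    incr .e,
    .store .tgt (.var .e) (.var .u),
    .store .next (.var .e) (.get .head (.var .v)),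
    .store .head (.var .v) (.var .e),
    incr .e,
    incr .i])]

/-- Enqueues the vertex `w`, reached through the half-edge `x` from the vertex `y`. -/
def visit (w : Var) (x y : Expr) : Stmt := block [
  .store .seen (.var w) (.lit 1),
  .store .via (.var w) x,
  .store .pred (.var w) y,
  .store .queue (.var .q) (.var w),
  incr .q]

/-- Breadth first search through all components. Sets `ok` to `0` as soon as it meets a vertex a
second time (so that there is a cycle, a loop or a double edge), or a component with
more than `maxComp` vertices. -/
def search : Stmt := block [
  .set .ok (.lit 1),
  .set .p (.lit 0),
  .set .q (.lit 0),
  .set .r (.lit 0),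
  .while (ltVar .r .numCells) (block [
    .ite (.bin .eq (.get .seen (.var .r)) (.lit 0))
      (block [
        .set .start (.var .q),
        visit .r (.lit 0) (.lit 0),
        .while (ltVar .p .q) (block [
          .set .u (.get .queue (.var .p)),
          incr .p,
          .set .e (.get .head (.var .u)),
          .while (.bin .ne (.var .e) (.lit 0)) (block [
            .ite (.bin .ne (edgeOf (.var .e)) (edgeOf (.get .via (.var .u))))
              (block [
                .set .v (.get .tgt (.var .e)),
                .ite (.bin .eq (.get .seen (.var .v)) (.lit 0))
                  (visit .v (.var .e) (.var .u))
                  (.set .ok (.lit 0))])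
              .skip,
            .set .e (.get .next (.var .e))])]),
        .ite (.bin .lt (.var .maxComp) (.bin .sub (.var .q) (.var .start)))
          (.set .ok (.lit 0))
          .skip])
      .skip,
    incr .r])]

/-- Back-substitution, in the order in which the search has met the vertices: the first vertex of a
component gets `0`, and a vertex `v` reached from `u` through the edge of the key `s` gets
`f(s) - g[u] - h₃(s)`. -/
def solve : Stmt := block [
  .set .i (.lit 0),
  .while (ltVar .i .numCells) (block [
    .set .v (.get .queue (.var .i)),
    .set .e (edgeOf (.get .via (.var .v))),
    .ite (.bin .eq (.var .e) (.lit 0))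
      (.store .tab (.var .v) (.lit 0))
      (block [
        .set .e (.bin .sub (.var .e) (.lit 1)),
        .store .tab (.var .v)
          (.bin .subMod
            (.bin .subMod (.get .val (.var .e)) (.get .tab (.get .pred (.var .v))))
            (.hash3 (.var .e)))]),
    incr .i])]

/-- Creation of the filter: repeat the choice of `h₁, h₂` until the graph is simple and acyclic
and has no component with more than `maxComp` vertices, then solve for the table. -/
def createProg : Stmt := block [
  .set .ok (.lit 0),
  .while (.bin .eq (.var .ok) (.lit 0)) (block [
    .redraw,
    buildGraph,
    search]),
  solve]

/-- Query at the key number `0`: compute `g[h₁] + g[h₂] + h₃`, and set `bot` if the result is not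
one of the numbers below `numVals`. -/
def queryProg : Stmt := block [
  .set .res (.bin .addMod
    (.bin .addMod (.get .tab (.hash1 (.lit 0))) (.get .tab (.hash2 (.lit 0))))
    (.hash3 (.lit 0))),
  .ite (ltVar .res .numVals) (.set .bot (.lit 0)) (.set .bot (.lit 1))]

/-- Change of the value at the key number `0` to `newVal`: finds the edge of this key among the
edges at `u = h₁`, and recomputes the table on the side of `v = h₂` in the component of this edge.
A shift of the table by `-d` at one end of any other edge is made up for by a shift by `d` at its
other end. -/
def updateProg : Stmt := block [
  .set .u (.hash1 (.lit 0)),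
  .set .v (.hash2 (.lit 0)),
  .set .e (.get .head (.var .u)),
  .while (.bin .ne (.get .tgt (.var .e)) (.var .v)) (.set .e (.get .next (.var .e))),
  .set .res (.bin .subMod
    (.bin .subMod (.var .newVal) (.get .tab (.var .u))) (.hash3 (.lit 0))),
  .set .d (.bin .subMod (.get .tab (.var .v)) (.var .res)),
  .store .tab (.var .v) (.var .res),
  .set .p (.lit 0),
  .set .q (.lit 1),
  .store .queue (.lit 0) (.var .v),
  .store .via (.lit 0) (.var .e),
  .store .shift (.lit 0) (.var .d),
  .while (ltVar .p .q) (block [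
    .set .u (.get .queue (.var .p)),
    .set .a (.get .via (.var .p)),
    .set .d (.get .shift (.var .p)),
    incr .p,
    .set .e (.get .head (.var .u)),
    .while (.bin .ne (.var .e) (.lit 0)) (block [
      .ite (.bin .ne (edgeOf (.var .e)) (edgeOf (.var .a)))
        (block [
          .set .v (.get .tgt (.var .e)),
          .store .tab (.var .v) (.bin .addMod (.get .tab (.var .v)) (.var .d)),
          .store .queue (.var .q) (.var .v),
          .store .via (.var .q) (.var .e),
          .store .shift (.var .q) (.bin .subMod (.lit 0) (.var .d)),
          incr .q])
        .skip,
      .set .e (.get .next (.var .e))])])]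

/-! ## Random hash functions -/

/-- The random source: a sequence of pairs `h₁, h₂ : D → V` with `V = {0, …, N - 1}` (the `Bool`
tells the two members of a pair apart) and one function `h₃ : D → ℤ/mℤ`. -/
abbrev HashSpace (N m : ℕ) (D : Type uD) : Type uD :=
  (ℕ × Bool × D → Fin N) × (D → Fin m)

/-- All hash values are independent and uniformly distributed. -/
noncomputable def hashLaw (N m : ℕ) [NeZero N] [NeZero m] (D : Type uD) :
    Measure (HashSpace N m D) :=
  (Measure.infinitePi fun _ : ℕ × Bool × D => (PMF.uniformOfFintype (Fin N)).toMeasure).prod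
    (Measure.infinitePi fun _ : D => (PMF.uniformOfFintype (Fin m)).toMeasure)

section

variable {N m : ℕ} {D : Type uD}

/-- The function `h₁` of the pair number `t`. -/
def HashSpace.h1 (ω : HashSpace N m D) (t : ℕ) (x : D) : Fin N := ω.1 (t, false, x)

/-- The function `h₂` of the pair number `t`. -/
def HashSpace.h2 (ω : HashSpace N m D) (t : ℕ) (x : D) : Fin N := ω.1 (t, true, x)

/-- The function `h₃`. -/
def HashSpace.h3 (ω : HashSpace N m D) (x : D) : Fin m := ω.2 x

/-- The machine environment with given hash functions and keys. -/
def HashSpace.env (ω : HashSpace N m D) (key : ℕ → D) : Env D where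
  m := m
  key := key
  h1 t x := ω.h1 t x
  h2 t x := ω.h2 t x
  h3 x := ω.h3 x

/-- The graph with the edges `h₁(s) h₂(s)`, `s ∈ S`. -/
def hashGraph (h1 h2 : D → Fin N) (S : Finset D) : SimpleGraph (Fin N) :=
  SimpleGraph.fromEdgeSet ((fun s => s(h1 s, h2 s)) '' (S : Set D))

/-- The requirement on `h₁, h₂`: the graph on `V` with the `|S|` edges `h₁(s) h₂(s)` is simple and
acyclic, and every connected component has at most `L` vertices. -/
structure GoodPair (h1 h2 : D → Fin N) (S : Finset D) (L : ℕ) : Prop where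
  no_loop : ∀ s ∈ S, h1 s ≠ h2 s
  no_double_edge : Set.InjOn (fun s => s(h1 s, h2 s)) (S : Set D)
  acyclic : (hashGraph h1 h2 S).IsAcyclic
  small : ∀ C : (hashGraph h1 h2 S).ConnectedComponent, C.supp.ncard ≤ L

end

/-! ## The data structure and its operations -/

/-- The filter: a table of `N` cells of `w` bits each, together with the hash functions, where
`trial` tells which pair `h₁, h₂` is used. -/
structure Filter (N w : ℕ) where
  trial : ℕ
  table : Fin N → BitVec w

/-- The bits stored by the filter. -/
def Filter.bits {N w : ℕ} (F : Filter N w) : List Bool :=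
  (List.ofFn F.table).flatMap fun b => List.ofFn fun j : Fin w => b.getLsb j

/-- The filter with the retained graph `G`, given by adjacency lists. -/
structure Store (n N m : ℕ) where
  filter : Filter N (Nat.clog 2 m)
  head : Fin N → ℕ
  next : Fin (2 * n + 1) → ℕ
  tgt : Fin (2 * n + 1) → ℕ

/-- What remains of a machine state: the table, in cells of `⌈log₂ m⌉` bits, and the graph. -/
def State.toStore (n N m : ℕ) (σ : State) : Store n N m where
  filter := ⟨σ.trial, fun v => BitVec.ofNat _ (σ.arr .tab v)⟩
  head v := σ.arr .head v
  next j := σ.arr .next j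
  tgt j := σ.arr .tgt j

/-- A function on `Fin l` as contents of an array, with `0` outside. -/
def arrayOf {l : ℕ} (a : Fin l → ℕ) (j : ℕ) : ℕ := if h : j < l then a ⟨j, h⟩ else 0

/-- Registers at the start of a query or an update. -/
def callRegs (k newVal : ℕ) : Var → ℕ
  | .numVals => 2 ^ k
  | .newVal => newVal
  | _ => 0

/-- Initial state for a query: only the filter is in memory. -/
def Filter.load {N w : ℕ} (F : Filter N w) (k : ℕ) : State where
  reg := callRegs k 0
  arr b := match b with
    | .tab => arrayOf fun v => (F.table v).toNat
    | _ => fun _ => 0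
  trial := F.trial

/-- Initial state for an update: the filter and the graph are in memory. -/
def Store.load {n N m : ℕ} (st : Store n N m) (k newVal : ℕ) : State where
  reg := callRegs k newVal
  arr b := match b with
    | .tab => arrayOf fun v => (st.filter.table v).toNat
    | .head => arrayOf st.head
    | .next => arrayOf st.next
    | .tgt => arrayOf st.tgt
    | _ => fun _ => 0
  trial := st.filter.trial

section

variable {n N m k : ℕ} {D : Type uD}

/-- Registers at the start of the creation. -/
def createRegs (n N L : ℕ) : Var → ℕ
  | .numKeys => n
  | .numCells => N
  | .maxComp => L
  | _ => 0

/-- Initial state for the creation: the values of `f`, in the order in which `S` is given. -/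
def createState [NeZero n] (N L : ℕ) {S : Finset D} (enum : Fin n ≃ S) (f : S → BitVec k) :
    State where
  reg := createRegs n N L
  arr b := match b with
    | .val => arrayOf fun j => (f (enum j)).toNat
    | _ => fun _ => 0
  trial := 0

/-- With the random choices `ω`, the creation of the filter for `f : S → {0,1}^k` halts with the
result `st` and has cost `c`. The set `S` is given as a list `enum` of its elements, and `L` is
the bound for the size of the components. -/
def Creates [NeZero n] (L : ℕ) {S : Finset D} (enum : Fin n ≃ S) (f : S → BitVec k)
    (ω : HashSpace N m D) (st : Store n N m) (c : Cost) : Prop :=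
  ∃ σ : State,
    Exec (ω.env fun j => (enum (Fin.ofNat n j) : D)) createProg (createState N L enum f) σ c ∧
      st = σ.toStore n N m

/-- The query of the filter `F` at `x` halts with the answer `out` (`none` is `⊥`), at cost `c`. -/
def Queries {w : ℕ} (k : ℕ) (ω : HashSpace N m D) (F : Filter N w) (x : D)
    (out : Option (BitVec k)) (c : Cost) : Prop :=
  ∃ σ : State, Exec (ω.env fun _ => x) queryProg (F.load k) σ c ∧
    out = if σ.reg .bot = 0 then some (BitVec.ofNat k (σ.reg .res)) else none

/-- The update of `st` that changes the value at `y` to `z` halts with the result `st₂`,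
at cost `c`. -/
def Updates (ω : HashSpace N m D) (st : Store n N m) (y : D) (z : BitVec k)
    (st₂ : Store n N m) (c : Cost) : Prop :=
  ∃ σ : State, Exec (ω.env fun _ => y) updateProg (st.load k z.toNat) σ c ∧
    st₂ = σ.toStore n N m

/-- The updates in the list `us` (new values at elements of `S`), carried out one after the other,
take `st` to `st₂`. -/
inductive UpdateSeq (ω : HashSpace N m D) {S : Finset D} :
    List (S × BitVec k) → Store n N m → Store n N m → Prop
  | nil (st : Store n N m) : UpdateSeq ω [] st st
  | cons {y : S} {z : BitVec k} {us : List (S × BitVec k)} {st st₁ st₂ : Store n N m}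
      {c : Cost} : Updates ω st (y : D) z st₁ c → UpdateSeq ω us st₁ st₂ →
      UpdateSeq ω ((y, z) :: us) st st₂

open Classical in
/-- The function `f` after the changes of values listed in `us`. -/
noncomputable def changed {S : Finset D} (f : S → BitVec k) (us : List (S × BitVec k)) :
    S → BitVec k :=
  us.foldl (fun g u => Function.update g u.1 u.2) f

/-- The creation time, as a function of the random choices (infinite if the creation does
not halt). -/
noncomputable def creationTime [NeZero n] (L : ℕ) {S : Finset D} (enum : Fin n ≃ S)
    (f : S → BitVec k) (ω : HashSpace N m D) : ℝ≥0∞ :=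
  ⨅ (st : Store n N m) (c : Cost) (_ : Creates L enum f ω st c), (c.steps : ℝ≥0∞)

/-- The event that the filter for `f`, once created and taken through the updates `us`, gives the
answer `⊥` at `x`. -/
def bottomEvent [NeZero n] (N m L : ℕ) {S : Finset D} (enum : Fin n ≃ S) (f : S → BitVec k)
    (us : List (S × BitVec k)) (x : D) : Set (HashSpace N m D) :=
  {ω | ∃ (st st₂ : Store n N m) (c c₂ : Cost), Creates L enum f ω st c ∧
    UpdateSeq ω us st st₂ ∧ Queries k ω st₂.filter x none c₂}

end

end Bloomier

/-! The heart is a lower bound, uniform in `n`, for the probability that the random multigraph with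
`n` edges on `N = ⌈cn⌉` vertices is a forest with components of size `O(log n)`. Its average degree
is at most `ρ = 2/c < 1`.

Forests. Let `F(J)` be the number of choices of ends for which the edges in `J` form a forest, and
`Λ(J)` the number of linked pairs of vertices, summed over these choices. A further edge destroys
the forest exactly if its ends are linked, so `N² F(J ∪ {i}) = N² F(J) - Λ(J)`
(`forestCount_insert`). Splitting off the first edge of a path gives `Λ(J) ≤ N F(J) + (2/N) ∑ Λ(J \
{i})` (`forestLinks_le`). For large `N`, induction yields `Λ(J) ≤ B N F(J)` with `B = 2/(1 - ρ)`;
hence an edge costs at most the fraction `B/N` of the forests, and `n ≤ N` edges leave a constant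
fraction (`forestCount_ge`).

Components. Exploring a component vertex by vertex is dominated by a subcritical branching process.
An exponential weight `y` per active vertex decreases on average by a factor `z > 1` per step, so
that a component of `t` vertices has probability at most `y / z ^ t` (`card_filter_cover_le`). A
union bound over the vertices finishes large `n`; for the remaining `n` the constant `K` is so large
that the size condition is void (`exists_goodFunctions_ge`).

Creation. Different pairs are independent, so `T` rejections in a row have probability at most `(1 -
p) ^ T`. A round takes linear time even if it fails, as the search scans the half-edges out of each
vertex at most once. A geometric series bounds the expectation, and its finiteness gives almost sure
halting. The search accepts exactly the good pairs (`Search.ok_iff`), and the order in which it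
finds the vertices allows back-substitution (`runs_solve`).

Updates. In a tree, removing the edge of `y` separates its ends. The value at one end is corrected,
and shifts of alternating sign on that side preserve all other equations (`Recompute.solves`). Only
one component, of logarithmic size, is touched.

Outside `S`. Neither creation nor updates read `h₃(x)` for `x ∉ S`. Adding `1` to it preserves the
law and adds `1` to the computed sum, which is therefore uniform on `ℤ/mℤ`; exactly `m - 2 ^ k` of
its values mean `⊥`.

The programs are verified by `Runs` with potentials for time; determinism transfers the results to
every halting run. By `Exec.congr` a halting run depends on finitely many hash values, whence
measurability for arbitrary `D`. -/

namespace Bloomier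

/-! ## Linked vertices and forests -/

section Link

variable {ι V : Type*} {a b : ι → V} {I J : Set ι} {i : ι} {u v w : V}

/-- The edge number `i` joins `u` and `v`. -/
def Joins (a b : ι → V) (i : ι) (u v : V) : Prop := (u = a i ∧ v = b i) ∨ (u = b i ∧ v = a i)

/-- The vertices `u` and `v` are joined by a path of edges with numbers in `J`. -/
def Link (a b : ι → V) (J : Set ι) : V → V → Prop :=
  Relation.ReflTransGen fun u v => ∃ i ∈ J, Joins a b i u v

/-- The multigraph of the edges with numbers in `J` has no cycles. -/
def Forest (a b : ι → V) (J : Set ι) : Prop := ∀ i ∈ J, ¬ Link a b (J \ {i}) (a i) (b i)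

theorem Joins.symm (h : Joins a b i u v) : Joins a b i v u := by
  rcases h with ⟨h, k⟩ | ⟨h, k⟩
  · exact Or.inr ⟨k, h⟩
  · exact Or.inl ⟨k, h⟩

theorem Link.refl (u : V) : Link a b J u u := Relation.ReflTransGen.refl

theorem Link.trans (h : Link a b J u v) (k : Link a b J v w) : Link a b J u w :=
  Relation.ReflTransGen.trans h k

theorem Link.symm (h : Link a b J u v) : Link a b J v u :=
  by
  induction h with
  | refl => exact Link.refl _
  | tail _ h ih => obtain ⟨i, hi, k⟩ := h; exact (Relation.ReflTransGen.single ⟨i, hi, k.symm⟩).trans ih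

theorem Link.mono (hIJ : I ⊆ J) (h : Link a b I u v) : Link a b J u v :=
  Relation.ReflTransGen.mono (fun _ _ ⟨i, hi, k⟩ => ⟨i, hIJ hi, k⟩) _ _ h

theorem Joins.link (h : Joins a b i u v) (hi : i ∈ J) : Link a b J u v :=
  Relation.ReflTransGen.single ⟨i, hi, h⟩

theorem Joins.edge_link (h : Joins a b i u v) (k : Link a b J u v) : Link a b J (a i) (b i) := by
  rcases h with ⟨rfl, rfl⟩ | ⟨rfl, rfl⟩
  · exact k
  · exact k.symm

/-- Only the first entry into the edge `i` and the last exit from it matter: each further crossing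
leads back to one of the three cases. -/
theorem Link.insert_split (h : Link a b (insert i J) u v) :
    Link a b J u v ∨ (Link a b J u (a i) ∧ Link a b J (b i) v) ∨
      (Link a b J u (b i) ∧ Link a b J (a i) v) := by
  induction h with
  | refl => exact Or.inl (Link.refl _)
  | @tail x y _ hxy ih =>
    obtain ⟨j, hj, hxy⟩ := hxy
    rcases hj with rfl | hj
    · rcases hxy with ⟨rfl, rfl⟩ | ⟨rfl, rfl⟩
      · rcases ih with h | ⟨h, -⟩ | ⟨h, -⟩
        · exact Or.inr (Or.inl ⟨h, Link.refl _⟩)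
        · exact Or.inr (Or.inl ⟨h, Link.refl _⟩)
        · exact Or.inl h
      · rcases ih with h | ⟨h, -⟩ | ⟨h, -⟩
        · exact Or.inr (Or.inr ⟨h, Link.refl _⟩)
        · exact Or.inl h
        · exact Or.inr (Or.inr ⟨h, Link.refl _⟩)
    · have hl : Link a b J x y := hxy.link hj
      rcases ih with h | ⟨h, k⟩ | ⟨h, k⟩
      · exact Or.inl (h.trans hl)
      · exact Or.inr (Or.inl ⟨h, k.trans hl⟩)
      · exact Or.inr (Or.inr ⟨h, k.trans hl⟩)

theorem Forest.mono (hIJ : I ⊆ J) (h : Forest a b J) : Forest a b I := fun i hi k =>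
  h i (hIJ hi) (k.mono (Set.sdiff_subset_sdiff_left hIJ))

/-- A cycle through an old edge `j` must use `i`. Going around it the other way, through `j`, links
the ends of `i` inside `J`, which is excluded. -/
theorem Forest.insert (h : Forest a b J) (hi : ¬ Link a b J (a i) (b i)) :
    Forest a b (insert i J) := by
  have hiJ : i ∉ J := fun hiJ => hi (Joins.link (Or.inl ⟨rfl, rfl⟩) hiJ)
  intro j hj k
  rcases hj with rfl | hj
  · exact hi (k.mono (by intro x hx; exact hx.1.resolve_left hx.2))
  · have hij : i ≠ j := fun e => hiJ (e ▸ hj)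
    have e : Insert.insert i J \ {j} = Insert.insert i (J \ {j}) := by
      rw [Set.insert_sdiff_of_notMem]; simpa using hij
    rw [e] at k
    have hs : J \ {j} ⊆ J := Set.sdiff_subset
    have hl : Link a b J (a j) (b j) := Joins.link (Or.inl ⟨rfl, rfl⟩) hj
    rcases k.insert_split with k | ⟨k1, k2⟩ | ⟨k1, k2⟩
    · exact h j hj k
    · exact hi (((k1.mono hs).symm.trans hl).trans (k2.mono hs).symm)
    · exact hi (((k2.mono hs).trans hl.symm).trans (k1.mono hs))

theorem Forest.insert_iff (hi : i ∉ J) :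
    Forest a b (Insert.insert i J) ↔ Forest a b J ∧ ¬ Link a b J (a i) (b i) := by
  refine ⟨fun h => ⟨h.mono (Set.subset_insert _ _), fun k => h i (Set.mem_insert _ _) ?_⟩,
    fun h => h.1.insert h.2⟩
  rwa [Set.insert_sdiff_of_mem _ (Set.mem_singleton i), Set.sdiff_singleton_eq_self hi]

/-- A path between different vertices can be chosen such that its first edge is not used again. -/
theorem Link.exists_first [DecidableEq ι] (J : Finset ι) (h : Link a b J u v) (huv : u ≠ v) :
    ∃ i ∈ J, ∃ w, Joins a b i u w ∧ Link a b ((J.erase i : Finset ι) : Set ι) w v := by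
  induction hn : J.card generalizing J with
  | zero =>
    rcases Relation.ReflTransGen.cases_head h with rfl | ⟨_, ⟨i, hi, _⟩, _⟩
    · exact absurd rfl huv
    · rw [Finset.card_eq_zero] at hn; subst hn; simp at hi
  | succ n ih =>
    rcases Relation.ReflTransGen.cases_head h with rfl | ⟨x, ⟨i, hi, hux⟩, hxv⟩
    · exact absurd rfl huv
    have hi : i ∈ J := hi
    -- The rest of the path may use `i` again. After its last use it leaves from `x` or from `u`; in
    -- the second case the induction applies to the smaller set of edges.
    have key : Link a b ((J.erase i : Finset ι) : Set ι) x v ∨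
        Link a b ((J.erase i : Finset ι) : Set ι) u v := by
      have e : (J : Set ι) = Insert.insert i ((J.erase i : Finset ι) : Set ι) := by
        rw [← Finset.coe_insert, Finset.insert_erase hi]
      change Link a b (J : Set ι) x v at hxv
      rw [e] at hxv
      rcases hux with ⟨rfl, rfl⟩ | ⟨rfl, rfl⟩ <;>
        rcases hxv.insert_split with k | ⟨_, k⟩ | ⟨_, k⟩ <;> first | exact Or.inl k | exact Or.inr k
    rcases key with k | k
    · exact ⟨i, hi, x, hux, k⟩
    · obtain ⟨j, hj, w, hj1, hj2⟩ := ih _ k (by rw [Finset.card_erase_of_mem hi, hn]; rfl)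
      refine ⟨j, Finset.mem_of_mem_erase hj, w, hj1, hj2.mono ?_⟩
      exact_mod_cast Finset.erase_subset_erase j (Finset.erase_subset i J)

/-- A multigraph is a forest if every edge leads from its own child to a vertex of lower rank. -/
theorem forest_of_rank [DecidableEq ι] (rank : V → ℕ) (par child : ι → V) (J : Finset ι)
    (hj : ∀ i ∈ J, Joins a b i (par i) (child i)) (hr : ∀ i ∈ J, rank (par i) < rank (child i))
    (hinj : Set.InjOn child J) : Forest a b (J : Set ι) := by
  induction hn : J.card generalizing J with
  | zero => rw [Finset.card_eq_zero] at hn; subst hn; intro i hi; simp at hi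
  | succ n ih =>
    obtain ⟨i, hi, hmax⟩ := J.exists_max_image (fun i => rank (child i))
      (Finset.card_pos.1 (by omega))
    rw [← Finset.insert_erase hi, Finset.coe_insert]
    have hsub : J.erase i ⊆ J := Finset.erase_subset i J
    refine (ih (J.erase i) (fun j h => hj j (hsub h)) (fun j h => hr j (hsub h))
      (hinj.mono (by exact_mod_cast hsub)) (by rw [Finset.card_erase_of_mem hi, hn]; rfl)).insert ?_
    intro k
    -- As `child i` has maximal rank, no other edge has it as its parent, and by injectivity none
    -- has it as its child. So it is isolated once `i` is removed.
    have iso : ∀ x, Link a b ((J.erase i : Finset ι) : Set ι) (child i) x → x = child i := by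
      intro x hx
      rcases Relation.ReflTransGen.cases_head hx with rfl | ⟨y, ⟨j, hjm, hjy⟩, _⟩
      · rfl
      exfalso
      have hjm : j ∈ J.erase i := hjm
      have hjJ := hsub hjm
      have hji : j ≠ i := Finset.ne_of_mem_erase hjm
      have hcj : child i = par j ∨ child i = child j := by
        rcases hjy with ⟨h1, _⟩ | ⟨h1, _⟩ <;> rcases hj j hjJ with ⟨h3, h4⟩ | ⟨h3, h4⟩ <;>
          simp [h1, h3, h4]
      rcases hcj with h | h
      · have := hr j hjJ
        have := hmax j hjJ
        rw [h] at this; omega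
      · exact hji (hinj hjJ hi h.symm)
    have h2 := hr i hi
    have : par i = child i := by
      rcases hj i hi with ⟨h3, h4⟩ | ⟨h3, h4⟩
      · rw [← h3, ← h4] at k; exact iso _ k.symm
      · rw [← h3, ← h4] at k; exact iso _ k
    rw [this] at h2; omega

variable {ι' V' : Type*} {a' b' : ι' → V'} {φ : V → V'} {ψ : ι' → ι} {J' : Set ι'}

/-- Passes between edges indexed by keys and by numbers, and between vertices in `Fin N` and in `ℕ`.
Since `y` is arbitrary, nothing outside the range of `φ` is reached, so components correspond as
sets. -/
theorem Link.map_iff (hφ : Function.Injective φ) (ha : ∀ i ∈ J', a' i = φ (a (ψ i)))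
    (hb : ∀ i ∈ J', b' i = φ (b (ψ i))) (hJ : ψ '' J' = J) {y : V'} :
    Link a' b' J' (φ u) y ↔ ∃ w, y = φ w ∧ Link a b J u w := by
  constructor
  · intro h
    induction h with
    | refl => exact ⟨u, rfl, Link.refl u⟩
    | tail _ h ih =>
      obtain ⟨w, rfl, hw⟩ := ih
      obtain ⟨i, hi, h⟩ := h
      have hiJ : ψ i ∈ J := hJ ▸ Set.mem_image_of_mem ψ hi
      rcases h with ⟨h1, rfl⟩ | ⟨h1, rfl⟩
      · rw [ha i hi] at h1
        exact ⟨_, hb i hi, hw.trans (Joins.link (Or.inl ⟨hφ h1, rfl⟩) hiJ)⟩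
      · rw [hb i hi] at h1
        exact ⟨_, ha i hi, hw.trans (Joins.link (Or.inr ⟨hφ h1, rfl⟩) hiJ)⟩
  · rintro ⟨w, rfl, h⟩
    induction h with
    | refl => exact Link.refl _
    | tail _ h ih =>
      obtain ⟨i, hi, h⟩ := h
      rw [← hJ] at hi
      obtain ⟨i, hi, rfl⟩ := hi
      refine ih.trans (Joins.link (i := i) ?_ hi)
      rcases h with ⟨rfl, rfl⟩ | ⟨rfl, rfl⟩
      · exact Or.inl ⟨(ha i hi).symm, (hb i hi).symm⟩
      · exact Or.inr ⟨(hb i hi).symm, (ha i hi).symm⟩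

theorem Link.map_iff' (hφ : Function.Injective φ) (ha : ∀ i ∈ J', a' i = φ (a (ψ i)))
    (hb : ∀ i ∈ J', b' i = φ (b (ψ i))) (hJ : ψ '' J' = J) :
    Link a' b' J' (φ u) (φ v) ↔ Link a b J u v := by
  rw [Link.map_iff hφ ha hb hJ]
  constructor
  · rintro ⟨w, h, k⟩; rwa [hφ h]
  · intro h; exact ⟨v, rfl, h⟩

theorem Forest.map_iff (hφ : Function.Injective φ) (hψ : Set.InjOn ψ J')
    (ha : ∀ i ∈ J', a' i = φ (a (ψ i)))
    (hb : ∀ i ∈ J', b' i = φ (b (ψ i))) (hJ : ψ '' J' = J) :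
    Forest a' b' J' ↔ Forest a b J := by
  have key : ∀ i ∈ J', (Link a' b' (J' \ {i}) (a' i) (b' i) ↔
      Link a b (J \ {ψ i}) (a (ψ i)) (b (ψ i))) := by
    intro i hi
    rw [ha i hi, hb i hi]
    refine Link.map_iff' hφ (fun j hj => ha j hj.1) (fun j hj => hb j hj.1) ?_
    rw [hψ.image_sdiff_subset (by simpa using hi), hJ, Set.image_singleton]
  constructor
  · intro h i hi
    rw [← hJ] at hi
    obtain ⟨i, hi, rfl⟩ := hi
    rw [← key i hi]; exact h i hi
  · intro h i hi
    rw [key i hi]; exact h _ (hJ ▸ Set.mem_image_of_mem ψ hi)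

theorem Forest.ne (h : Forest a b J) (hi : i ∈ J) : a i ≠ b i := by
  intro e
  apply h i hi
  rw [e]; exact Link.refl _

theorem Forest.eq_of_joins {j : ι} (h : Forest a b J) (hi : i ∈ J) (hj : j ∈ J)
    (h1 : Joins a b i u v) (h2 : Joins a b j u v) : i = j := by
  by_contra hne
  exact h i hi (h1.edge_link (h2.link ⟨hj, fun e => hne e.symm⟩))

end Link

/-! ### Good pairs as forests on indexed edges -/

section GoodPair

variable {N : ℕ} {D : Type uD} {h1 h2 : D → Fin N} {S : Finset D} {L : ℕ}

theorem hashGraph_adj {u v : Fin N} :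
    (hashGraph h1 h2 S).Adj u v ↔ (∃ s ∈ S, Joins h1 h2 s u v) ∧ u ≠ v := by
  simp only [hashGraph, SimpleGraph.fromEdgeSet_adj, Set.mem_image, Finset.mem_coe, Joins,
    Sym2.eq_iff]
  constructor
  · rintro ⟨⟨s, hs, h⟩, k⟩
    refine ⟨⟨s, hs, ?_⟩, k⟩
    rcases h with ⟨h, h'⟩ | ⟨h, h'⟩ <;> simp [h, h']
  · rintro ⟨⟨s, hs, h⟩, k⟩
    refine ⟨⟨s, hs, ?_⟩, k⟩
    rcases h with ⟨h, h'⟩ | ⟨h, h'⟩ <;> simp [h, h']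

theorem hashGraph_reachable {u v : Fin N} :
    (hashGraph h1 h2 S).Reachable u v ↔ Link h1 h2 (S : Set D) u v := by
  rw [SimpleGraph.reachable_iff_reflTransGen]
  constructor
  · intro h
    exact Relation.ReflTransGen.mono
      (fun x y hxy => by simpa using (hashGraph_adj.1 hxy).1) _ _ h
  · intro h
    induction h with
    | refl => exact Relation.ReflTransGen.refl
    | @tail x y _ h ih =>
      by_cases e : x = y
      · exact e ▸ ih
      · exact ih.tail (hashGraph_adj.2 ⟨by simpa using h, e⟩)

/-- A graph is acyclic iff each edge is a bridge. Without loops and double edges, deleting the edge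
of `s` from the graph amounts to deleting the index `s`; a forest in the sense of `Forest` has
neither, as both would be cycles. -/
theorem goodPair_iff : GoodPair h1 h2 S L ↔ Forest h1 h2 (S : Set D) ∧
    ∀ v : Fin N, {w | Link h1 h2 (S : Set D) v w}.ncard ≤ L := by
  have hcomp : (∀ C : (hashGraph h1 h2 S).ConnectedComponent, C.supp.ncard ≤ L) ↔
      ∀ v : Fin N, {w | Link h1 h2 (S : Set D) v w}.ncard ≤ L := by
    have e : ∀ v : Fin N, ((hashGraph h1 h2 S).connectedComponentMk v).supp =
        {w | Link h1 h2 (S : Set D) v w} := by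
      intro v; ext w
      rw [SimpleGraph.ConnectedComponent.mem_supp_iff, SimpleGraph.ConnectedComponent.eq,
        hashGraph_reachable]
      exact ⟨Link.symm, Link.symm⟩
    constructor
    · intro h v; rw [← e]; exact h _
    · intro h C
      induction C using SimpleGraph.ConnectedComponent.ind with | _ v => rw [e]; exact h v
  have step : ∀ (hn : ∀ s ∈ S, h1 s ≠ h2 s)
      (hd : Set.InjOn (fun s => s(h1 s, h2 s)) (S : Set D)) (s : D), s ∈ S → ∀ u v : Fin N,
      (((hashGraph h1 h2 S).deleteEdges {s(h1 s, h2 s)}).Reachable u v ↔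
        Link h1 h2 ((S : Set D) \ {s}) u v) := by
    intro hn hd s hs u v
    rw [SimpleGraph.reachable_iff_reflTransGen, Link]
    refine iff_of_eq (congrArg (fun r => Relation.ReflTransGen r u v) ?_)
    funext x y
    rw [SimpleGraph.deleteEdges_adj, hashGraph_adj]
    refine propext ⟨?_, ?_⟩
    · rintro ⟨⟨⟨t, ht, hj⟩, hxy⟩, hne⟩
      refine ⟨t, ⟨ht, ?_⟩, hj⟩
      rintro rfl
      apply hne
      rcases hj with ⟨rfl, rfl⟩ | ⟨rfl, rfl⟩ <;> simp [Sym2.eq_swap]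
    · rintro ⟨t, ⟨ht, hts⟩, hj⟩
      refine ⟨⟨⟨t, ht, hj⟩, ?_⟩, ?_⟩
      · rcases hj with ⟨rfl, rfl⟩ | ⟨rfl, rfl⟩
        · exact hn t ht
        · exact (hn t ht).symm
      · intro he
        apply hts
        apply hd ht hs
        rw [Set.mem_singleton_iff] at he
        simp only
        rw [← he]
        rcases hj with ⟨rfl, rfl⟩ | ⟨rfl, rfl⟩ <;> simp [Sym2.eq_swap]
  constructor
  · intro h
    refine ⟨fun s hs k => ?_, hcomp.1 h.small⟩
    have hadj : (hashGraph h1 h2 S).Adj (h1 s) (h2 s) :=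
      hashGraph_adj.2 ⟨⟨s, hs, Or.inl ⟨rfl, rfl⟩⟩, h.no_loop s hs⟩
    have hb := SimpleGraph.isAcyclic_iff_forall_adj_isBridge.1 h.acyclic hadj
    rw [SimpleGraph.isBridge_iff] at hb
    exact hb ((step h.no_loop h.no_double_edge s hs _ _).2 k)
  · rintro ⟨hf, hs⟩
    have hn : ∀ s ∈ S, h1 s ≠ h2 s := fun s hs => hf.ne hs
    have hd : Set.InjOn (fun s => s(h1 s, h2 s)) (S : Set D) := by
      intro s hs t ht e
      refine hf.eq_of_joins hs ht (u := h1 s) (v := h2 s) (Or.inl ⟨rfl, rfl⟩) ?_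
      simpa [Joins] using e
    refine ⟨hn, hd, ?_, hcomp.2 hs⟩
    rw [SimpleGraph.isAcyclic_iff_forall_adj_isBridge]
    intro u v huv
    obtain ⟨⟨s, hs, hj⟩, _⟩ := hashGraph_adj.1 huv
    have e : s(u, v) = s(h1 s, h2 s) := by
      rcases hj with ⟨rfl, rfl⟩ | ⟨rfl, rfl⟩ <;> simp [Sym2.eq_swap]
    rw [e, SimpleGraph.isBridge_iff]
    intro hr
    exact hf s hs ((step hn hd s hs _ _).1 hr)

end GoodPair

/-! ## Reasoning about programs -/

section Runs

variable {D : Type uD} {E E' : Env D} {s t : Stmt} {b : Expr} {σ τ : State} {c : Cost}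
  {Q R : State → ℕ → Prop}

/-- The program halts, and its final state and its number of steps satisfy `Q`. -/
def Runs (E : Env D) (s : Stmt) (σ : State) (Q : State → ℕ → Prop) : Prop :=
  ∃ τ c, Exec E s σ τ c ∧ Q τ c.steps

theorem Cost.add_steps (x y : Cost) : (x + y).steps = x.steps + y.steps := rfl
theorem Cost.add_hashes (x y : Cost) : (x + y).hashes = x.hashes + y.hashes := rfl
theorem Cost.add_reads (x y : Cost) : (x + y).reads = x.reads + y.reads := rfl

theorem Runs.mono (h : Runs E s σ Q) (hQ : ∀ τ c, Q τ c → R τ c) : Runs E s σ R := by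
  obtain ⟨τ, c, h, k⟩ := h
  exact ⟨τ, c, h, hQ _ _ k⟩

/-- By determinism, what holds for one halting run holds for every run. -/
theorem Runs.of_exec (h : Runs E s σ Q) (k : Exec E s σ τ c) : Q τ c.steps := by
  obtain ⟨τ', c', h, hQ⟩ := h
  obtain ⟨rfl, rfl⟩ := h.det k
  exact hQ

/-- This rule and the following ones are equivalences, so that rewriting with them executes
straight-line code symbolically and adds up its cost. -/
theorem runs_skip : Runs E .skip σ Q ↔ Q σ 1 :=
  ⟨fun h => h.of_exec (.skip σ), fun h => ⟨_, _, .skip σ, h⟩⟩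

theorem runs_set {x : Var} {y : Expr} :
    Runs E (.set x y) σ Q ↔ Q (σ.setReg x (y.eval E σ)) (y.cost.steps + 1) :=
  ⟨fun h => h.of_exec (.set x y σ), fun h => ⟨_, _, .set x y σ, h⟩⟩

theorem runs_store {r : Arr} {j y : Expr} :
    Runs E (.store r j y) σ Q ↔
      Q (σ.setArr r (j.eval E σ) (y.eval E σ)) (j.cost.steps + y.cost.steps + 1) :=
  ⟨fun h => h.of_exec (.store r j y σ), fun h => ⟨_, _, .store r j y σ, h⟩⟩

theorem runs_redraw : Runs E .redraw σ Q ↔ Q { σ with trial := σ.trial + 1 } 1 :=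
  ⟨fun h => h.of_exec (.redraw σ), fun h => ⟨_, _, .redraw σ, h⟩⟩

theorem runs_seq : Runs E (.seq s t) σ Q ↔
    Runs E s σ fun τ c => Runs E t τ fun υ d => Q υ (c + d) := by
  constructor
  · rintro ⟨τ, c, h, hQ⟩
    cases h with
    | seq h k => exact ⟨_, _, h, _, _, k, hQ⟩
  · rintro ⟨τ, c, h, υ, d, k, hQ⟩
    exact ⟨_, _, .seq h k, hQ⟩

theorem runs_ite : Runs E (.ite b s t) σ Q ↔
    if b.eval E σ ≠ 0 then Runs E s σ fun τ c => Q τ (b.cost.steps + 1 + c)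
    else Runs E t σ fun τ c => Q τ (b.cost.steps + 1 + c) := by
  split_ifs with hb
  · constructor
    · rintro ⟨τ, c, h, hQ⟩
      cases h with
      | ite_true _ k => exact ⟨_, _, k, hQ⟩
      | ite_false hb' _ => exact absurd hb' hb
    · rintro ⟨τ, c, h, hQ⟩
      exact ⟨_, _, .ite_true hb h, hQ⟩
  · rw [not_not] at hb
    constructor
    · rintro ⟨τ, c, h, hQ⟩
      cases h with
      | ite_true hb' _ => exact absurd hb hb'
      | ite_false _ k => exact ⟨_, _, k, hQ⟩
    · rintro ⟨τ, c, h, hQ⟩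
      exact ⟨_, _, .ite_false hb h, hQ⟩

/-- A loop halts if each round is paid for by a decrease of the potential, the first argument
of the invariant. -/
theorem Runs.while' (Inv : ℕ → State → Prop) {k : ℕ} (hσ : Inv k σ)
    (step : ∀ k σ, Inv k σ → b.eval E σ ≠ 0 →
      Runs E s σ fun τ c => ∃ k', Inv k' τ ∧ c + (b.cost.steps + 1) + k' ≤ k)
    (done : ∀ k' τ c, Inv k' τ → b.eval E τ = 0 → c + k' ≤ k + (b.cost.steps + 1) → Q τ c) :
    Runs E (.while b s) σ Q := by
  suffices H : ∀ k σ, Inv k σ → Runs E (.while b s) σ fun τ c =>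
      ∃ k', Inv k' τ ∧ b.eval E τ = 0 ∧ c + k' ≤ k + (b.cost.steps + 1) from
    (H _ σ hσ).mono fun τ c ⟨k', h1, h2, h3⟩ => done k' τ c h1 h2 h3
  intro k
  -- Evaluating the guard costs at least one step, so each round strictly decreases the potential.
  induction k using Nat.strong_induction_on with
  | _ k ih =>
    intro σ hσ
    by_cases hb : b.eval E σ = 0
    · exact ⟨_, _, .while_false hb, k, hσ, hb, by simp only [Cost.add_steps]; omega⟩
    · obtain ⟨τ, c, h, k', hτ, hc⟩ := step k σ hσ hb
      obtain ⟨υ, d, h', k'', hυ, hb', hd⟩ := ih k' (by omega) τ hτ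
      exact ⟨_, _, .while_true hb h h', k'', hυ, hb', by simp only [Cost.add_steps]; omega⟩

/-- A loop halts if each round is paid for by a decrease of the potential `Φ`. -/
theorem Runs.while (Inv : State → Prop) (Φ : State → ℕ) (hσ : Inv σ)
    (step : ∀ σ, Inv σ → b.eval E σ ≠ 0 →
      Runs E s σ fun τ c => Inv τ ∧ c + (b.cost.steps + 1) + Φ τ ≤ Φ σ)
    (done : ∀ τ c, Inv τ → b.eval E τ = 0 → c + Φ τ ≤ Φ σ + (b.cost.steps + 1) → Q τ c) :
    Runs E (.while b s) σ Q := by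
  refine Runs.while' (fun k τ => Inv τ ∧ Φ τ = k) ⟨hσ, rfl⟩ ?_ ?_
  · rintro _ τ ⟨hτ, rfl⟩ hb
    exact (step τ hτ hb).mono fun υ c h => ⟨_, ⟨h.1, rfl⟩, h.2⟩
  · rintro _ τ c ⟨hτ, rfl⟩ hb hc
    exact done τ c hτ hb hc

/-- Partial correctness of a loop. -/
theorem Exec.while_inv (Inv : State → Prop) (hσ : Inv σ)
    (step : ∀ σ τ c, Inv σ → b.eval E σ ≠ 0 → Exec E s σ τ c → Inv τ)
    (h : Exec E (.while b s) σ τ c) : Inv τ ∧ b.eval E τ = 0 := by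
  generalize hw : Stmt.while b s = w at h
  induction h with
  | while_true hb h1 _ _ ih2 =>
    cases hw
    exact ih2 (step _ _ _ hσ hb h1) rfl
  | while_false hb => cases hw; exact ⟨hσ, hb⟩
  | _ => cases hw

/-- A bound on the pair number in the final state then bounds it throughout the run. -/
theorem Exec.trial_le (h : Exec E s σ τ c) : σ.trial ≤ τ.trial := by
  induction h with
  | skip | set | store => exact le_rfl
  | redraw => exact Nat.le_succ _
  | seq _ _ h k => exact h.trans k
  | ite_true _ _ h | ite_false _ _ h => exact h
  | while_true _ _ _ h k => exact h.trans k
  | while_false => exact le_rfl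

/-- Two environments cannot be distinguished by programs that use at most `T` pairs of hash
functions. -/
structure Env.Agree (E E' : Env D) (T : ℕ) : Prop where
  m : E.m = E'.m
  h1 : ∀ t ≤ T, ∀ j, E.h1 t (E.key j) = E'.h1 t (E'.key j)
  h2 : ∀ t ≤ T, ∀ j, E.h2 t (E.key j) = E'.h2 t (E'.key j)
  h3 : ∀ j, E.h3 (E.key j) = E'.h3 (E'.key j)

theorem Expr.eval_congr {T : ℕ} (hE : E.Agree E' T) (hσ : σ.trial ≤ T) (x : Expr) :
    x.eval E σ = x.eval E' σ := by
  induction x with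
  | lit | var => rfl
  | get _ _ ih | half _ ih => simp only [Expr.eval, ih]
  | bin _ _ _ ih1 ih2 => simp only [Expr.eval, ih1, ih2, hE.m]
  | hash1 _ ih => simp only [Expr.eval, ih, hE.h1 _ hσ]
  | hash2 _ ih => simp only [Expr.eval, ih, hE.h2 _ hσ]
  | hash3 _ ih => simp only [Expr.eval, ih, hE.h3]

/-- A run reads hash values only at the listed keys and for pair numbers up to the final one. This
is the source of measurability and of the independence of the store from `h₃(x)` for `x ∉ S`. -/
theorem Exec.congr {T : ℕ} (hE : E.Agree E' T) (h : Exec E s σ τ c) (hτ : τ.trial ≤ T) :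
    Exec E' s σ τ c := by
  induction h with
  | skip σ => exact .skip σ
  | set x y σ =>
    have hσ : σ.trial ≤ T := hτ
    rw [Expr.eval_congr hE hσ]
    exact .set x y σ
  | store r j y σ =>
    have hσ : σ.trial ≤ T := hτ
    rw [Expr.eval_congr hE hσ, Expr.eval_congr hE hσ]
    exact .store r j y σ
  | redraw σ => exact .redraw σ
  | seq _ k ih1 ih2 => exact .seq (ih1 (k.trial_le.trans hτ)) (ih2 hτ)
  | ite_true hb k ih =>
    rw [Expr.eval_congr hE (k.trial_le.trans hτ)] at hb
    exact .ite_true hb (ih hτ)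
  | ite_false hb k ih =>
    rw [Expr.eval_congr hE (k.trial_le.trans hτ)] at hb
    exact .ite_false hb (ih hτ)
  | while_true hb k1 k2 ih1 ih2 =>
    rw [Expr.eval_congr hE (k1.trial_le.trans (k2.trial_le.trans hτ))] at hb
    exact .while_true hb (ih1 (k2.trial_le.trans hτ)) (ih2 hτ)
  | while_false hb =>
    rw [Expr.eval_congr hE hτ] at hb
    exact .while_false hb

end Runs

/-! ### Reading registers and arrays after a write -/

@[simp] theorem State.setReg_reg (σ : State) (x z : Var) (y : ℕ) :
    (σ.setReg x y).reg z = if z = x then y else σ.reg z := by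
  simp [State.setReg, Function.update_apply]

@[simp] theorem State.setReg_arr (σ : State) (x : Var) (y : ℕ) : (σ.setReg x y).arr = σ.arr := rfl

@[simp] theorem State.setReg_trial (σ : State) (x : Var) (y : ℕ) :
    (σ.setReg x y).trial = σ.trial := rfl

@[simp] theorem State.setArr_reg (σ : State) (r : Arr) (j y : ℕ) :
    (σ.setArr r j y).reg = σ.reg := rfl

@[simp] theorem State.setArr_arr (σ : State) (r r' : Arr) (j y : ℕ) :
    (σ.setArr r j y).arr r' = if r' = r then Function.update (σ.arr r) j y else σ.arr r' := by
  simp only [State.setArr, Function.update_apply]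

@[simp] theorem State.setArr_trial (σ : State) (r : Arr) (j y : ℕ) :
    (σ.setArr r j y).trial = σ.trial := rfl

section

variable (m x y : ℕ)

theorem BinOp.eval_add : BinOp.add.eval m x y = x + y := rfl
theorem BinOp.eval_sub : BinOp.sub.eval m x y = x - y := rfl
theorem BinOp.eval_addMod :
    BinOp.addMod.eval m x y = ((x : ZMod m) + (y : ZMod m)).val := rfl
theorem BinOp.eval_subMod :
    BinOp.subMod.eval m x y = ((x : ZMod m) - (y : ZMod m)).val := rfl
theorem BinOp.eval_lt : BinOp.lt.eval m x y = if x < y then 1 else 0 := rfl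
theorem BinOp.eval_eq : BinOp.eq.eval m x y = if x = y then 1 else 0 := rfl
theorem BinOp.eval_ne : BinOp.ne.eval m x y = if x = y then 0 else 1 := rfl

end

attribute [local simp] runs_skip runs_set runs_store runs_redraw runs_seq runs_ite block incr ltVar
  edgeOf Expr.eval BinOp.eval_add BinOp.eval_sub BinOp.eval_addMod BinOp.eval_subMod
  BinOp.eval_lt BinOp.eval_eq BinOp.eval_ne Expr.cost Cost.add_steps

/-! ## Half-edges and adjacency lists -/

/-- The vertex from which the half-edge `e` leads; the half-edge leads to `halfSrc b a e`. -/
def halfSrc (a b : ℕ → ℕ) (e : ℕ) : ℕ := if e % 2 = 1 then a ((e - 1) / 2) else b ((e - 1) / 2)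

/-- The half-edges out of `w` with numbers at most `k`, the largest first. -/
def outList (a b : ℕ → ℕ) (w : ℕ) : ℕ → List ℕ
  | 0 => []
  | k + 1 => if halfSrc a b (k + 1) = w then (k + 1) :: outList a b w k else outList a b w k

/-- Following the pointers `next` from `e` to `0` gives the list `l`. -/
def OutChain (next : ℕ → ℕ) : ℕ → List ℕ → Prop
  | e, [] => e = 0
  | e, x :: l => e = x ∧ x ≠ 0 ∧ OutChain next (next x) l

/-- The arrays hold the adjacency lists of the half-edges `1, …, k` on the vertices below `N`. -/
structure AdjLists (a b : ℕ → ℕ) (N k : ℕ) (head next tgt : ℕ → ℕ) : Prop where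
  chain : ∀ w < N, OutChain next (head w) (outList a b w k)
  tgt_eq : ∀ e, 1 ≤ e → e ≤ k → tgt e = halfSrc b a e

section

variable {a b : ℕ → ℕ} {N n k w e e' : ℕ} {next : ℕ → ℕ}

theorem mem_outList : e ∈ outList a b w k ↔ 1 ≤ e ∧ e ≤ k ∧ halfSrc a b e = w := by
  induction k with
  | zero => simp [outList]; omega
  | succ k ih =>
    rw [outList]
    split_ifs with h
    · rw [List.mem_cons, ih]
      constructor
      · rintro (rfl | h') <;> [exact ⟨by omega, le_rfl, h⟩; exact ⟨h'.1, by omega, h'.2.2⟩]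
      · rintro ⟨h1, h2, h3⟩
        rcases Nat.lt_or_ge k e with h4 | h4
        · left; omega
        · exact Or.inr ⟨h1, h4, h3⟩
    · rw [ih]
      constructor
      · rintro h'; exact ⟨h'.1, by omega, h'.2.2⟩
      · rintro ⟨h1, h2, h3⟩
        refine ⟨h1, ?_, h3⟩
        by_contra h4
        exact h ((by omega : e = k + 1) ▸ h3)

theorem nodup_outList : (outList a b w k).Nodup := by
  induction k with
  | zero => simp [outList]
  | succ k ih =>
    rw [outList]
    split_ifs with h
    · refine List.nodup_cons.2 ⟨fun h' => ?_, ih⟩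
      have := (mem_outList.1 h').2.1
      omega
    · exact ih

theorem OutChain.congr {next' : ℕ → ℕ} {l : List ℕ} (h : OutChain next e l)
    (hl : ∀ x ∈ l, next' x = next x) : OutChain next' e l := by
  induction l generalizing e with
  | nil => exact h
  | cons x l ih =>
    obtain ⟨h1, h2, h3⟩ := h
    refine ⟨h1, h2, ?_⟩
    rw [hl x List.mem_cons_self]
    exact ih h3 fun y hy => hl y (List.mem_cons_of_mem x hy)

theorem halfSrc_odd (i : ℕ) : halfSrc a b (2 * i + 1) = a i := by
  rw [halfSrc, if_pos (by omega)]; congr 1; omega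

theorem halfSrc_even (i : ℕ) : halfSrc a b (2 * i + 2) = b i := by
  rw [halfSrc, if_neg (by omega)]; congr 1; omega

theorem joins_half : Joins a b ((e - 1) / 2) (halfSrc a b e) (halfSrc b a e) := by
  rw [halfSrc, halfSrc]
  split_ifs
  · exact Or.inl ⟨rfl, rfl⟩
  · exact Or.inr ⟨rfl, rfl⟩

theorem halfSrc_lt (ha : ∀ i < n, a i < N) (hb : ∀ i < n, b i < N) (h1 : 1 ≤ e)
    (h2 : e ≤ 2 * n) : halfSrc a b e < N := by
  rw [halfSrc]
  split_ifs
  · exact ha _ (by omega)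
  · exact hb _ (by omega)

/-- The two half-edges of an edge. -/
theorem half_twin (h1 : 1 ≤ e) (h2 : 1 ≤ e') (h : (e + 1) / 2 = (e' + 1) / 2) :
    e = e' ∨ (halfSrc a b e = halfSrc b a e' ∧ halfSrc b a e = halfSrc a b e') := by
  have hd : (e - 1) / 2 = (e' - 1) / 2 := by omega
  by_cases he : e = e'
  · exact Or.inl he
  right
  simp only [halfSrc, hd]
  rcases Nat.mod_two_eq_zero_or_one e with h3 | h3
  · have h4 : e' % 2 = 1 := by omega
    simp [h3, h4]
  · have h4 : e' % 2 = 0 := by omega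
    simp [h3, h4]

/-- The new half-edge becomes the head of its list. The old chains contain only smaller numbers, so
they do not notice the new entry of `next`. -/
theorem AdjLists.push {head next tgt : ℕ → ℕ} (h : AdjLists a b N k head next tgt) {u v : ℕ}
    (hu : halfSrc a b (k + 1) = u) (hv : halfSrc b a (k + 1) = v) :
    AdjLists a b N (k + 1) (Function.update head u (k + 1))
      (Function.update next (k + 1) (head u)) (Function.update tgt (k + 1) v) := by
  constructor
  · intro w hw
    have hc : OutChain (Function.update next (k + 1) (head u)) (head w) (outList a b w k) :=
      (h.chain w hw).congr fun x hx => by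
        rw [Function.update_of_ne]
        have := (mem_outList.1 hx).2.1
        omega
    rw [outList]
    split_ifs with hk
    · have hwu : w = u := hk.symm.trans hu
      subst hwu
      rw [Function.update_self]
      exact ⟨rfl, by omega, by rwa [Function.update_self]⟩
    · rw [Function.update_of_ne (fun e => hk (hu.trans e.symm))]
      exact hc
  · intro e h1 h2
    rcases eq_or_ne e (k + 1) with rfl | he
    · rw [Function.update_self, hv]
    · rw [Function.update_of_ne he]
      exact h.tgt_eq e h1 (by omega)

end

/-- The parts of a state that are left alone in a round of the creation. -/
structure Frame (σ τ : State) : Prop where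
  numKeys : τ.reg .numKeys = σ.reg .numKeys
  numCells : τ.reg .numCells = σ.reg .numCells
  maxComp : τ.reg .maxComp = σ.reg .maxComp
  val : τ.arr .val = σ.arr .val
  trial : τ.trial = σ.trial

theorem runs_buildGraph {D : Type uD} {E : Env D} {σ : State} {a b : ℕ → ℕ}
    (ha : ∀ i < σ.reg .numKeys, E.h1 σ.trial (E.key i) = a i)
    (hb' : ∀ i < σ.reg .numKeys, E.h2 σ.trial (E.key i) = b i) :
    Runs E buildGraph σ fun τ c => Frame σ τ ∧
      AdjLists a b (σ.reg .numCells) (2 * σ.reg .numKeys)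
        (τ.arr .head) (τ.arr .next) (τ.arr .tgt) ∧
      (∀ w < σ.reg .numCells, τ.arr .seen w = 0) ∧
      c ≤ 30 * σ.reg .numCells + 70 * σ.reg .numKeys + 30 := by
  simp only [buildGraph, block, runs_seq, runs_set]
  -- The constant `30` here, and `70` in the next loop, generously bound the cost of one round.
  refine Runs.while
    (fun τ => Frame σ τ ∧ τ.reg .i ≤ σ.reg .numCells ∧
      ∀ w < τ.reg .i, τ.arr .head w = 0 ∧ τ.arr .seen w = 0)
    (fun τ => 30 * (σ.reg .numCells - τ.reg .i)) ?_ ?_ ?_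
  · refine ⟨⟨?_, ?_, ?_, ?_, ?_⟩, ?_, ?_⟩ <;> simp
  · rintro τ ⟨hF, hi, hz⟩ hb
    have hN := hF.numCells
    simp [hN] at hb
    simp
    refine ⟨⟨⟨?_, ?_, ?_, ?_, ?_⟩, ?_, ?_⟩, ?_⟩
    · simp [hF.numKeys]
    · simp [hF.numCells]
    · simp [hF.maxComp]
    · simp [hF.val]
    · simp [hF.trial]
    · omega
    · intro w hw
      rcases eq_or_ne w (τ.reg .i) with rfl | hne
      · simp
      · simp only [Function.update_of_ne hne]
        exact hz w (by omega)
    · omega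
  · rintro τ c ⟨hF, hi, hz⟩ hb hc
    have hN := hF.numCells
    simp [hN] at hb hc
    have hz : ∀ w < σ.reg .numCells, τ.arr .head w = 0 ∧ τ.arr .seen w = 0 :=
      fun w hw => hz w (by omega)
    clear hb
    -- After `i` keys the half-edges `1, …, 2i` are in place. Numbering starts at `1` because `0`
    -- ends a list.
    refine Runs.while
      (fun υ => Frame σ υ ∧ υ.reg .i ≤ σ.reg .numKeys ∧ υ.reg .e = 2 * υ.reg .i + 1 ∧
        AdjLists a b (σ.reg .numCells) (2 * υ.reg .i)
          (υ.arr .head) (υ.arr .next) (υ.arr .tgt) ∧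
        ∀ w < σ.reg .numCells, υ.arr .seen w = 0)
      (fun υ => 70 * (σ.reg .numKeys - υ.reg .i)) ?_ ?_ ?_
    · refine ⟨⟨?_, ?_, ?_, ?_, ?_⟩, ?_, ?_, ⟨?_, ?_⟩, ?_⟩
      · simp [hF.numKeys]
      · simp [hF.numCells]
      · simp [hF.maxComp]
      · simp [hF.val]
      · simp [hF.trial]
      · simp
      · simp
      · intro w hw
        simpa [outList, OutChain] using (hz w hw).1
      · intro e h1 h2
        simp at h2
        omega
      · intro w hw
        simpa using (hz w hw).2
    · rintro υ ⟨hF, hi, he, hA, hs⟩ hb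
      have hK := hF.numKeys
      simp [hK] at hb
      simp [hF.trial, ha _ hb, hb' _ hb, he]
      refine ⟨⟨⟨?_, ?_, ?_, ?_, ?_⟩, ?_, ?_, ?_, ?_⟩, ?_⟩
      · simp [hF.numKeys]
      · simp [hF.numCells]
      · simp [hF.maxComp]
      · simp [hF.val]
      · simp [hF.trial]
      · omega
      · omega
      · have h1 := hA.push (u := a (υ.reg .i)) (v := b (υ.reg .i))
          (halfSrc_odd _) (halfSrc_odd _)
        have h2 := h1.push (u := b (υ.reg .i)) (v := a (υ.reg .i))
          (halfSrc_even _) (halfSrc_even _)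
        exact h2
      · exact hs
      · omega
    · rintro υ d ⟨hF, hi, he, hA, hs⟩ hb hd
      have hK := hF.numKeys
      simp [hK] at hb hd
      refine ⟨hF, ?_, hs, ?_⟩
      · rwa [show σ.reg .numKeys = υ.reg .i by omega]
      · simp
        omega

/-! ## Breadth first search -/

section

variable {a b : ℕ → ℕ} {N n L s q p : ℕ} {Q via pred seen : ℕ → ℕ} {ok e w u v : ℕ} {l : List ℕ}

theorem exists_half {i : ℕ} (hi : i < n) (h : Joins a b i u v) :
    ∃ e, 1 ≤ e ∧ e ≤ 2 * n ∧ halfSrc a b e = u ∧ halfSrc b a e = v := by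
  rcases h with ⟨rfl, rfl⟩ | ⟨rfl, rfl⟩
  · exact ⟨2 * i + 1, by omega, by omega, halfSrc_odd i, halfSrc_odd i⟩
  · exact ⟨2 * i + 2, by omega, by omega, halfSrc_even i, halfSrc_even i⟩

theorem link_half (h1 : 1 ≤ e) (h2 : e ≤ 2 * n) :
    Link a b (Set.Iio n) (halfSrc a b e) (halfSrc b a e) :=
  joins_half.link (show (e - 1) / 2 < n by omega)

/-- In a forest, an exploration does not return to a vertex: the vertices `Q s, …, Q (q - 1)` have
been found, `Q k` through the half-edge `x k` from an earlier vertex. -/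
theorem Forest.fresh {J : Set ℕ} (hf : Forest a b J) {x : ℕ → ℕ}
    (inj : ∀ j k, s ≤ j → j < q → s ≤ k → k < q → Q j = Q k → j = k)
    (tree : ∀ k, s < k → k < q → 1 ≤ x k ∧ (x k - 1) / 2 ∈ J ∧ halfSrc b a (x k) = Q k ∧
      ∃ j, s ≤ j ∧ j < k ∧ Q j = halfSrc a b (x k))
    {p : ℕ} (hp : s ≤ p) (hpq : p < q) (he : 1 ≤ e) (heJ : (e - 1) / 2 ∈ J)
    (hsrc : Q p = halfSrc a b e)
    (hne : s < p → (e + 1) / 2 ≠ (x p + 1) / 2) (hnew : ∀ k, s < k → k < q → x k ≠ e)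
    {k : ℕ} (hk : s ≤ k) (hkq : k < q) : Q k ≠ halfSrc b a e := by
  intro hdst
  -- The edges used by the exploration; they link all vertices found so far.
  set V : Set ℕ := {i | ∃ k, s < k ∧ k < q ∧ (x k - 1) / 2 = i} with hV
  have hlink : ∀ k, s ≤ k → k < q → Link a b V (Q s) (Q k) := by
    intro k
    induction k using Nat.strong_induction_on with
    | _ k ih =>
      intro h1 h2
      rcases Nat.eq_or_lt_of_le h1 with rfl | h1
      · exact Link.refl _
      obtain ⟨h3, h4, h5, j, h6, h7, h8⟩ := tree k h1 h2
      refine (ih j h7 h6 (by omega)).trans ?_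
      rw [h8, ← h5]
      exact joins_half.link ⟨k, h1, h2, rfl⟩
  -- If the edge of `e` had been used, then either through `e` itself, which `hnew` excludes, or
  -- through its twin. The twin leads to `Q p`, so `Q p` was found through this edge, against `hne`.
  have hnot : (e - 1) / 2 ∉ V := by
    rintro ⟨j, h1, h2, h3⟩
    obtain ⟨h4, h5, h6, i, h7, h8, h9⟩ := tree j h1 h2
    have h10 : (x j + 1) / 2 = (e + 1) / 2 := by omega
    rcases half_twin (a := a) (b := b) h4 he h10 with h | ⟨_, h⟩
    · exact hnew j h1 h2 h
    · have : j = p := inj j p h1.le h2 hp hpq (by rw [hsrc, ← h, h6])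
      subst this
      exact hne h1 h10.symm
  -- A return would link both ends of the edge of `e` by exploration edges, and hence without this
  -- edge.
  refine hf _ heJ (joins_half.edge_link (((hlink p hp hpq).symm.trans (hlink k hk hkq)).mono ?_ |>
    fun h => by rwa [hsrc, hdst] at h))
  rintro _ ⟨j, h1, h2, rfl⟩
  refine ⟨(tree j h1 h2).2.1, fun h => hnot ⟨j, h1, h2, h⟩⟩

/-- The half-edge `e` has been looked at: it leads out of one of the first `p` vertices of the
queue, and is not one of those in `l`. -/
structure Scanned (a b : ℕ → ℕ) (n : ℕ) (Q : ℕ → ℕ) (p : ℕ) (l : List ℕ) (e : ℕ) : Prop where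
  pos : 1 ≤ e
  le : e ≤ 2 * n
  src : ∃ k < p, Q k = halfSrc a b e
  notMem : e ∉ l

/-- The situation during the search: the queue consists of `Q 0, …, Q (q - 1)`, the current
component begins with `Q s`, the first `p` vertices have been processed apart from the
half-edges in `l`, which lead out of `Q (p - 1)`. -/
structure Search (a b : ℕ → ℕ) (n N L : ℕ) (Q via pred seen : ℕ → ℕ) (ok s q p : ℕ) (l : List ℕ) :
    Prop where
  le : s ≤ p
  le' : p ≤ q
  lt : ∀ k < q, Q k < N
  inj : ∀ j < q, ∀ k < q, Q j = Q k → j = k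
  seen_iff : ∀ w < N, seen w ≠ 0 ↔ ∃ k < q, Q k = w
  tree : ∀ k < q, via (Q k) ≠ 0 → halfSrc b a (via (Q k)) = Q k ∧
    pred (Q k) = halfSrc a b (via (Q k)) ∧ ∃ j < k, Q j = halfSrc a b (via (Q k))
  root : s < q → via (Q s) = 0
  comp : ∀ k, s < k → k < q → via (Q k) ≠ 0 ∧ ∃ j, s ≤ j ∧ j < k ∧ Q j = halfSrc a b (via (Q k))
  closed : ∀ e, Scanned a b n Q s [] e → ∃ k < s, Q k = halfSrc b a e
  scan_mem : ∀ e, Scanned a b n Q p l e → ∃ k < q, Q k = halfSrc b a e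
  scan_ok : ok ≠ 0 → ∀ e, Scanned a b n Q p l e →
    (e + 1) / 2 = (via (halfSrc a b e) + 1) / 2 ∨ via (halfSrc b a e) = e
  via_scan : ∀ k < q, via (Q k) ≠ 0 → Scanned a b n Q p l (via (Q k))
  good : Forest a b (Set.Iio n) → (∀ v < N, {w | Link a b (Set.Iio n) v w}.ncard ≤ L) → ok ≠ 0
  small : ok ≠ 0 → ∀ k < s, {w | Link a b (Set.Iio n) (Q k) w}.ncard ≤ L

theorem Scanned.congr {Q' : ℕ → ℕ} (h : Scanned a b n Q p l e) (hQ : ∀ k < p, Q' k = Q k) :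
    Scanned a b n Q' p l e := by
  obtain ⟨h1, h2, ⟨k, hk, h3⟩, h4⟩ := h
  exact ⟨h1, h2, ⟨k, hk, (hQ k hk).trans h3⟩, h4⟩

/-- Appending a vertex to the queue, as the first of a component or found through `e`. -/
theorem Search.enqueue {l' : List ℕ} (h : Search a b n N L Q via pred seen ok s q p l)
    (hl : ∀ x ∉ l', x ∉ l ∨ (x = e ∧ e ≠ 0)) (hl' : l' ⊆ l) (hw : w < N)
    (hseen : seen w = 0) (hend : s < q → e ≠ 0) (hstart : s = q → e = 0)
    (he : e ≠ 0 → Scanned a b n Q p l' e ∧ halfSrc b a e = w ∧ u = halfSrc a b e ∧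
      ∃ j, s ≤ j ∧ j < q ∧ Q j = halfSrc a b e) :
    Search a b n N L (Function.update Q q w) (Function.update via w e) (Function.update pred w u)
      (Function.update seen w 1) ok s (q + 1) p l' := by
  have hnew : ∀ k < q, Q k ≠ w := fun k hk hkw => (h.seen_iff w hw).2 ⟨k, hk, hkw⟩ hseen
  have hQ : ∀ k < q, Function.update Q q w k = Q k := fun k hk =>
    Function.update_of_ne (by omega) _ _
  have hQq : Function.update Q q w q = w := Function.update_self _ _ _
  have hvia : ∀ k < q, Function.update via w e (Q k) = via (Q k) := fun k hk =>
    Function.update_of_ne (hnew k hk) _ _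
  have hpred : ∀ k < q, Function.update pred w u (Q k) = pred (Q k) := fun k hk =>
    Function.update_of_ne (hnew k hk) _ _
  have hsc : ∀ x, Scanned a b n (Function.update Q q w) p l' x ↔ Scanned a b n Q p l' x := fun x =>
    ⟨fun k => k.congr fun j hj => (hQ j (by have := h.le'; omega)).symm,
      fun k => k.congr fun j hj => hQ j (by have := h.le'; omega)⟩
  -- Only `e` can become a scanned half-edge here.
  have hsc' : ∀ x, Scanned a b n Q p l' x → Scanned a b n Q p l x ∨ (x = e ∧ e ≠ 0) := by
    rintro x ⟨h1, h2, h3, h4⟩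
    exact (hl x h4).imp_left fun h5 => ⟨h1, h2, h3, h5⟩
  have hsq : s ≤ q := h.le.trans h.le'
  refine ⟨h.le, h.le'.trans (Nat.le_succ q), ?_, ?_, ?_, ?_, ?_, ?_, ?_, ?_, ?_, ?_, h.good, ?_⟩
  · intro k hk
    rcases Nat.lt_succ_iff_lt_or_eq.1 hk with hk | rfl
    · rw [hQ k hk]; exact h.lt k hk
    · rwa [hQq]
  · intro j hj k hk hjk
    rcases Nat.lt_succ_iff_lt_or_eq.1 hj with hj | rfl <;>
      rcases Nat.lt_succ_iff_lt_or_eq.1 hk with hk | rfl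
    · rw [hQ j hj, hQ k hk] at hjk; exact h.inj j hj k hk hjk
    · rw [hQ j hj, hQq] at hjk; exact absurd hjk (hnew j hj)
    · rw [hQ k hk, hQq] at hjk; exact absurd hjk.symm (hnew k hk)
    · rfl
  · intro x hx
    rcases eq_or_ne x w with rfl | hxw
    · simp only [Function.update_self]
      exact ⟨fun _ => ⟨q, by omega, hQq⟩, fun _ => one_ne_zero⟩
    · rw [Function.update_of_ne hxw, h.seen_iff x hx]
      constructor
      · rintro ⟨k, hk, hkx⟩; exact ⟨k, by omega, by rw [hQ k hk, hkx]⟩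
      · rintro ⟨k, hk, hkx⟩
        rcases Nat.lt_succ_iff_lt_or_eq.1 hk with hk | rfl
        · exact ⟨k, hk, by rw [← hQ k hk, hkx]⟩
        · rw [hQq] at hkx; exact absurd hkx.symm hxw
  · intro k hk hv
    rcases Nat.lt_succ_iff_lt_or_eq.1 hk with hk | rfl
    · rw [hQ k hk, hvia k hk] at *
      obtain ⟨h1, h2, j, hj, h3⟩ := h.tree k hk hv
      refine ⟨h1, by rwa [hpred k hk], j, hj, by rwa [hQ j (by omega)]⟩
    · rw [hQq, Function.update_self] at *
      obtain ⟨h1, h2, h3, j, _, hj, h4⟩ := he hv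
      exact ⟨h2, by rwa [Function.update_self], j, hj, by rwa [hQ j hj]⟩
  · intro _
    rcases Nat.eq_or_lt_of_le hsq with hs | hs
    · subst hs; rw [hQq, Function.update_self]; exact hstart rfl
    · rw [hQ s hs, hvia s hs]; exact h.root hs
  · intro k hs hk
    rcases Nat.lt_succ_iff_lt_or_eq.1 hk with hk | rfl
    · rw [hQ k hk, hvia k hk]
      obtain ⟨h1, j, h2, hj, h3⟩ := h.comp k hs hk
      exact ⟨h1, j, h2, hj, by rwa [hQ j (by omega)]⟩
    · rw [hQq, Function.update_self]
      refine ⟨hend hs, ?_⟩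
      obtain ⟨h1, h2, h3, j, h5, hj, h4⟩ := he (hend hs)
      exact ⟨j, h5, hj, by rwa [hQ j hj]⟩
  · intro x hx
    obtain ⟨k, hk, h1⟩ := h.closed x (hx.congr fun j hj => (hQ j (by omega)).symm)
    exact ⟨k, hk, by rwa [hQ k (by omega)]⟩
  · intro x hx
    rcases hsc' x ((hsc x).1 hx) with hx | ⟨rfl, hx⟩
    · obtain ⟨k, hk, h1⟩ := h.scan_mem x hx
      exact ⟨k, by omega, by rwa [hQ k hk]⟩
    · exact ⟨q, by omega, by rw [hQq, (he hx).2.1]⟩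
  · intro hok x hx
    rcases hsc' x ((hsc x).1 hx) with hx | ⟨rfl, hx⟩
    swap
    · right; rw [(he hx).2.1, Function.update_self]
    obtain ⟨k, hk, h1⟩ := hx.src
    obtain ⟨j, hj, h2⟩ := h.scan_mem x hx
    rw [← h1, ← h2, hvia k (by have := h.le'; omega), hvia j hj, h1, h2]
    exact h.scan_ok hok x hx
  · intro k hk hv
    rw [hsc]
    rcases Nat.lt_succ_iff_lt_or_eq.1 hk with hk | rfl
    · rw [hQ k hk, hvia k hk] at *
      obtain ⟨h1, h2, h3, h4⟩ := h.via_scan k hk hv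
      exact ⟨h1, h2, h3, fun h5 => h4 (hl' h5)⟩
    · rw [hQq, Function.update_self] at *
      exact (he hv).1
  · intro hok k hk
    rw [hQ k (by omega)]
    exact h.small hok k hk

/-- Beginning to process the next vertex. -/
theorem Search.pop (h : Search a b n N L Q via pred seen ok s q p []) (hp : p < q) :
    Search a b n N L Q via pred seen ok s q (p + 1) (outList a b (Q p) (2 * n)) := by
  -- All half-edges out of the new vertex are pending, so that the set of scanned half-edges does
  -- not change.
  have hsc : ∀ x, Scanned a b n Q (p + 1) (outList a b (Q p) (2 * n)) x ↔
      Scanned a b n Q p [] x := by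
    intro x
    constructor
    · rintro ⟨h1, h2, ⟨k, hk, h3⟩, h4⟩
      refine ⟨h1, h2, ⟨k, ?_, h3⟩, by simp⟩
      rcases Nat.lt_succ_iff_lt_or_eq.1 hk with hk | rfl
      · exact hk
      · exact absurd (mem_outList.2 ⟨h1, h2, h3.symm⟩) h4
    · rintro ⟨h1, h2, ⟨k, hk, h3⟩, h4⟩
      refine ⟨h1, h2, ⟨k, by omega, h3⟩, fun h5 => ?_⟩
      have := h.inj k (by omega) p hp (by rw [h3, (mem_outList.1 h5).2.2])
      omega
  exact ⟨h.le.trans (Nat.le_succ p), hp, h.lt, h.inj, h.seen_iff, h.tree, h.root, h.comp, h.closed,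
    fun x hx => h.scan_mem x ((hsc x).1 hx), fun hok x hx => h.scan_ok hok x ((hsc x).1 hx),
    fun k hk hv => (hsc _).2 (h.via_scan k hk hv), h.good, h.small⟩

/-- Passing over a half-edge. -/
theorem Search.scan {ok' : ℕ} (h : Search a b n N L Q via pred seen ok s q p (e :: l))
    (hmem : ∃ k < q, Q k = halfSrc b a e)
    (hok : ok' ≠ 0 → ok ≠ 0)
    (hscan : ok' ≠ 0 → (e + 1) / 2 = (via (halfSrc a b e) + 1) / 2 ∨ via (halfSrc b a e) = e)
    (hgood : Forest a b (Set.Iio n) → (∀ v < N, {w | Link a b (Set.Iio n) v w}.ncard ≤ L) →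
      ok' ≠ 0) :
    Search a b n N L Q via pred seen ok' s q p l := by
  have hsc : ∀ x, Scanned a b n Q p l x → x = e ∨ Scanned a b n Q p (e :: l) x := by
    rintro x ⟨h1, h2, h3, h4⟩
    by_cases hx : x = e
    · exact Or.inl hx
    · exact Or.inr ⟨h1, h2, h3, by simp [hx, h4]⟩
  refine ⟨h.le, h.le', h.lt, h.inj, h.seen_iff, h.tree, h.root, h.comp, h.closed, ?_, ?_, ?_,
    hgood, fun h1 => h.small (hok h1)⟩
  · intro x hx
    rcases hsc x hx with rfl | hx
    · exact hmem
    · exact h.scan_mem x hx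
  · intro h1 x hx
    rcases hsc x hx with rfl | hx
    · exact hscan h1
    · exact h.scan_ok (hok h1) x hx
  · intro k hk hv
    obtain ⟨h1, h2, h3, h4⟩ := h.via_scan k hk hv
    exact ⟨h1, h2, h3, fun h5 => h4 (List.mem_cons_of_mem e h5)⟩

/-- Passing over the edge through which the current vertex was found. -/
theorem Search.scan_back (h : Search a b n N L Q via pred seen ok s q p (e :: l)) (he : 1 ≤ e)
    (hsp : s < p) (hsrc : Q (p - 1) = halfSrc a b e)
    (hv : (e + 1) / 2 = (via (Q (p - 1)) + 1) / 2) :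
    Search a b n N L Q via pred seen ok s q p l := by
  have hpq := h.le'
  refine h.scan ?_ id (fun _ => Or.inl (by rwa [← hsrc])) h.good
  have hv0 : via (Q (p - 1)) ≠ 0 := by omega
  obtain ⟨h1, h2, j, hj, h3⟩ := h.tree (p - 1) (by omega) hv0
  -- The half-edge through which the vertex was found is already scanned, hence not pending; so `e`
  -- is its twin and leads back to the predecessor.
  rcases half_twin (a := a) (b := b) he (by omega) hv with h4 | ⟨_, h4⟩
  · exact absurd (h4 ▸ List.mem_cons_self) (h.via_scan (p - 1) (by omega) hv0).notMem
  · exact ⟨j, by omega, by rw [h4, h3]⟩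

/-- Meeting a vertex for the second time. -/
theorem Search.scan_seen (h : Search a b n N L Q via pred seen ok s q p (e :: l)) (he : 1 ≤ e)
    (hen : e ≤ 2 * n)
    (hsp : s < p) (hsrc : Q (p - 1) = halfSrc a b e)
    (hv : (e + 1) / 2 ≠ (via (Q (p - 1)) + 1) / 2) (hw : halfSrc b a e < N)
    (hseen : seen (halfSrc b a e) ≠ 0) :
    Search a b n N L Q via pred seen 0 s q p l := by
  have hpq := h.le'
  -- With `ok = 0` the clauses about success are void. What remains is to show that the multigraph
  -- is not a forest.
  refine h.scan ((h.seen_iff _ hw).1 hseen) (absurd rfl) (absurd rfl) fun hf _ => False.elim ?_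
  obtain ⟨k, hk, hkw⟩ := (h.seen_iff _ hw).1 hseen
  -- Earlier components are closed: if the vertex met belonged to one, then the reverse half-edge
  -- `f` would place the current vertex there too.
  have hks : s ≤ k := by
    by_contra hks
    obtain ⟨f, hf1, hf2, hf3, hf4⟩ : ∃ f, 1 ≤ f ∧ f ≤ 2 * n ∧ halfSrc a b f = halfSrc b a e ∧
        halfSrc b a f = halfSrc a b e :=
      exists_half (show (e - 1) / 2 < n by omega) joins_half.symm
    obtain ⟨j, hj, hj1⟩ := h.closed f ⟨hf1, hf2, ⟨k, by omega, by rw [hkw, hf3]⟩, by simp⟩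
    have := h.inj j (by omega) (p - 1) (by omega) (by rw [hj1, hf4, hsrc])
    omega
  refine hf.fresh (Q := Q) (s := s) (q := q) (x := fun k => via (Q k))
    (fun j k _ hj _ hk => h.inj j hj k hk) ?_ (p := p - 1) (by omega) (by omega) he
    (show (e - 1) / 2 < n by omega) hsrc (fun _ => hv) ?_ hks hk hkw
  · intro k hs hk
    obtain ⟨h1, h2⟩ := h.comp k hs hk
    obtain ⟨h3, h4, _⟩ := h.via_scan k hk h1
    exact ⟨h3, show _ < n by omega, (h.tree k hk h1).1, h2⟩
  · intro k hs hk hke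
    have := (h.via_scan k hk (h.comp k hs hk).1).notMem
    apply this
    rw [hke]; exact List.mem_cons_self

/-- Finding a new vertex. -/
theorem Search.scan_new (h : Search a b n N L Q via pred seen ok s q p (e :: l)) (he : 1 ≤ e)
    (hen : e ≤ 2 * n) (hel : e ∉ l)
    (hsp : s < p) (hsrc : Q (p - 1) = halfSrc a b e)
    (hw : halfSrc b a e < N) (hseen : seen (halfSrc b a e) = 0) :
    Search a b n N L (Function.update Q q (halfSrc b a e))
      (Function.update via (halfSrc b a e) e)
      (Function.update pred (halfSrc b a e) (Q (p - 1)))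
      (Function.update seen (halfSrc b a e) 1) ok s (q + 1) p l := by
  have hpq := h.le'
  refine h.enqueue (l' := l) (e := e) ?_ (List.subset_cons_self e l) hw hseen (fun _ => by omega)
    (fun _ => by omega) fun _ =>
      ⟨⟨he, hen, ⟨p - 1, by omega, hsrc⟩, hel⟩, rfl, hsrc, p - 1, by omega, by omega, hsrc⟩
  intro x hx
  by_cases hxe : x = e
  · exact Or.inr ⟨hxe, by omega⟩
  · left; simp [hxe, hx]

theorem Scanned.of_src (he : 1 ≤ e)
    (hen : e ≤ 2 * n) {k : ℕ} (hk : k < q) (hsrc : Q k = halfSrc a b e) :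
    Scanned a b n Q q [] e := ⟨he, hen, ⟨k, hk, hsrc⟩, by simp⟩

/-- The vertices since `Q s` form a component, when all of them have been processed. -/
theorem Search.component (h : Search a b n N L Q via pred seen ok s q q []) {k : ℕ} (hk : s ≤ k)
    (hkq : k < q) : {w | Link a b (Set.Iio n) (Q k) w} = Q '' Set.Ico s q := by
  have hlink : ∀ k, s ≤ k → k < q → Link a b (Set.Iio n) (Q s) (Q k) := by
    intro k
    induction k using Nat.strong_induction_on with
    | _ k ih =>
      intro h1 h2
      rcases Nat.eq_or_lt_of_le h1 with rfl | h1
      · exact Link.refl _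
      obtain ⟨h3, j, h6, h7, h8⟩ := h.comp k h1 h2
      obtain ⟨h4, h5, _, _⟩ := h.via_scan k h2 h3
      refine (ih j h7 h6 (by omega)).trans ?_
      have h9 := link_half (a := a) (b := b) h4 h5
      rwa [(h.tree k h2 h3).1, ← h8] at h9
  ext w
  constructor
  · intro hw
    change Link a b (Set.Iio n) (Q k) w at hw
    induction hw with
    | refl => exact ⟨k, ⟨hk, hkq⟩, rfl⟩
    | tail _ hxy ih =>
      obtain ⟨j, ⟨hj1, hj2⟩, rfl⟩ := ih
      obtain ⟨i, hi, hxy⟩ := hxy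
      obtain ⟨e, he, hen, h1, h2⟩ := exists_half hi hxy
      obtain ⟨i, hi, h3⟩ := h.scan_mem e (Scanned.of_src he hen hj2 h1.symm)
      refine ⟨i, ⟨?_, hi⟩, h3.trans h2⟩
      -- A neighbour in an earlier component would, by closedness, have `Q j` in that component as
      -- well.
      by_contra his
      obtain ⟨f, hf1, hf2, hf3, hf4⟩ := exists_half (show (e - 1) / 2 < n by omega)
        (joins_half (a := a) (b := b)).symm
      obtain ⟨i', hi', h4⟩ := h.closed f ⟨hf1, hf2, ⟨i, by omega, by rw [h3, hf3]⟩, by simp⟩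
      have := h.inj i' (by have := h.le; omega) j hj2 (by rw [h4, hf4, h1])
      omega
  · rintro ⟨j, ⟨hj1, hj2⟩, rfl⟩
    exact (hlink k hk hkq).symm.trans (hlink j hj1 hj2)

theorem Search.ncard_component (h : Search a b n N L Q via pred seen ok s q q []) {k : ℕ}
    (hk : s ≤ k) (hkq : k < q) : {w | Link a b (Set.Iio n) (Q k) w}.ncard = q - s := by
  rw [h.component hk hkq, Set.InjOn.ncard_image]
  · rw [← Finset.coe_Ico, Set.ncard_coe_finset, Nat.card_Ico]
  · intro i hi j hj hij
    exact h.inj i hi.2 j hj.2 hij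

/-- The end of a component. -/
theorem Search.finish (h : Search a b n N L Q via pred seen ok s q q []) (hsq : s < q) :
    Search a b n N L Q via pred seen (if L < q - s then 0 else ok) q q q [] := by
  refine ⟨le_rfl, le_rfl, h.lt, h.inj, h.seen_iff, h.tree, fun h => absurd h (lt_irrefl q),
    fun k h1 h2 => by omega, fun e he => h.scan_mem e he, h.scan_mem, ?_, h.via_scan, ?_, ?_⟩
  · intro hok
    refine h.scan_ok ?_
    split_ifs at hok with hL
    · exact absurd rfl hok
    · exact hok
  · intro hf hL
    rw [if_neg]
    · exact h.good hf hL
    · rw [← h.ncard_component le_rfl hsq]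
      exact Nat.not_lt.2 (hL _ (h.lt s hsq))
  · intro hok k hk
    split_ifs at hok with hL
    · exact absurd rfl hok
    · rcases Nat.lt_or_ge k s with hks | hks
      · exact h.small hok k hks
      · rw [h.ncard_component hks hk]; omega

theorem Search.start (h : Search a b n N L Q via pred seen ok q q q []) (hw : w < N)
    (hseen : seen w = 0) :
    Search a b n N L (Function.update Q q w) (Function.update via w 0) (Function.update pred w 0)
      (Function.update seen w 1) ok q (q + 1) q [] :=
  h.enqueue (fun _ hx => Or.inl hx) (List.Subset.refl _) hw hseen (fun h => absurd h (lt_irrefl q))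
    (fun _ => rfl) fun h => absurd rfl h

theorem search_init (hs : ∀ w < N, seen w = 0) :
    Search a b n N L Q via pred seen 1 0 0 0 [] := by
  refine ⟨le_rfl, le_rfl, ?_, ?_, ?_, ?_, ?_, ?_, ?_, ?_, ?_, ?_, ?_, ?_⟩
  any_goals intros; omega
  · intro w hw; simp [hs w hw]
  · rintro e ⟨_, _, ⟨k, hk, _⟩, _⟩; omega
  · rintro e ⟨_, _, ⟨k, hk, _⟩, _⟩; omega
  · rintro _ e ⟨_, _, ⟨k, hk, _⟩, _⟩; omega

/-- The result of a successful search: the vertices in an order such that each is the first of its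
component or is joined by the edge of `via` to the earlier vertex `pred`; each edge occurs. -/
structure Order (a b : ℕ → ℕ) (n N : ℕ) (Q via pred : ℕ → ℕ) : Prop where
  lt : ∀ k < N, Q k < N
  inj : ∀ j < N, ∀ k < N, Q j = Q k → j = k
  surj : ∀ w < N, ∃ k < N, Q k = w
  tree : ∀ k < N, via (Q k) ≠ 0 → via (Q k) ≤ 2 * n ∧ halfSrc b a (via (Q k)) = Q k ∧
    pred (Q k) = halfSrc a b (via (Q k)) ∧ ∃ j < k, Q j = halfSrc a b (via (Q k))
  cover : ∀ i < n, ∃ k < N, (via (Q k) + 1) / 2 = i + 1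

theorem Search.length (h : Search a b n N L Q via pred seen ok q q q [])
    (hs : ∀ w < N, seen w ≠ 0) : q = N := by
  have e : (Finset.range q).image Q = Finset.range N := by
    ext w
    simp only [Finset.mem_image, Finset.mem_range]
    constructor
    · rintro ⟨k, hk, rfl⟩; exact h.lt k hk
    · intro hw; exact (h.seen_iff w hw).1 (hs w hw)
  have := congrArg Finset.card e
  rwa [Finset.card_image_of_injOn, Finset.card_range, Finset.card_range] at this
  intro i hi j hj hij
  exact h.inj i (by simpa using hi) j (by simpa using hj) hij

theorem Search.order (h : Search a b n N L Q via pred seen ok N N N [])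
    (ha : ∀ i < n, a i < N) (hs : ∀ w < N, seen w ≠ 0) (hok : ok ≠ 0) :
    Order a b n N Q via pred := by
  refine ⟨h.lt, h.inj, fun w hw => (h.seen_iff w hw).1 (hs w hw), ?_, ?_⟩
  · intro k hk hv
    exact ⟨(h.via_scan k hk hv).le, h.tree k hk hv⟩
  · intro i hi
    obtain ⟨k, hk, hki⟩ := (h.seen_iff _ (ha i hi)).1 (hs _ (ha i hi))
    -- The half-edge `2 * i + 1` out of `a i` has been scanned. Success leaves two possibilities,
    -- and in each the edge `i` is the one through which one of its ends was found.
    have hsrc : halfSrc a b (2 * i + 1) = a i := halfSrc_odd i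
    have hsc := Scanned.of_src (n := n) (e := 2 * i + 1) (by omega) (by omega) hk (hki.trans hsrc.symm)
    rcases h.scan_ok hok _ hsc with h1 | h1
    · exact ⟨k, hk, by rw [hsrc, ← hki] at h1; omega⟩
    · obtain ⟨j, hj, h2⟩ := h.scan_mem _ hsc
      exact ⟨j, hj, by rw [h2, h1]; omega⟩

/-- Take the position in the queue as rank, and the vertex found through an edge as its child. A
vertex is found through one edge only, so children are distinct, and parents come earlier. -/
theorem Order.forest (h : Order a b n N Q via pred) : Forest a b (Set.Iio n) := by
  choose! f hf1 hf2 using h.cover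
  choose! pos hp1 hp2 using h.surj
  have hpos : ∀ k < N, pos (Q k) = k := fun k hk =>
    h.inj _ (hp1 _ (h.lt k hk)) k hk (hp2 _ (h.lt k hk))
  rw [← Finset.coe_range]
  refine forest_of_rank pos (fun i => halfSrc a b (via (Q (f i)))) (fun i => Q (f i)) _ ?_ ?_ ?_
  · intro i hi
    have hi := Finset.mem_range.1 hi
    have h2 := hf2 i hi
    have h1 := h.tree (f i) (hf1 i hi) (by omega)
    have := joins_half (a := a) (b := b) (e := via (Q (f i)))
    rw [h1.2.1] at this
    rwa [show (via (Q (f i)) - 1) / 2 = i by omega] at this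
  · intro i hi
    have hi := Finset.mem_range.1 hi
    have h2 := hf2 i hi
    obtain ⟨_, _, _, j, hj, h3⟩ := h.tree (f i) (hf1 i hi) (by omega)
    have := hf1 i hi
    rw [← h3, hpos j (by omega), hpos _ this]
    exact hj
  · intro i hi j hj hij
    have hi : i < n := by simpa using hi
    have hj : j < n := by simpa using hj
    have h1 := hf2 i hi
    have h2 := hf2 j hj
    simp only at hij
    rw [hij] at h1
    omega

/-- Acceptance of good graphs is the clause `good` of the invariant. Conversely, a search without
complaint has exhibited every edge as a tree edge and has measured every component. -/
theorem Search.ok_iff (h : Search a b n N L Q via pred seen ok N N N [])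
    (ha : ∀ i < n, a i < N) (hs : ∀ w < N, seen w ≠ 0) :
    ok ≠ 0 ↔ Forest a b (Set.Iio n) ∧ ∀ v < N, {w | Link a b (Set.Iio n) v w}.ncard ≤ L := by
  refine ⟨fun hok => ⟨(h.order ha hs hok).forest, fun v hv => ?_⟩, fun hf => h.good hf.1 hf.2⟩
  obtain ⟨k, hk, rfl⟩ := (h.seen_iff v hv).1 (hs v hv)
  exact h.small hok k hk

/-- Each half-edge has a single source, so it is counted at most once. -/
theorem sum_length_outList_le : ∑ w ∈ Finset.range N, (outList a b w n).length ≤ n := by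
  induction n with
  | zero => simp [outList]
  | succ n ih =>
    have e : ∀ w, (outList a b w (n + 1)).length =
        (outList a b w n).length + if halfSrc a b (n + 1) = w then 1 else 0 := by
      intro w; rw [outList]; split_ifs <;> simp
    simp only [e, Finset.sum_add_distrib, Finset.sum_ite_eq]
    split_ifs <;> omega

/-- The vertices of the queue are distinct even if the graph has cycles. This makes rejected rounds
linear in time, too. -/
theorem Search.sum_length_le (h : Search a b n N L Q via pred seen ok s q p l) {k : ℕ}
    (hk : k ≤ q) :
    ∑ j ∈ Finset.range k, (outList a b (Q j) (2 * n)).length ≤ 2 * n := by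
  refine le_trans ?_ (sum_length_outList_le (a := a) (b := b) (N := N))
  rw [← Finset.sum_image (s := Finset.range k) (g := Q)
    (f := fun w => (outList a b w (2 * n)).length)]
  · refine Finset.sum_le_sum_of_subset ?_
    intro w hw
    obtain ⟨j, hj, rfl⟩ := Finset.mem_image.1 hw
    rw [Finset.mem_range] at hj ⊢
    exact h.lt j (by omega)
  · intro i hi j hj hij
    have hi : i < k := by simpa using hi
    have hj : j < k := by simpa using hj
    exact h.inj i (by omega) j (by omega) hij

end

-- The search as a computation of the machine

attribute [local simp] visit

/-- The state `τ` of the machine during the search, which has begun in the state `σ`. -/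
structure SearchState (a b : ℕ → ℕ) (σ τ : State) (s p : ℕ) (l : List ℕ) : Prop where
  frame : Frame σ τ
  head : τ.arr .head = σ.arr .head
  next : τ.arr .next = σ.arr .next
  tgt : τ.arr .tgt = σ.arr .tgt
  inv : Search a b (σ.reg .numKeys) (σ.reg .numCells) (σ.reg .maxComp) (τ.arr .queue)
    (τ.arr .via) (τ.arr .pred) (τ.arr .seen) (τ.reg .ok) s (τ.reg .q) p l

/-- The loop of the search through the half-edges out of a vertex. -/
def scanLoop : Stmt := .while (.bin .ne (.var .e) (.lit 0)) (block [
  .ite (.bin .ne (edgeOf (.var .e)) (edgeOf (.get .via (.var .u))))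
    (block [
      .set .v (.get .tgt (.var .e)),
      .ite (.bin .eq (.get .seen (.var .v)) (.lit 0))
        (visit .v (.var .e) (.var .u))
        (.set .ok (.lit 0))])
    .skip,
  .set .e (.get .next (.var .e))])

/-- The state `υ` during the loop through the half-edges out of `Q (p - 1)`, which has begun in the
state `τ`. -/
structure ScanState (a b : ℕ → ℕ) (σ τ υ : State) (s p : ℕ) (l : List ℕ) : Prop where
  state : SearchState a b σ υ s p l
  reg_r : υ.reg .r = τ.reg .r
  reg_p : υ.reg .p = τ.reg .p
  reg_start : υ.reg .start = τ.reg .start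
  le : τ.reg .q ≤ υ.reg .q
  queue : ∀ k < τ.reg .q, υ.arr .queue k = τ.arr .queue k
  mem : ∀ e ∈ l, 1 ≤ e ∧ e ≤ 2 * σ.reg .numKeys ∧ τ.arr .queue (p - 1) = halfSrc a b e
  nodup : l.Nodup
  chain : OutChain (σ.arr .next) (υ.reg .e) l
  reg_u : υ.reg .u = τ.arr .queue (p - 1)

section

variable {D : Type uD} {E : Env D} {σ τ : State} {a b : ℕ → ℕ} {s p : ℕ} {l : List ℕ}

theorem runs_scanLoop
    (hA : AdjLists a b (σ.reg .numCells) (2 * σ.reg .numKeys)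
        (σ.arr .head) (σ.arr .next) (σ.arr .tgt))
    (ha : ∀ i < σ.reg .numKeys, a i < σ.reg .numCells)
    (hb : ∀ i < σ.reg .numKeys, b i < σ.reg .numCells)
    (h : ScanState a b σ τ τ s p l) (hsp : s < p) (hpq : p ≤ τ.reg .q) :
    Runs E scanLoop τ fun υ c => ScanState a b σ τ υ s p [] ∧ c ≤ 60 * l.length + 4 := by
  refine Runs.while' (fun k υ => ∃ l', ScanState a b σ τ υ s p l' ∧ k = 60 * l'.length)
    ⟨l, h, rfl⟩ ?_ ?_
  · rintro k υ ⟨l', h, rfl⟩ hbe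
    simp at hbe
    obtain _ | ⟨e, l'⟩ := l'
    · exact absurd h.chain hbe
    obtain ⟨hee, he0, hc⟩ := h.chain
    subst hee
    obtain ⟨he, hen, hsrc⟩ := h.mem (υ.reg .e) List.mem_cons_self
    have hQp : υ.arr .queue (p - 1) = τ.arr .queue (p - 1) := h.queue _ (by omega)
    have hl' : ∀ e ∈ l', 1 ≤ e ∧ e ≤ 2 * σ.reg .numKeys ∧
      τ.arr .queue (p - 1) = halfSrc a b e := fun e k => h.mem e (List.mem_cons_of_mem _ k)
    have hnd := List.nodup_cons.1 h.nodup
    have htgt : υ.arr .tgt (υ.reg .e) = halfSrc b a (υ.reg .e) := by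
      rw [h.state.tgt, hA.tgt_eq _ he hen]
    have hw : halfSrc b a (υ.reg .e) < σ.reg .numCells := halfSrc_lt hb ha he hen
    have hle := h.le
    have hF := h.state.frame
    suffices H : Runs E _ υ fun υ' c => ScanState a b σ τ υ' s p l' ∧ c ≤ 50 from
      H.mono fun υ' c h => ⟨_, ⟨l', h.1, rfl⟩, by have := h.2; simp; omega⟩
    simp [h.reg_u, htgt, h.state.next]
    -- The three cases: the edge through which the current vertex was found, a new vertex, a vertex
    -- already seen.
    split_ifs with h1 h2
    · refine ⟨⟨⟨hF.1, hF.2, hF.3, hF.4, hF.5⟩, h.state.head, h.state.next, h.state.tgt,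
        ?_⟩, h.reg_r, h.reg_p, h.reg_start, h.le, h.queue, hl', hnd.2, hc, h.reg_u⟩
      exact h.state.inv.scan_back he hsp (by rw [hQp, hsrc]) (by rw [hQp, h1])
    · refine ⟨⟨⟨hF.1, hF.2, hF.3, hF.4, hF.5⟩, h.state.head, h.state.next, h.state.tgt,
        ?_⟩, h.reg_r, h.reg_p, h.reg_start, h.le.trans (Nat.le_succ _), ?_, hl', hnd.2, hc, h.reg_u⟩
      · have := h.state.inv.scan_new he hen hnd.1 hsp (by rw [hQp, hsrc]) hw h2
        rw [hQp] at this
        exact this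
      · intro k hk
        exact (Function.update_of_ne (by omega) _ _).trans (h.queue k hk)
    · refine ⟨⟨⟨hF.1, hF.2, hF.3, hF.4, hF.5⟩, h.state.head, h.state.next, h.state.tgt,
        ?_⟩, h.reg_r, h.reg_p, h.reg_start, h.le, h.queue, hl', hnd.2, hc, h.reg_u⟩
      exact h.state.inv.scan_seen he hen hsp (by rw [hQp, hsrc]) (by rwa [hQp]) hw h2
  · rintro k υ c ⟨l', h, rfl⟩ hbe hcost
    simp at hbe hcost
    obtain _ | ⟨e, l'⟩ := l'
    · exact ⟨h, by simp at hcost; omega⟩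
    · exact absurd (h.chain.1.symm.trans hbe) h.chain.2.1

/-- The loop of the search through a component. -/
def componentLoop : Stmt := .while (ltVar .p .q) (block [
  .set .u (.get .queue (.var .p)),
  incr .p,
  .set .e (.get .head (.var .u)),
  scanLoop])

/-- A bound for the remaining time of the search, when the first `p` vertices of the queue have been
processed. -/
def searchPot (a b : ℕ → ℕ) (n N : ℕ) (Q : ℕ → ℕ) (p : ℕ) : ℕ :=
  60 * (2 * n - ∑ k ∈ Finset.range p, (outList a b (Q k) (2 * n)).length) + 70 * (N - p)

theorem searchPot_congr {n N : ℕ} {Q Q' : ℕ → ℕ} (h : ∀ k < p, Q' k = Q k) :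
    searchPot a b n N Q' p = searchPot a b n N Q p := by
  rw [searchPot, searchPot, Finset.sum_congr rfl]
  intro k hk
  rw [h k (Finset.mem_range.1 hk)]

theorem Search.queue_le {n N L : ℕ} {Q via pred seen : ℕ → ℕ} {ok q : ℕ}
    (h : Search a b n N L Q via pred seen ok s q p l) : q ≤ N := by
  have := Finset.card_le_card_of_injOn (s := Finset.range q) (t := Finset.range N) Q
    (fun k hk => by simpa using h.lt k (by simpa using hk))
    (fun i hi j hj hij => h.inj i (by simpa using hi) j (by simpa using hj) hij)
  simpa using this

/-- Processing a vertex is paid for by `60` per half-edge out of it and `70` for itself. The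
truncated subtractions are exact, as at most `2 * n` half-edges and `N` vertices occur. -/
theorem Search.searchPot_succ {n N L : ℕ} {Q via pred seen : ℕ → ℕ} {ok q : ℕ}
    (h : Search a b n N L Q via pred seen ok s q p l) (hp : p < q) :
    searchPot a b n N Q (p + 1) + 60 * (outList a b (Q p) (2 * n)).length + 70 ≤
      searchPot a b n N Q p := by
  have h1 := h.sum_length_le (k := p + 1) hp
  have h2 := h.queue_le
  rw [Finset.sum_range_succ] at h1
  rw [searchPot, searchPot, Finset.sum_range_succ]
  omega

/-- The cost is stated as a drop of the potential, so that the costs of all components add up to a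
linear bound. -/
theorem runs_componentLoop
    (hA : AdjLists a b (σ.reg .numCells) (2 * σ.reg .numKeys)
        (σ.arr .head) (σ.arr .next) (σ.arr .tgt))
    (ha : ∀ i < σ.reg .numKeys, a i < σ.reg .numCells)
    (hb : ∀ i < σ.reg .numKeys, b i < σ.reg .numCells)
    (h : SearchState a b σ τ s p []) (hp : τ.reg .p = p) :
    Runs E componentLoop τ fun υ c => SearchState a b σ υ s (υ.reg .q) [] ∧
      υ.reg .r = τ.reg .r ∧ υ.reg .p = υ.reg .q ∧ υ.reg .start = τ.reg .start ∧
      τ.reg .q ≤ υ.reg .q ∧ (∀ k < τ.reg .q, υ.arr .queue k = τ.arr .queue k) ∧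
      c + searchPot a b (σ.reg .numKeys) (σ.reg .numCells) (υ.arr .queue) (υ.reg .q) ≤
        searchPot a b (σ.reg .numKeys) (σ.reg .numCells) (τ.arr .queue) p + 4 := by
  refine Runs.while
    (fun υ => SearchState a b σ υ s (υ.reg .p) [] ∧
      υ.reg .r = τ.reg .r ∧ υ.reg .start = τ.reg .start ∧
      τ.reg .q ≤ υ.reg .q ∧ ∀ k < τ.reg .q, υ.arr .queue k = τ.arr .queue k)
    (fun υ => searchPot a b (σ.reg .numKeys) (σ.reg .numCells) (υ.arr .queue) (υ.reg .p))
    ⟨by rwa [hp], rfl, rfl, le_rfl, fun _ _ => rfl⟩ ?_ ?_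
  · rintro υ ⟨h, hr, hs, hq, hQ⟩ hbe
    simp at hbe
    simp only [block, runs_seq, runs_set, incr]
    have hF := h.frame
    have hu : υ.arr .queue (υ.reg .p) < σ.reg .numCells := h.inv.lt _ hbe
    refine Runs.mono (runs_scanLoop (σ := σ) (s := s) (p := υ.reg .p + 1)
      (l := outList a b (υ.arr .queue (υ.reg .p)) (2 * σ.reg .numKeys)) hA ha hb ?_ ?_ ?_) ?_
    · refine ⟨⟨⟨hF.1, hF.2, hF.3, hF.4, hF.5⟩, h.head, h.next, h.tgt, h.inv.pop hbe⟩, rfl, rfl, rfl,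
        le_rfl, fun _ _ => rfl, ?_, nodup_outList, ?_, ?_⟩
      · intro e he
        obtain ⟨h1, h2, h3⟩ := mem_outList.1 he
        exact ⟨h1, h2, by simp [h3]⟩
      · simpa [h.head] using hA.chain _ hu
      · simp
    · have := h.inv.le; omega
    · simpa using hbe
    · intro υ' c ⟨h', hc⟩
      have h1 : υ'.reg .p = υ.reg .p + 1 := by simpa using h'.reg_p
      have h2 : ∀ k < υ.reg .q, υ'.arr .queue k = υ.arr .queue k := by simpa using h'.queue
      have h3 : υ.reg .q ≤ υ'.reg .q := by simpa using h'.le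
      refine ⟨⟨by rw [h1]; exact h'.state, ?_, ?_, by omega, fun k hk => ?_⟩, ?_⟩
      · simpa [hr] using h'.reg_r
      · simpa [hs] using h'.reg_start
      · rw [h2 k (by omega), hQ k hk]
      · have := h.inv.searchPot_succ hbe
        rw [h1, searchPot_congr fun k hk => h2 k (by omega)]
        simp
        omega
  · rintro υ c ⟨h, hr, hs, hq, hQ⟩ hbe hc
    simp at hbe
    have hpq : υ.reg .p = υ.reg .q := le_antisymm h.inv.le' hbe
    rw [hpq] at h hc
    simp [hp] at hc
    exact ⟨h, hr, hpq, hs, hq, hQ, hc⟩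

theorem search_eq : search = block [
  .set .ok (.lit 1),
  .set .p (.lit 0),
  .set .q (.lit 0),
  .set .r (.lit 0),
  .while (ltVar .r .numCells) (block [
    .ite (.bin .eq (.get .seen (.var .r)) (.lit 0))
      (block [
        .set .start (.var .q),
        visit .r (.lit 0) (.lit 0),
        componentLoop,
        .ite (.bin .lt (.var .maxComp) (.bin .sub (.var .q) (.var .start)))
          (.set .ok (.lit 0))
          .skip])
      .skip,
    incr .r])] := rfl

theorem runs_search
    (hA : AdjLists a b (σ.reg .numCells) (2 * σ.reg .numKeys)
        (σ.arr .head) (σ.arr .next) (σ.arr .tgt))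
    (ha : ∀ i < σ.reg .numKeys, a i < σ.reg .numCells)
    (hb : ∀ i < σ.reg .numKeys, b i < σ.reg .numCells)
    (hs : ∀ w < σ.reg .numCells, σ.arr .seen w = 0) :
    Runs E search σ fun τ c => Frame σ τ ∧ τ.arr .head = σ.arr .head ∧
      τ.arr .next = σ.arr .next ∧ τ.arr .tgt = σ.arr .tgt ∧
      (τ.reg .ok ≠ 0 ↔ Forest a b (Set.Iio (σ.reg .numKeys)) ∧
        ∀ v < σ.reg .numCells,
          {w | Link a b (Set.Iio (σ.reg .numKeys)) v w}.ncard ≤ σ.reg .maxComp) ∧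
      (τ.reg .ok ≠ 0 → Order a b (σ.reg .numKeys) (σ.reg .numCells)
        (τ.arr .queue) (τ.arr .via) (τ.arr .pred)) ∧
      c ≤ 120 * σ.reg .numKeys + 170 * σ.reg .numCells + 30 := by
  rw [search_eq]
  simp only [block, runs_seq, runs_set]
  -- The potential adds `100` for each possible starting vertex not yet tried. Its initial value,
  -- `120` per key and `170` per cell, gives the time bound.
  refine Runs.while
    (fun τ => SearchState a b σ τ (τ.reg .q) (τ.reg .q) [] ∧ τ.reg .p = τ.reg .q ∧
      τ.reg .r ≤ σ.reg .numCells ∧ ∀ w < τ.reg .r, τ.arr .seen w ≠ 0)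
    (fun τ => searchPot a b (σ.reg .numKeys) (σ.reg .numCells) (τ.arr .queue) (τ.reg .q) +
      100 * (σ.reg .numCells - τ.reg .r)) ?_ ?_ ?_
  · refine ⟨⟨⟨?_, ?_, ?_, ?_, ?_⟩, rfl, rfl, rfl, ?_⟩, ?_, ?_, ?_⟩
    any_goals simp
    exact search_init hs
  · rintro τ ⟨h, hp, hr, hseen⟩ hbe
    have hF := h.frame
    simp [hF.numCells] at hbe
    rw [runs_seq, runs_ite]
    split_ifs with h1
    · simp at h1
      simp only [visit, block, incr, runs_seq, runs_set, runs_store]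
      have hst := h.inv.start hbe h1
      refine Runs.mono (runs_componentLoop (σ := σ) (s := τ.reg .q) (p := τ.reg .q) hA ha hb
        ⟨⟨hF.1, hF.2, hF.3, hF.4, hF.5⟩, h.head, h.next, h.tgt, hst⟩ hp) ?_
      rintro υ c ⟨h', hr', hp', hs', hq', hQ', hc⟩
      simp at hr' hs' hc hq' hQ'
      have hF' := h'.frame
      have hfin := h'.inv.finish hq'
      have hpot : searchPot a b (σ.reg .numKeys) (σ.reg .numCells)
          (Function.update (τ.arr .queue) (τ.reg .q) (τ.reg .r)) (τ.reg .q) =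
          searchPot a b (σ.reg .numKeys) (σ.reg .numCells) (τ.arr .queue) (τ.reg .q) :=
        searchPot_congr fun k hk => Function.update_of_ne (by omega) _ _
      have hseen' : ∀ w < υ.reg .r + 1, υ.arr .seen w ≠ 0 := by
        intro w hw
        rw [h'.inv.seen_iff w (by omega)]
        rcases Nat.lt_succ_iff_lt_or_eq.1 hw with hw | hw
        · obtain ⟨k, hk, hkw⟩ := (h.inv.seen_iff w (by omega)).1 (hseen w (by omega))
          refine ⟨k, by omega, ?_⟩
          rw [hQ' k (by omega), Function.update_of_ne (by omega), hkw]
        · refine ⟨τ.reg .q, by omega, ?_⟩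
          rw [hQ' _ le_rfl, Function.update_self, hw, hr']
      rw [runs_ite]
      have hcond : Expr.eval E υ
          (.bin .lt (.var .maxComp) (.bin .sub (.var .q) (.var .start))) ≠ 0 ↔
          σ.reg .maxComp < υ.reg .q - τ.reg .q := by
        simp [hF'.maxComp, hs']
        omega
      rw [if_congr hcond rfl rfl]
      split_ifs with hL
      · rw [if_pos hL] at hfin
        simp only [runs_set]
        refine ⟨⟨⟨⟨hF'.1, hF'.2, hF'.3, hF'.4, hF'.5⟩, h'.head, h'.next, h'.tgt, hfin⟩, hp', ?_,
          hseen'⟩, ?_⟩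
        · simp; omega
        · simp; omega
      · rw [if_neg hL] at hfin
        rw [runs_skip]
        refine ⟨⟨⟨⟨hF'.1, hF'.2, hF'.3, hF'.4, hF'.5⟩, h'.head, h'.next, h'.tgt, hfin⟩, hp', ?_,
          hseen'⟩, ?_⟩
        · simp; omega
        · simp; omega
    · simp at h1
      simp only [runs_skip, runs_set, incr]
      refine ⟨⟨⟨⟨hF.1, hF.2, hF.3, hF.4, hF.5⟩, h.head, h.next, h.tgt, h.inv⟩, hp, ?_, ?_⟩, ?_⟩
      · simp; omega
      · intro w hw
        simp at hw ⊢
        rcases Nat.lt_or_eq_of_le hw with hw | rfl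
        · exact hseen w hw
        · exact h1
      · simp; omega
  · rintro τ c ⟨h, hp, hr, hseen⟩ hbe hc
    have hF := h.frame
    simp [hF.numCells] at hbe
    have hrN : τ.reg .r = σ.reg .numCells := by omega
    rw [hrN] at hseen
    have hqN := h.inv.length hseen
    have hinv := h.inv
    rw [hqN] at hinv
    refine ⟨h.frame, h.head, h.next, h.tgt, hinv.ok_iff ha hseen, hinv.order ha hseen, ?_⟩
    simp [searchPot] at hc ⊢
    omega

end

/-! ### Back-substitution and the loop of the creation -/

section

variable {D : Type uD} {E : Env D} {σ τ : State} {a b : ℕ → ℕ}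

/-- The table solves the equations of the first `n` keys. -/
structure Solves (m : ℕ) (a b : ℕ → ℕ) (n N : ℕ) (h3 val tab : ℕ → ℕ) : Prop where
  lt : ∀ w < N, tab w < m
  eq : ∀ i < n, (tab (a i) : ZMod m) + (tab (b i) : ZMod m) + (h3 i : ZMod m) = (val i : ZMod m)

/-- A vertex is assigned once, after its predecessor, so the equation of its edge holds from then
on. Since every edge is the one through which some vertex was found, all equations are covered. -/
theorem runs_solve (hm : 0 < E.m)
    (hO : Order a b (σ.reg .numKeys) (σ.reg .numCells) (σ.arr .queue) (σ.arr .via) (σ.arr .pred)) :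
    Runs E solve σ fun τ c => τ.trial = σ.trial ∧ τ.arr .head = σ.arr .head ∧
      τ.arr .next = σ.arr .next ∧ τ.arr .tgt = σ.arr .tgt ∧
      Solves E.m a b (σ.reg .numKeys) (σ.reg .numCells) (fun i => E.h3 (E.key i)) (σ.arr .val)
        (τ.arr .tab) ∧
      c ≤ 50 * σ.reg .numCells + 10 := by
  have : NeZero E.m := ⟨hm.ne'⟩
  simp only [solve, block, runs_seq, runs_set]
  refine Runs.while
    (fun τ => (τ.trial = σ.trial ∧ τ.arr .head = σ.arr .head ∧
      τ.arr .next = σ.arr .next ∧ τ.arr .tgt = σ.arr .tgt) ∧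
      (τ.arr .queue = σ.arr .queue ∧ τ.arr .via = σ.arr .via ∧ τ.arr .pred = σ.arr .pred ∧
        τ.arr .val = σ.arr .val ∧ τ.reg .numCells = σ.reg .numCells) ∧
      τ.reg .i ≤ σ.reg .numCells ∧
      ∀ k < τ.reg .i, τ.arr .tab (σ.arr .queue k) < E.m ∧
        (σ.arr .via (σ.arr .queue k) ≠ 0 → (τ.arr .tab (σ.arr .queue k) : ZMod E.m) =
          σ.arr .val ((σ.arr .via (σ.arr .queue k) - 1) / 2) -
            τ.arr .tab (σ.arr .pred (σ.arr .queue k)) -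
            E.h3 (E.key ((σ.arr .via (σ.arr .queue k) - 1) / 2))))
    (fun τ => 50 * (σ.reg .numCells - τ.reg .i)) ?_ ?_ ?_
  · simp
  · rintro τ ⟨h1, ⟨hq, hv, hp, hval, hN⟩, hi, ht⟩ hb
    simp [hN] at hb
    -- Both branches write one cell. It is enough that the value `y` written solves the equation of
    -- the current vertex, if there is one.
    suffices H : ∀ y, y < E.m → (σ.arr .via (σ.arr .queue (τ.reg .i)) ≠ 0 → (y : ZMod E.m) =
          σ.arr .val ((σ.arr .via (σ.arr .queue (τ.reg .i)) - 1) / 2) -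
            τ.arr .tab (σ.arr .pred (σ.arr .queue (τ.reg .i))) -
            E.h3 (E.key ((σ.arr .via (σ.arr .queue (τ.reg .i)) - 1) / 2))) →
        ∀ k < τ.reg .i + 1, Function.update (τ.arr .tab) (σ.arr .queue (τ.reg .i)) y
          (σ.arr .queue k) < E.m ∧
        (σ.arr .via (σ.arr .queue k) ≠ 0 →
          (Function.update (τ.arr .tab) (σ.arr .queue (τ.reg .i)) y
            (σ.arr .queue k) : ZMod E.m) =
          σ.arr .val ((σ.arr .via (σ.arr .queue k) - 1) / 2) -
            Function.update (τ.arr .tab) (σ.arr .queue (τ.reg .i)) y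
              (σ.arr .pred (σ.arr .queue k)) -
            E.h3 (E.key ((σ.arr .via (σ.arr .queue k) - 1) / 2))) by
      rw [runs_seq, runs_set, runs_seq, runs_set, runs_seq, runs_ite]
      split_ifs with hz
      · simp [hq, hv] at hz
        have hz : σ.arr .via (σ.arr .queue (τ.reg .i)) = 0 := by omega
        simp only [runs_store, incr, runs_set]
        simp
        refine ⟨⟨h1, ⟨hq, hv, hp, hval, hN⟩, by omega, ?_⟩, by omega⟩
        rw [hq]
        exact fun k hk => H 0 hm (absurd hz) k (by omega)
      · simp only [runs_store, incr, runs_set, runs_seq]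
        simp
        refine ⟨⟨h1, ⟨hq, hv, hp, hval, hN⟩, by omega, ?_⟩, by omega⟩
        have hlab : (σ.arr .via (σ.arr .queue (τ.reg .i)) + 1) / 2 - 1 =
          (σ.arr .via (σ.arr .queue (τ.reg .i)) - 1) / 2 := by omega
        rw [hq, hv, hp, hval, hlab]
        exact fun k hk => H _ (ZMod.val_lt _) (fun _ => by rw [ZMod.natCast_zmod_val]) k (by omega)
    intro y hy hyeq k hk
    have hinj : ∀ j < τ.reg .i, σ.arr .queue j ≠ σ.arr .queue (τ.reg .i) := by
      intro j hj hjk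
      have := hO.inj j (by omega) _ hb hjk
      omega
    -- The predecessor is strictly earlier in the queue, so the present write does not change its
    -- value.
    have hpred : ∀ j ≤ τ.reg .i, σ.arr .via (σ.arr .queue j) ≠ 0 →
        σ.arr .pred (σ.arr .queue j) ≠ σ.arr .queue (τ.reg .i) := by
      intro j hj hv0
      obtain ⟨_, _, h4, i, hi, h5⟩ := hO.tree j (by omega) hv0
      rw [h4, ← h5]
      exact hinj i (by omega)
    rcases Nat.lt_succ_iff_lt_or_eq.1 hk with hk | rfl
    · rw [Function.update_of_ne (hinj k hk)]
      refine ⟨(ht k hk).1, fun hv0 => ?_⟩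
      rw [Function.update_of_ne (hpred k hk.le hv0)]
      exact (ht k hk).2 hv0
    · rw [Function.update_self]
      refine ⟨hy, fun hv0 => ?_⟩
      rw [Function.update_of_ne (hpred _ le_rfl hv0)]
      exact hyeq hv0
  · rintro τ c ⟨h1, ⟨hq, hv, hp, hval, hN⟩, hi, ht⟩ hb hc
    simp [hN] at hb
    have hi : τ.reg .i = σ.reg .numCells := by omega
    rw [hi] at ht
    refine ⟨h1.1, h1.2.1, h1.2.2.1, h1.2.2.2, ⟨?_, ?_⟩, ?_⟩
    · intro w hw
      obtain ⟨k, hk, rfl⟩ := hO.surj w hw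
      exact (ht k hk).1
    · intro i hi
      obtain ⟨k, hk, hki⟩ := hO.cover i hi
      have h2 := (ht k hk).2 (by omega)
      obtain ⟨_, h4, h5, _⟩ := hO.tree k hk (by omega)
      have hlab : (σ.arr .via (σ.arr .queue k) - 1) / 2 = i := by omega
      have hj := joins_half (a := a) (b := b) (e := σ.arr .via (σ.arr .queue k))
      rw [hlab, h4, ← h5] at hj
      rw [hlab] at h2
      rcases hj with ⟨h6, h7⟩ | ⟨h6, h7⟩
      · rw [← h6, ← h7, h2]; ring
      · rw [← h6, ← h7, h2]; ring
    · simp at hc ⊢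
      omega

/-- The pair number `t` of hash functions gives a forest on the vertices below `N` with components
of at most `L` vertices. -/
def GoodTrial (E : Env D) (n N L t : ℕ) : Prop :=
  Forest (fun i => E.h1 t (E.key i)) (fun i => E.h2 t (E.key i)) (Set.Iio n) ∧
    ∀ v < N, {w | Link (fun i => E.h1 t (E.key i)) (fun i => E.h2 t (E.key i))
      (Set.Iio n) v w}.ncard ≤ L

/-- The state `τ` between two rounds of the creation, which has begun in the state `σ`. -/
structure CreateState (E : Env D) (σ τ : State) : Prop where
  numKeys : τ.reg .numKeys = σ.reg .numKeys
  numCells : τ.reg .numCells = σ.reg .numCells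
  maxComp : τ.reg .maxComp = σ.reg .maxComp
  val : τ.arr .val = σ.arr .val
  bad : τ.reg .ok = 0 → ∀ t, 1 ≤ t → t ≤ τ.trial →
    ¬ GoodTrial E (σ.reg .numKeys) (σ.reg .numCells) (σ.reg .maxComp) t
  least : τ.reg .ok ≠ 0 → IsLeast {t | 1 ≤ t ∧
    GoodTrial E (σ.reg .numKeys) (σ.reg .numCells) (σ.reg .maxComp) t} τ.trial
  adj : τ.reg .ok ≠ 0 → AdjLists (fun i => E.h1 τ.trial (E.key i)) (fun i => E.h2 τ.trial (E.key i))
    (σ.reg .numCells) (2 * σ.reg .numKeys) (τ.arr .head) (τ.arr .next) (τ.arr .tgt)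
  order : τ.reg .ok ≠ 0 → Order (fun i => E.h1 τ.trial (E.key i))
    (fun i => E.h2 τ.trial (E.key i)) (σ.reg .numKeys) (σ.reg .numCells) (τ.arr .queue)
    (τ.arr .via) (τ.arr .pred)

/-- The time bound does not depend on whether the pair is accepted, which is what the expectation
needs. -/
theorem runs_round
    (h1 : ∀ t i, E.h1 t (E.key i) < σ.reg .numCells)
    (h2 : ∀ t i, E.h2 t (E.key i) < σ.reg .numCells)
    (h : CreateState E σ τ) (hok : τ.reg .ok = 0) :
    Runs E (block [.redraw, buildGraph, search]) τ fun υ c => CreateState E σ υ ∧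
      υ.trial = τ.trial + 1 ∧ c ≤ 200 * (σ.reg .numKeys + σ.reg .numCells) + 70 := by
  simp only [block, runs_seq, runs_redraw]
  refine (runs_buildGraph (a := fun i => E.h1 (τ.trial + 1) (E.key i))
    (b := fun i => E.h2 (τ.trial + 1) (E.key i)) (fun _ _ => rfl) fun _ _ => rfl).mono ?_
  rintro υ c ⟨hF, hA, hs, hc⟩
  simp only [h.numKeys, h.numCells] at hA hs hc
  have hK : υ.reg .numKeys = σ.reg .numKeys := hF.numKeys.trans h.numKeys
  have hN : υ.reg .numCells = σ.reg .numCells := hF.numCells.trans h.numCells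
  have hL : υ.reg .maxComp = σ.reg .maxComp := hF.maxComp.trans h.maxComp
  have ht : υ.trial = τ.trial + 1 := hF.trial
  refine (runs_search (a := fun i => E.h1 (τ.trial + 1) (E.key i))
    (b := fun i => E.h2 (τ.trial + 1) (E.key i)) (by rwa [hK, hN]) (by rw [hN]; intros; apply h1)
    (by rw [hN]; intros; apply h2) (by rwa [hN])).mono ?_
  rintro ρ d ⟨hF', hhead, hnext, htgt, hiff, hO, hd⟩
  rw [hK, hN] at hO hd
  rw [hK, hN, hL] at hiff
  have ht' : ρ.trial = τ.trial + 1 := hF'.trial.trans ht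
  refine ⟨⟨hF'.numKeys.trans hK, hF'.numCells.trans hN, hF'.maxComp.trans hL,
    hF'.val.trans (hF.val.trans h.val), ?_, ?_, ?_, ?_⟩, ht', by omega⟩
  · intro hρ t h1 h2 hG
    rcases Nat.lt_or_eq_of_le h2 with h2 | h2
    · exact h.bad hok t h1 (by omega) hG
    · rw [h2, ht'] at hG
      exact hiff.2 hG hρ
  · intro hρ
    rw [ht']
    refine ⟨⟨by omega, hiff.1 hρ⟩, fun t ht => ?_⟩
    by_contra hlt
    exact h.bad hok t ht.1 (by omega) ht.2
  · intro _
    rw [ht', hhead, hnext, htgt]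
    exact hA
  · intro hρ
    rw [ht']
    exact hO hρ

theorem createState_init (h0 : σ.trial = 0) : CreateState E σ (σ.setReg .ok 0) := by
  refine ⟨rfl, rfl, rfl, rfl, ?_, ?_, ?_, ?_⟩
  · intro _ t h1 h2
    simp [h0] at h2
    omega
  all_goals intro h; simp at h

theorem runs_createProg (hm : 0 < E.m) (h0 : σ.trial = 0)
    (h1 : ∀ t i, E.h1 t (E.key i) < σ.reg .numCells)
    (h2 : ∀ t i, E.h2 t (E.key i) < σ.reg .numCells) {t : ℕ}
    (ht : IsLeast {t | 1 ≤ t ∧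
      GoodTrial E (σ.reg .numKeys) (σ.reg .numCells) (σ.reg .maxComp) t} t) :
    Runs E createProg σ fun τ c => τ.trial = t ∧
      AdjLists (fun i => E.h1 t (E.key i)) (fun i => E.h2 t (E.key i))
        (σ.reg .numCells) (2 * σ.reg .numKeys) (τ.arr .head) (τ.arr .next) (τ.arr .tgt) ∧
      Solves E.m (fun i => E.h1 t (E.key i)) (fun i => E.h2 t (E.key i)) (σ.reg .numKeys)
        (σ.reg .numCells) (fun i => E.h3 (E.key i)) (σ.arr .val) (τ.arr .tab) ∧
      c ≤ t * (300 * (σ.reg .numKeys + σ.reg .numCells) + 200) := by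
  rw [createProg, block, runs_seq, runs_set, block, runs_seq]
  -- The potential counts the pairs up to the first good one, `t`. The loop cannot pass `t`, since
  -- only bad pairs are rejected.
  refine Runs.while (fun τ => CreateState E σ τ ∧ τ.trial ≤ t)
    (fun τ => (t - τ.trial) * (200 * (σ.reg .numKeys + σ.reg .numCells) + 100)) ?_ ?_ ?_
  · exact ⟨createState_init h0, by simp [h0]⟩
  · rintro τ ⟨h, hτ⟩ hb
    simp at hb
    refine (runs_round h1 h2 h hb).mono ?_
    rintro υ c ⟨hυ, htr, hc⟩
    have hlt : τ.trial < t := by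
      by_contra hlt
      exact h.bad hb t ht.1.1 (by omega) ht.1.2
    refine ⟨⟨hυ, by omega⟩, ?_⟩
    obtain ⟨j, hj⟩ : ∃ j, t = τ.trial + 1 + j := ⟨t - τ.trial - 1, by omega⟩
    rw [htr, show t - (τ.trial + 1) = j by omega, show t - τ.trial = j + 1 by omega]
    simp
    nlinarith
  · rintro τ c ⟨h, hτ⟩ hb hc
    simp at hb
    have htt : τ.trial = t := (h.least hb).unique ht
    have hA := h.adj hb
    have hO := h.order hb
    rw [htt] at hA hO
    rw [← h.numKeys, ← h.numCells] at hO
    refine (runs_solve hm hO).mono ?_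
    rintro υ d ⟨h3, h4, h5, h6, hS, hd⟩
    rw [h.numKeys, h.numCells, h.val] at hS
    refine ⟨h3.trans htt, by rwa [h4, h5, h6], hS, ?_⟩
    rw [h.numCells] at hd
    simp [htt, h0] at hc ⊢
    have : 1 ≤ t := ht.1.1
    nlinarith

/-- No time bound is available here, so partial correctness is used: the loop can be left only with
`ok ≠ 0`, and then the current pair is good. -/
theorem Exec.exists_goodTrial {c : Cost} (h0 : σ.trial = 0)
    (h1 : ∀ t i, E.h1 t (E.key i) < σ.reg .numCells)
    (h2 : ∀ t i, E.h2 t (E.key i) < σ.reg .numCells)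
    (h : Exec E createProg σ τ c) :
    ∃ t, IsLeast {t | 1 ≤ t ∧
      GoodTrial E (σ.reg .numKeys) (σ.reg .numCells) (σ.reg .maxComp) t} t := by
  rw [createProg, block, block] at h
  cases h with
  | seq ha hb =>
  cases ha
  cases hb with
  | seq hb _ =>
  obtain ⟨hυ, hok⟩ := hb.while_inv (CreateState E σ) (createState_init h0) (by
    intro τ υ c hτ hb he
    simp at hb
    exact ((runs_round h1 h2 hτ hb).of_exec he).1)
  simp at hok
  exact ⟨_, hυ.least hok⟩

end

/-! ## Updates -/

section

variable {a b : ℕ → ℕ} {N n m L i₀ q p : ℕ} {Q via shift tab tab₀ : ℕ → ℕ} {e w u v : ℕ}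
  {l : List ℕ} {d₀ : ZMod m}

theorem Link.lt {J : Set ℕ} (ha : ∀ i ∈ J, a i < N) (hb : ∀ i ∈ J, b i < N) (h : Link a b J u v)
    (hu : u < N) : v < N := by
  induction h with
  | refl => exact hu
  | tail _ h _ =>
    obtain ⟨i, hi, ⟨_, rfl⟩ | ⟨_, rfl⟩⟩ := h
    · exact hb i hi
    · exact ha i hi

/-- A set of `k` different vertices in one component has at most `L` elements. -/
theorem card_le_of_link (ha : ∀ i < n, a i < N) (hb : ∀ i < n, b i < N)
    (hL : ∀ v < N, {w | Link a b (Set.Iio n) v w}.ncard ≤ L) (hv : v < N) (s : Finset ℕ)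
    (hs : ∀ w ∈ s, Link a b (Set.Iio n) v w) : s.card ≤ L := by
  refine le_trans ?_ (hL v hv)
  rw [← Set.ncard_coe_finset]
  refine Set.ncard_le_ncard (fun w hw => hs w hw) ?_
  exact (Set.finite_Iio N).subset fun w hw => Link.lt ha hb hw hv

/-- The situation during the recomputation of the table from `tab₀` to `tab`: the vertices found are
`Q 0, …, Q (q - 1)`, and the value at `Q k` has been changed by `-shift k`. -/
structure Recompute (a b : ℕ → ℕ) (n N m i₀ : ℕ) (d₀ : ZMod m) (tab₀ Q via shift tab : ℕ → ℕ)
    (q p : ℕ) (l : List ℕ) : Prop where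
  le : p ≤ q
  pos : 0 < q
  lt : ∀ k < q, Q k < N
  inj : ∀ j < q, ∀ k < q, Q j = Q k → j = k
  root : Q 0 = b i₀
  via_root : (via 0 + 1) / 2 = i₀ + 1
  shift_root : (shift 0 : ZMod m) = d₀
  tree : ∀ k, 0 < k → k < q → Scanned a b n Q p l (via k) ∧ halfSrc b a (via k) = Q k ∧
    (via k - 1) / 2 ≠ i₀ ∧
    ∃ j < k, Q j = halfSrc a b (via k) ∧ (shift j : ZMod m) + (shift k : ZMod m) = 0
  scan : ∀ e, Scanned a b n Q p l e → (e - 1) / 2 ≠ i₀ →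
    ∃ j < q, ∃ k < q, Q j = halfSrc a b e ∧ Q k = halfSrc b a e ∧
      (shift j : ZMod m) + (shift k : ZMod m) = 0
  tab_of_notMem : ∀ w, (∀ k < q, Q k ≠ w) → tab w = tab₀ w
  tab_queue : ∀ k < q, tab (Q k) < m ∧
    (tab (Q k) : ZMod m) = (tab₀ (Q k) : ZMod m) - (shift k : ZMod m)

/-- The recomputation never uses the edge `i₀`. In a forest it therefore stays on the side of `b i₀`
and leaves the value at `a i₀` alone. -/
theorem Recompute.link (h : Recompute a b n N m i₀ d₀ tab₀ Q via shift tab q p l) {k : ℕ}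
    (hk : k < q) : Link a b (Set.Iio n \ {i₀}) (b i₀) (Q k) := by
  induction k using Nat.strong_induction_on with
  | _ k ih =>
    rcases Nat.eq_zero_or_pos k with rfl | h1
    · rw [h.root]; exact Link.refl _
    obtain ⟨h2, h3, h4, j, h6, h7, _⟩ := h.tree k h1 hk
    have hj := joins_half (a := a) (b := b) (e := via k)
    rw [h3, ← h7] at hj
    have := h2.le
    have := h2.pos
    exact (ih j h6 (by omega)).trans (hj.link ⟨show _ < n by omega, h4⟩)

theorem Recompute.length_le (h : Recompute a b n N m i₀ d₀ tab₀ Q via shift tab q p l)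
    (ha : ∀ i < n, a i < N) (hb : ∀ i < n, b i < N)
    (hL : ∀ v < N, {w | Link a b (Set.Iio n) v w}.ncard ≤ L) : q ≤ L := by
  have := card_le_of_link ha hb hL (h.root ▸ h.lt 0 h.pos) ((Finset.range q).image Q) (by
    intro w hw
    obtain ⟨k, hk, rfl⟩ := Finset.mem_image.1 hw
    exact (h.link (Finset.mem_range.1 hk)).mono Set.sdiff_subset)
  rwa [Finset.card_image_of_injOn, Finset.card_range] at this
  intro i hi j hj hij
  exact h.inj i (by simpa using hi) j (by simpa using hj) hij

theorem Recompute.pop (h : Recompute a b n N m i₀ d₀ tab₀ Q via shift tab q p []) (hp : p < q) :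
    Recompute a b n N m i₀ d₀ tab₀ Q via shift tab q (p + 1) (outList a b (Q p) (2 * n)) := by
  have hsc : ∀ x, Scanned a b n Q (p + 1) (outList a b (Q p) (2 * n)) x ↔
      Scanned a b n Q p [] x := by
    intro x
    constructor
    · rintro ⟨h1, h2, ⟨k, hk, h3⟩, h4⟩
      refine ⟨h1, h2, ⟨k, ?_, h3⟩, by simp⟩
      rcases Nat.lt_succ_iff_lt_or_eq.1 hk with hk | rfl
      · exact hk
      · exact absurd (mem_outList.2 ⟨h1, h2, h3.symm⟩) h4
    · rintro ⟨h1, h2, ⟨k, hk, h3⟩, h4⟩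
      refine ⟨h1, h2, ⟨k, by omega, h3⟩, fun h5 => ?_⟩
      have := h.inj k (by omega) p hp (by rw [h3, (mem_outList.1 h5).2.2])
      omega
  refine ⟨hp, h.pos, h.lt, h.inj, h.root, h.via_root, h.shift_root, ?_, ?_, h.tab_of_notMem,
    h.tab_queue⟩
  · intro k h1 h2
    obtain ⟨h3, h4⟩ := h.tree k h1 h2
    exact ⟨(hsc _).2 h3, h4⟩
  · exact fun e he => h.scan e ((hsc e).1 he)

/-- At the root the skipped half-edge belongs to `i₀`, about which `scan` says nothing. Elsewhere it
is the twin of the half-edge through which the vertex was found, and the shifts at its ends already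
cancel. -/
theorem Recompute.skip (h : Recompute a b n N m i₀ d₀ tab₀ Q via shift tab q p (e :: l))
    (he : 1 ≤ e) (hp : 0 < p) (hsrc : Q (p - 1) = halfSrc a b e)
    (hv : (e + 1) / 2 = (via (p - 1) + 1) / 2) :
    Recompute a b n N m i₀ d₀ tab₀ Q via shift tab q p l := by
  have hpq := h.le
  refine ⟨h.le, h.pos, h.lt, h.inj, h.root, h.via_root, h.shift_root, ?_, ?_, h.tab_of_notMem,
    h.tab_queue⟩
  · intro k h1 h2
    obtain ⟨⟨h3, h4, h5, h6⟩, h7⟩ := h.tree k h1 h2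
    exact ⟨⟨h3, h4, h5, fun h8 => h6 (List.mem_cons_of_mem e h8)⟩, h7⟩
  · rintro x ⟨h1, h2, h3, h4⟩ hx
    rcases eq_or_ne x e with rfl | hxe
    · rcases Nat.eq_zero_or_pos (p - 1) with hp0 | hp0
      · rw [hp0, h.via_root] at hv; omega
      obtain ⟨h5, h6, _, j, h7, h8, h9⟩ := h.tree (p - 1) hp0 (by omega)
      rcases half_twin (a := a) (b := b) he h5.pos hv with h10 | ⟨_, h10⟩
      · exact absurd (h10 ▸ List.mem_cons_self) h5.notMem
      · exact ⟨p - 1, by omega, j, by omega, hsrc, h8.trans h10.symm, by rw [add_comm, h9]⟩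
    · exact h.scan x ⟨h1, h2, h3, by simp [hxe, h4]⟩ hx

/-- A half-edge of `i₀` could start at `a i₀`, which is not reached, or at the root, where it would
be the edge to be skipped. That its target is new is `Forest.fresh`. -/
theorem Recompute.fresh (h : Recompute a b n N m i₀ d₀ tab₀ Q via shift tab q p (e :: l))
    (hf : Forest a b (Set.Iio n)) (hi₀ : i₀ < n)
    (he : 1 ≤ e) (hen : e ≤ 2 * n) (hp : 0 < p) (hsrc : Q (p - 1) = halfSrc a b e)
    (hv : (e + 1) / 2 ≠ (via (p - 1) + 1) / 2) :
    (e - 1) / 2 ≠ i₀ ∧ ∀ k < q, Q k ≠ halfSrc b a e := by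
  have hpq := h.le
  constructor
  · intro hei
    have hj := joins_half (a := a) (b := b) (e := e)
    rw [hei, ← hsrc] at hj
    rcases hj with ⟨h1, _⟩ | ⟨h1, _⟩
    · have := h.link (k := p - 1) (by omega)
      rw [h1] at this
      exact hf i₀ hi₀ this.symm
    · have := h.inj (p - 1) (by omega) 0 h.pos (by rw [h1, h.root])
      rw [this, h.via_root] at hv
      omega
  · intro k hk
    refine hf.fresh (Q := Q) (s := 0) (q := q) (x := via) (fun j k _ hj _ hk => h.inj j hj k hk) ?_
      (p := p - 1) (by omega) (by omega) he (show _ < n by omega) hsrc (fun _ => hv) ?_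
      (Nat.zero_le k) hk
    · intro k h1 h2
      obtain ⟨h3, h4, _, j, h5, h6, _⟩ := h.tree k h1 h2
      have := h3.le
      exact ⟨h3.pos, show _ < n by have := h3.pos; omega, h4, j, Nat.zero_le j, h5, h6⟩
    · intro k h1 h2 h3
      exact (h.tree k h1 h2).1.notMem (h3 ▸ List.mem_cons_self)

/-- The new vertex still has its old value, because it has not been found before. Giving it the
negative of the shift of its predecessor keeps the sum along the edge. -/
theorem Recompute.enqueue (h : Recompute a b n N m i₀ d₀ tab₀ Q via shift tab q p (e :: l))
    (hf : Forest a b (Set.Iio n)) (hi₀ : i₀ < n)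
    (he : 1 ≤ e) (hen : e ≤ 2 * n) (hel : e ∉ l) (hp : 0 < p) (hsrc : Q (p - 1) = halfSrc a b e)
    (hv : (e + 1) / 2 ≠ (via (p - 1) + 1) / 2) (hdst : halfSrc b a e = w) (hw : w < N) {x y : ℕ}
    (hx : x < m) (hxd : (x : ZMod m) = (tab w : ZMod m) + (shift (p - 1) : ZMod m))
    (hyd : (y : ZMod m) = - (shift (p - 1) : ZMod m)) :
    Recompute a b n N m i₀ d₀ tab₀ (Function.update Q q w) (Function.update via q e)
      (Function.update shift q y) (Function.update tab w x) (q + 1) p l := by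
  have hpq := h.le
  obtain ⟨hei, hnew⟩ := h.fresh hf hi₀ he hen hp hsrc hv
  rw [hdst] at hnew
  have hup : ∀ (f : ℕ → ℕ) (z k : ℕ), k < q → Function.update f q z k = f k := fun f z k hk =>
    Function.update_of_ne (by omega) _ _
  have hsc : ∀ x, Scanned a b n (Function.update Q q w) p l x →
      Scanned a b n Q p (e :: l) x ∨ x = e := by
    rintro x ⟨h1, h2, ⟨k, hk, h3⟩, h4⟩
    rcases eq_or_ne x e with rfl | hxe
    · exact Or.inr rfl
    · rw [hup _ _ k (by omega)] at h3
      exact Or.inl ⟨h1, h2, ⟨k, hk, h3⟩, by simp [hxe, h4]⟩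
  have hpos := h.pos
  refine ⟨by omega, by omega, ?_, ?_, ?_, ?_, ?_, ?_, ?_, ?_, ?_⟩
  · intro k hk
    rcases Nat.lt_succ_iff_lt_or_eq.1 hk with hk | rfl
    · rw [hup _ _ k hk]; exact h.lt k hk
    · rwa [Function.update_self]
  · intro j hj k hk hjk
    rcases Nat.lt_succ_iff_lt_or_eq.1 hj with hj | rfl <;>
      rcases Nat.lt_succ_iff_lt_or_eq.1 hk with hk | rfl
    · rw [hup _ _ j hj, hup _ _ k hk] at hjk; exact h.inj j hj k hk hjk
    · rw [hup _ _ j hj, Function.update_self] at hjk; exact absurd hjk (hnew j hj)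
    · rw [hup _ _ k hk, Function.update_self] at hjk; exact absurd hjk.symm (hnew k hk)
    · rfl
  · rw [hup _ _ 0 hpos, h.root]
  · rw [hup _ _ 0 hpos, h.via_root]
  · rw [hup _ _ 0 hpos, h.shift_root]
  · intro k hk0 hk
    rcases Nat.lt_succ_iff_lt_or_eq.1 hk with hk | rfl
    · obtain ⟨⟨h1, h2, ⟨i, hi, h3⟩, h4⟩, h5, h6, j, h7, h8, h9⟩ := h.tree k hk0 hk
      rw [hup via _ k hk, hup Q _ k hk, hup shift _ k hk]
      refine ⟨⟨h1, h2, ⟨i, hi, ?_⟩, fun h10 => h4 (List.mem_cons_of_mem e h10)⟩, h5, h6, j, h7,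
        ?_, ?_⟩
      · rwa [hup Q _ i (by omega)]
      · rwa [hup Q _ j (by omega)]
      · rwa [hup shift _ j (by omega)]
    · simp only [Function.update_self]
      refine ⟨⟨he, hen, ⟨p - 1, by omega, ?_⟩, hel⟩, hdst, hei, p - 1, by omega, ?_, ?_⟩
      · rwa [hup Q _ (p - 1) (by omega)]
      · rwa [hup Q _ (p - 1) (by omega)]
      · rw [hup shift _ (p - 1) (by omega), hyd, add_neg_cancel]
  · intro x hx hxi
    rcases hsc x hx with hx | rfl
    · obtain ⟨j, hj, k, hk, h1, h2, h3⟩ := h.scan x hx hxi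
      refine ⟨j, by omega, k, by omega, ?_⟩
      rw [hup Q _ j hj, hup Q _ k hk, hup shift _ j hj, hup shift _ k hk]
      exact ⟨h1, h2, h3⟩
    · refine ⟨p - 1, by omega, q, by omega, ?_⟩
      rw [hup Q _ (p - 1) (by omega), hup shift _ (p - 1) (by omega)]
      simp only [Function.update_self]
      exact ⟨hsrc, hdst.symm, by rw [hyd, add_neg_cancel]⟩
  · intro w' hw'
    have h1 := hw' q (by omega)
    rw [Function.update_self] at h1
    rw [Function.update_of_ne h1.symm]
    refine h.tab_of_notMem w' fun k hk => ?_
    have := hw' k (by omega)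
    rwa [hup Q _ k hk] at this
  · intro k hk
    rcases Nat.lt_succ_iff_lt_or_eq.1 hk with hk | rfl
    · rw [hup Q _ k hk, hup shift _ k hk, Function.update_of_ne (hnew k hk)]
      exact h.tab_queue k hk
    · simp only [Function.update_self]
      refine ⟨hx, ?_⟩
      rw [hxd, hyd, h.tab_of_notMem w hnew]
      ring

/-- At the edge `i₀` only the end `b i₀` changes, to the value that solves the new equation. Any
other edge has either both ends in the queue, with opposite shifts, or neither. -/
theorem Recompute.solves {h3 val : ℕ → ℕ} {z : ℕ}
    (h : Recompute a b n N m i₀ d₀ tab₀ Q via shift tab q q [])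
    (hf : Forest a b (Set.Iio n)) (hi₀ : i₀ < n)
    (hs : Solves m a b n N h3 val tab₀)
    (hd : d₀ = (tab₀ (b i₀) : ZMod m) - ((z : ZMod m) - tab₀ (a i₀) - h3 i₀)) :
    Solves m a b n N h3 (Function.update val i₀ z) tab := by
  constructor
  · intro w hw
    by_cases hwQ : ∀ k < q, Q k ≠ w
    · rw [h.tab_of_notMem w hwQ]; exact hs.lt w hw
    · push Not at hwQ
      obtain ⟨k, hk, rfl⟩ := hwQ
      exact (h.tab_queue k hk).1
  · intro i hi
    rcases eq_or_ne i i₀ with rfl | hii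
    · have h1 : tab (a i) = tab₀ (a i) := by
        refine h.tab_of_notMem _ fun k hk hki => ?_
        have := h.link hk
        rw [hki] at this
        exact hf i hi₀ this.symm
      have h2 := (h.tab_queue 0 h.pos).2
      rw [h.root, h.shift_root, hd] at h2
      rw [h1, h2, Function.update_self]
      ring
    · rw [Function.update_of_ne hii, ← hs.eq i hi]
      -- Nothing is pending at the end, so every half-edge out of a found vertex has been scanned
      -- and its ends carry opposite shifts.
      have key : ∀ e, 1 ≤ e → e ≤ 2 * n → (e - 1) / 2 = i → ∀ k < q, Q k = halfSrc a b e →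
          (tab (halfSrc a b e) : ZMod m) + (tab (halfSrc b a e) : ZMod m) =
            (tab₀ (halfSrc a b e) : ZMod m) + (tab₀ (halfSrc b a e) : ZMod m) := by
        intro e h1 h2 h3 k hk hke
        obtain ⟨j, hj, j', hj', h4, h5, h6⟩ := h.scan e ⟨h1, h2, ⟨k, hk, hke⟩, by simp⟩
          (by rwa [h3])
        rw [← h4, ← h5, (h.tab_queue j hj).2, (h.tab_queue j' hj').2]
        linear_combination -h6
      by_cases ha : ∃ k < q, Q k = a i
      · obtain ⟨k, hk, hka⟩ := ha
        have := key (2 * i + 1) (by omega) (by omega) (by omega) k hk (by rw [halfSrc_odd, hka])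
        rw [halfSrc_odd, halfSrc_odd] at this
        rw [this]
      · by_cases hb : ∃ k < q, Q k = b i
        · obtain ⟨k, hk, hka⟩ := hb
          have := key (2 * i + 2) (by omega) (by omega) (by omega) k hk (by rw [halfSrc_even, hka])
          rw [halfSrc_even, halfSrc_even] at this
          linear_combination this
        · push Not at ha hb
          rw [h.tab_of_notMem _ ha, h.tab_of_notMem _ hb]

/-- Among the half-edges out of a vertex, there is at most one of a given edge. -/
theorem length_filter_outList_le (hf : Forest a b (Set.Iio n)) (c : ℕ) :
    ((outList a b w (2 * n)).filter fun e => (e + 1) / 2 = c).length ≤ 1 := by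
  rw [← List.toFinset_card_of_nodup (nodup_outList.filter _), Finset.card_le_one]
  intro x hx y hy
  simp only [List.mem_toFinset, List.mem_filter, decide_eq_true_eq] at hx hy
  obtain ⟨hx1, hx2⟩ := hx
  obtain ⟨hy1, hy2⟩ := hy
  obtain ⟨h1, h2, h3⟩ := mem_outList.1 hx1
  obtain ⟨h4, h5, h6⟩ := mem_outList.1 hy1
  rcases half_twin (a := a) (b := b) h1 h4 (hx2.trans hy2.symm) with h | ⟨h, _⟩
  · exact h
  · exfalso
    have hne := hf.ne (show (y - 1) / 2 ∈ Set.Iio n from show _ < n by omega)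
    rw [h3, ← h6] at h
    simp only [halfSrc] at h
    split_ifs at h
    · exact hne h
    · exact hne h.symm

/-- The half-edges out of a vertex lead to different vertices. -/
theorem length_outList_le (hf : Forest a b (Set.Iio n))
    (ha : ∀ i < n, a i < N) (hb : ∀ i < n, b i < N)
    (hL : ∀ v < N, {w | Link a b (Set.Iio n) v w}.ncard ≤ L) (hw : w < N) :
    (outList a b w (2 * n)).length ≤ L := by
  have hinj : Set.InjOn (halfSrc b a) ((outList a b w (2 * n)).toFinset : Set ℕ) := by
    intro x hx y hy hxy
    obtain ⟨h1, h2, h3⟩ := mem_outList.1 (List.mem_toFinset.1 hx)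
    obtain ⟨h4, h5, h6⟩ := mem_outList.1 (List.mem_toFinset.1 hy)
    have hjx := joins_half (a := a) (b := b) (e := x)
    have hjy := joins_half (a := a) (b := b) (e := y)
    rw [h3, hxy] at hjx
    rw [h6] at hjy
    have hxn : (x - 1) / 2 < n := by omega
    have heq := hf.eq_of_joins hxn (show (y - 1) / 2 < n by omega) hjx hjy
    rcases half_twin (a := a) (b := b) h1 h4 (by omega) with h | ⟨h, h'⟩
    · exact h
    · exfalso
      have hne := hf.ne (i := (x - 1) / 2) hxn
      rw [h3, ← hxy] at h
      rcases hjx with ⟨h8, h9⟩ | ⟨h8, h9⟩ <;> rw [← h8, ← h9, ← hxy, h] at hne <;>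
        exact hne rfl
  have := card_le_of_link ha hb hL hw ((outList a b w (2 * n)).toFinset.image (halfSrc b a)) (by
    intro x hx
    obtain ⟨e, he, rfl⟩ := Finset.mem_image.1 hx
    obtain ⟨h1, h2, h3⟩ := mem_outList.1 (List.mem_toFinset.1 he)
    have := link_half (a := a) (b := b) h1 h2
    rwa [h3] at this)
  rwa [Finset.card_image_of_injOn hinj, List.toFinset_card_of_nodup nodup_outList] at this

end

/-- The loop of an update that looks for the edge. -/
def findLoop : Stmt :=
  .while (.bin .ne (.get .tgt (.var .e)) (.var .v)) (.set .e (.get .next (.var .e)))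

/-- The loop of an update through the half-edges out of a vertex. -/
def shiftLoop : Stmt := .while (.bin .ne (.var .e) (.lit 0)) (block [
  .ite (.bin .ne (edgeOf (.var .e)) (edgeOf (.var .a)))
    (block [
      .set .v (.get .tgt (.var .e)),
      .store .tab (.var .v) (.bin .addMod (.get .tab (.var .v)) (.var .d)),
      .store .queue (.var .q) (.var .v),
      .store .via (.var .q) (.var .e),
      .store .shift (.var .q) (.bin .subMod (.lit 0) (.var .d)),
      incr .q])
    .skip,
  .set .e (.get .next (.var .e))])

/-- The loop of an update through the component. -/
def recomputeLoop : Stmt := .while (ltVar .p .q) (block [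
  .set .u (.get .queue (.var .p)),
  .set .a (.get .via (.var .p)),
  .set .d (.get .shift (.var .p)),
  incr .p,
  .set .e (.get .head (.var .u)),
  shiftLoop])

theorem updateProg_eq : updateProg = block [
  .set .u (.hash1 (.lit 0)),
  .set .v (.hash2 (.lit 0)),
  .set .e (.get .head (.var .u)),
  findLoop,
  .set .res (.bin .subMod
    (.bin .subMod (.var .newVal) (.get .tab (.var .u))) (.hash3 (.lit 0))),
  .set .d (.bin .subMod (.get .tab (.var .v)) (.var .res)),
  .store .tab (.var .v) (.var .res),
  .set .p (.lit 0),
  .set .q (.lit 1),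
  .store .queue (.lit 0) (.var .v),
  .store .via (.lit 0) (.var .e),
  .store .shift (.lit 0) (.var .d),
  recomputeLoop] := rfl

/-! ### The loops of an update and of a query -/

section

variable {D : Type uD} {E : Env D} {σ τ : State} {a b : ℕ → ℕ} {N n L i₀ p : ℕ}
  {tab₀ : ℕ → ℕ} {l : List ℕ} {d₀ : ZMod E.m}

/-- The state `υ` while the edge is being looked for, when `l` are the remaining half-edges. -/
structure FindState (σ υ : State) (l : List ℕ) : Prop where
  arr : υ.arr = σ.arr
  trial : υ.trial = σ.trial
  reg_u : υ.reg .u = σ.reg .u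
  reg_v : υ.reg .v = σ.reg .v
  reg_newVal : υ.reg .newVal = σ.reg .newVal
  chain : OutChain (σ.arr .next) (υ.reg .e) l

/-- The half-edge `2 * i₀ + 1` stays in the remaining list, so the loop stops before the list ends.
A forest has no parallel edges, so the target identifies the edge. -/
theorem runs_findLoop (hA : AdjLists a b N (2 * n) (σ.arr .head) (σ.arr .next) (σ.arr .tgt))
    (ha : ∀ i < n, a i < N) (hf : Forest a b (Set.Iio n)) (hi₀ : i₀ < n)
    (hv : σ.reg .v = b i₀) (he : σ.reg .e = σ.arr .head (a i₀)) :
    Runs E findLoop σ fun τ c => (∃ l, FindState σ τ l) ∧ (τ.reg .e + 1) / 2 = i₀ + 1 ∧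
      c ≤ 10 * (outList a b (a i₀) (2 * n)).length + 10 := by
  refine Runs.while' (fun k τ => ∃ l, FindState σ τ l ∧ 2 * i₀ + 1 ∈ l ∧
    (∀ e ∈ l, 1 ≤ e ∧ e ≤ 2 * n ∧ halfSrc a b e = a i₀) ∧ k = 10 * l.length)
    ⟨outList a b (a i₀) (2 * n), ⟨rfl, rfl, rfl, rfl, rfl, ?_⟩, ?_, ?_, rfl⟩ ?_ ?_
  · rw [he]; exact hA.chain _ (ha i₀ hi₀)
  · exact mem_outList.2 ⟨by omega, by omega, halfSrc_odd i₀⟩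
  · exact fun e he => mem_outList.1 he
  · rintro _ τ ⟨l, h, hmem, hl, rfl⟩ hb
    obtain _ | ⟨e, l⟩ := l
    · simp at hmem
    obtain ⟨hc1, hc2, hc3⟩ := h.chain
    obtain ⟨he1, he2, he3⟩ := hl e List.mem_cons_self
    rw [runs_set]
    refine ⟨_, ⟨l, ⟨h.arr, h.trial, h.reg_u, h.reg_v, h.reg_newVal, ?_⟩, ?_,
      fun x hx => hl x (List.mem_cons_of_mem e hx), rfl⟩, ?_⟩
    · simpa [h.arr, hc1] using hc3
    · rcases List.mem_cons.1 hmem with hme | hme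
      · exfalso
        have htgt := hA.tgt_eq e he1 he2
        rw [← hme, halfSrc_odd] at htgt
        simp [h.arr, h.reg_v, hc1, ← hme, htgt, hv] at hb
      · exact hme
    · simp; omega
  · rintro _ τ c ⟨l, h, hmem, hl, rfl⟩ hb hc
    obtain _ | ⟨e, l⟩ := l
    · simp at hmem
    obtain ⟨hc1, hc2, hc3⟩ := h.chain
    obtain ⟨he1, he2, he3⟩ := hl e List.mem_cons_self
    refine ⟨⟨_, h⟩, ?_, ?_⟩
    · simp [h.arr, h.reg_v, hc1, hA.tgt_eq e he1 he2, hv] at hb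
      have hj := joins_half (a := a) (b := b) (e := e)
      rw [he3, hb] at hj
      have := hf.eq_of_joins (show (e - 1) / 2 < n by omega) (show i₀ < n from hi₀) hj
        (Or.inl ⟨rfl, rfl⟩)
      omega
    · simp at hc
      omega

/-- The state `τ` of the machine during an update, which has begun in the state `σ`. -/
structure UpdateState (a b : ℕ → ℕ) (N n i₀ m : ℕ) (d₀ : ZMod m) (σ τ : State) (p : ℕ)
    (l : List ℕ) : Prop where
  trial : τ.trial = σ.trial
  head : τ.arr .head = σ.arr .head
  next : τ.arr .next = σ.arr .next
  tgt : τ.arr .tgt = σ.arr .tgt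
  inv : Recompute a b n N m i₀ d₀ (σ.arr .tab) (τ.arr .queue) (τ.arr .via) (τ.arr .shift)
    (τ.arr .tab) (τ.reg .q) p l

/-- The state `υ` during the loop through the half-edges out of `Q (p - 1)`. -/
structure ShiftState (a b : ℕ → ℕ) (N n i₀ m : ℕ) (d₀ : ZMod m) (σ υ : State) (p : ℕ)
    (l : List ℕ) : Prop where
  state : UpdateState a b N n i₀ m d₀ σ υ p l
  reg_p : υ.reg .p = p
  reg_a : υ.reg .a = υ.arr .via (p - 1)
  reg_d : υ.reg .d = υ.arr .shift (p - 1)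
  mem : ∀ e ∈ l, 1 ≤ e ∧ e ≤ 2 * n ∧ υ.arr .queue (p - 1) = halfSrc a b e
  nodup : l.Nodup
  chain : OutChain (σ.arr .next) (υ.reg .e) l

/-- A half-edge either enqueues a vertex, which happens for at most `L` vertices in total, or
belongs to the edge through which the current vertex was found, and there is at most one of this
kind. So the time is charged to vertices, not to degrees. -/
theorem runs_shiftLoop (hm : 0 < E.m)
    (hA : AdjLists a b N (2 * n) (σ.arr .head) (σ.arr .next) (σ.arr .tgt))
    (ha : ∀ i < n, a i < N) (hb : ∀ i < n, b i < N) (hf : Forest a b (Set.Iio n)) (hi₀ : i₀ < n)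
    (hL : ∀ v < N, {w | Link a b (Set.Iio n) v w}.ncard ≤ L)
    (h : ShiftState a b N n i₀ E.m d₀ σ τ p l) (hp : 0 < p)
    (hcount : (l.filter fun e => (e + 1) / 2 = (τ.reg .a + 1) / 2).length ≤ 1) :
    Runs E shiftLoop τ fun υ c => ShiftState a b N n i₀ E.m d₀ σ υ p [] ∧
      c + 60 * (L - υ.reg .q) ≤ 60 * (L - τ.reg .q) + 70 := by
  have : NeZero E.m := ⟨hm.ne'⟩
  refine Runs.while' (fun k υ => ∃ l', ShiftState a b N n i₀ E.m d₀ σ υ p l' ∧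
    k = 60 * (L - υ.reg .q) +
      60 * (l'.filter fun e => (e + 1) / 2 = (υ.reg .a + 1) / 2).length) ⟨l, h, rfl⟩ ?_ ?_
  · rintro _ υ ⟨l', h, rfl⟩ hbe
    simp at hbe
    obtain _ | ⟨e, l'⟩ := l'
    · exact absurd h.chain hbe
    obtain ⟨hee, he0, hc⟩ := h.chain
    subst hee
    obtain ⟨he, hen, hsrc⟩ := h.mem (υ.reg .e) List.mem_cons_self
    have hnd := List.nodup_cons.1 h.nodup
    have htgt : υ.arr .tgt (υ.reg .e) = halfSrc b a (υ.reg .e) := by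
      rw [h.state.tgt, hA.tgt_eq _ he hen]
    have hw : halfSrc b a (υ.reg .e) < N := halfSrc_lt hb ha he hen
    have hle := h.state.inv.le
    have hl' : ∀ e ∈ l', 1 ≤ e ∧ e ≤ 2 * n ∧ υ.arr .queue (p - 1) = halfSrc a b e :=
      fun e k => h.mem e (List.mem_cons_of_mem _ k)
    by_cases h1 : (υ.reg .e + 1) / 2 = (υ.reg .a + 1) / 2
    · suffices H : Runs E _ υ fun υ' c => ShiftState a b N n i₀ E.m d₀ σ υ' p l' ∧ c ≤ 50 ∧
          υ'.reg .q = υ.reg .q ∧ υ'.reg .a = υ.reg .a from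
        H.mono fun υ' c ⟨h2, h3, h4, h5⟩ => ⟨_, ⟨l', h2, rfl⟩, by
          rw [h4, h5, List.filter_cons_of_pos (by simpa using h1)]
          simp
          omega⟩
      simp [h.state.next, h1]
      exact ⟨⟨h.state.trial, h.state.head, h.state.next, h.state.tgt,
        h.state.inv.skip he hp hsrc (by rw [h1, h.reg_a])⟩, h.reg_p, h.reg_a, h.reg_d, hl', hnd.2,
        hc⟩
    · suffices H : Runs E _ υ fun υ' c => ShiftState a b N n i₀ E.m d₀ σ υ' p l' ∧ c ≤ 50 ∧
          υ'.reg .q = υ.reg .q + 1 ∧ υ'.reg .a = υ.reg .a from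
        H.mono fun υ' c ⟨h2, h3, h4, h5⟩ => ⟨_, ⟨l', h2, rfl⟩, by
          have := h2.state.inv.length_le ha hb hL
          rw [h5, List.filter_cons_of_neg (by simpa using h1)]
          simp
          omega⟩
      have hinv := h.state.inv.enqueue (w := halfSrc b a (υ.reg .e))
        (x := ((υ.arr .tab (halfSrc b a (υ.reg .e)) : ZMod E.m) + (υ.reg .d : ZMod E.m)).val)
        (y := (- (υ.reg .d : ZMod E.m)).val)
        hf hi₀ he hen hnd.1 hp hsrc (by rwa [← h.reg_a]) rfl hw
        (ZMod.val_lt _) (by rw [ZMod.natCast_zmod_val, h.reg_d])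
        (by rw [ZMod.natCast_zmod_val, h.reg_d])
      have hup : ∀ (f : ℕ → ℕ) (z : ℕ), Function.update f (υ.reg .q) z (p - 1) = f (p - 1) :=
        fun f z => Function.update_of_ne (by omega) _ _
      simp [h.state.next, htgt, h1]
      refine ⟨⟨h.state.trial, h.state.head, h.state.next, h.state.tgt, hinv⟩, h.reg_p, ?_, ?_, ?_,
        hnd.2, hc⟩
      · exact h.reg_a.trans (hup _ _).symm
      · exact h.reg_d.trans (hup _ _).symm
      · intro e' he'
        obtain ⟨h2, h3, h4⟩ := hl' e' he'
        exact ⟨h2, h3, (hup _ _).trans h4⟩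
  · rintro _ υ c ⟨l', h, rfl⟩ hbe hcost
    simp at hbe
    obtain _ | ⟨e, l'⟩ := l'
    · exact ⟨h, by simp at hcost; omega⟩
    · exact absurd (h.chain.1.symm.trans hbe) h.chain.2.1

theorem runs_recomputeLoop (hm : 0 < E.m)
    (hA : AdjLists a b N (2 * n) (σ.arr .head) (σ.arr .next) (σ.arr .tgt))
    (ha : ∀ i < n, a i < N) (hb : ∀ i < n, b i < N) (hf : Forest a b (Set.Iio n)) (hi₀ : i₀ < n)
    (hL : ∀ v < N, {w | Link a b (Set.Iio n) v w}.ncard ≤ L)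
    (h : UpdateState a b N n i₀ E.m d₀ σ τ 0 []) (hp : τ.reg .p = 0) :
    Runs E recomputeLoop τ fun υ c => UpdateState a b N n i₀ E.m d₀ σ υ (υ.reg .q) [] ∧
      c ≤ 160 * L + 10 := by
  -- `60` is reserved for each vertex still to be found and `100` for each still to be processed,
  -- hence `160 * L` in all.
  refine Runs.while (fun υ => UpdateState a b N n i₀ E.m d₀ σ υ (υ.reg .p) [])
    (fun υ => 60 * (L - υ.reg .q) + 100 * (L - υ.reg .p)) (by rwa [hp]) ?_ ?_
  · rintro υ h hbe
    simp at hbe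
    have hlt := h.inv.lt _ hbe
    have hqL := h.inv.length_le ha hb hL
    simp only [block, runs_seq, runs_set, incr]
    refine Runs.mono (runs_shiftLoop (σ := σ) (p := υ.reg .p + 1)
      (l := outList a b (υ.arr .queue (υ.reg .p)) (2 * n)) (d₀ := d₀) hm hA ha hb hf hi₀ hL ?_
      (Nat.succ_pos _) (length_filter_outList_le hf _)) ?_
    · refine ⟨⟨h.trial, h.head, h.next, h.tgt, h.inv.pop hbe⟩, rfl, rfl, rfl, ?_, nodup_outList, ?_⟩
      · intro e he
        obtain ⟨h1, h2, h3⟩ := mem_outList.1 he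
        exact ⟨h1, h2, by simp [h3]⟩
      · simpa [h.head] using hA.chain _ hlt
    · rintro υ' c ⟨h', hc⟩
      have hp' := h'.reg_p
      refine ⟨by rw [hp']; exact h'.state, ?_⟩
      rw [hp']
      simp at hc ⊢
      omega
  · rintro υ c h hbe hc
    simp at hbe
    have hpq : υ.reg .p = υ.reg .q := le_antisymm h.inv.le hbe
    rw [hpq] at h
    simp at hc
    exact ⟨h, by omega⟩

theorem runs_updateProg {h3 val : ℕ → ℕ} (hm : 0 < E.m)
    (hA : AdjLists a b N (2 * n) (σ.arr .head) (σ.arr .next) (σ.arr .tgt))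
    (ha : ∀ i < n, a i < N) (hb : ∀ i < n, b i < N) (hf : Forest a b (Set.Iio n)) (hi₀ : i₀ < n)
    (hL : ∀ v < N, {w | Link a b (Set.Iio n) v w}.ncard ≤ L)
    (hh1 : E.h1 σ.trial (E.key 0) = a i₀) (hh2 : E.h2 σ.trial (E.key 0) = b i₀)
    (hh3 : E.h3 (E.key 0) = h3 i₀) (hs : Solves E.m a b n N h3 val (σ.arr .tab)) :
    Runs E updateProg σ fun τ c => τ.trial = σ.trial ∧ τ.arr .head = σ.arr .head ∧
      τ.arr .next = σ.arr .next ∧ τ.arr .tgt = σ.arr .tgt ∧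
      Solves E.m a b n N h3 (Function.update val i₀ (σ.reg .newVal)) (τ.arr .tab) ∧
      c ≤ 170 * L + 100 := by
  have : NeZero E.m := ⟨hm.ne'⟩
  rw [updateProg_eq]
  simp only [block, runs_seq, runs_set, runs_store]
  refine (runs_findLoop (a := a) (b := b) (N := N) (n := n) (i₀ := i₀) (by exact hA) ha hf hi₀ ?_
    ?_).mono ?_
  · simp [hh2]
  · simp [hh1]
  rintro υ c ⟨⟨l, hF⟩, he, hc⟩
  have harr : υ.arr = σ.arr := hF.arr
  have htr : υ.trial = σ.trial := hF.trial
  have hu : υ.reg .u = a i₀ := by rw [hF.reg_u]; simp [hh1]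
  have hv : υ.reg .v = b i₀ := by rw [hF.reg_v]; simp [hh2]
  have hz : υ.reg .newVal = σ.reg .newVal := by rw [hF.reg_newVal]; simp
  have hlen := length_outList_le hf ha hb hL (ha i₀ hi₀)
  -- The shift `d₀` is the old value at `b i₀` minus the new one, in accordance with the convention
  -- that a value changes by `-shift`. Finding the edge costs the other `10 * L`.
  refine (runs_recomputeLoop (σ := σ) (a := a) (b := b) (N := N) (n := n) (i₀ := i₀) (L := L)
    (d₀ := (σ.arr .tab (b i₀) : ZMod E.m) - ((σ.reg .newVal : ZMod E.m) -
      (σ.arr .tab (a i₀) : ZMod E.m) - (h3 i₀ : ZMod E.m))) hm hA ha hb hf hi₀ hL ?_ ?_).mono ?_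
  · refine ⟨?_, ?_, ?_, ?_, ?_⟩
    · simp [htr]
    · simp [harr]
    · simp [harr]
    · simp [harr]
    · simp [harr, hu, hv, hz, hh3]
      refine ⟨by omega, by omega, ?_, ?_, ?_, ?_, ?_, ?_, ?_, ?_, ?_⟩
      · intro k hk
        obtain rfl : k = 0 := by omega
        simpa using hb i₀ hi₀
      · intros; omega
      · simp
      · simpa using he
      · simp
      · intros; omega
      · rintro x ⟨_, _, ⟨k, hk, _⟩, _⟩; omega
      · intro w hw
        have := hw 0 (by omega)
        rw [Function.update_self] at this
        rw [Function.update_of_ne this.symm]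
      · intro k hk
        obtain rfl : k = 0 := by omega
        simp [ZMod.val_lt]
  · simp
  · rintro ρ d ⟨hU, hd⟩
    refine ⟨hU.trial, hU.head, hU.next, hU.tgt, hU.inv.solves hf hi₀ hs rfl, ?_⟩
    simp at hd hc ⊢
    omega

/-- A query looks at two cells of the table and evaluates three hash functions. -/
theorem exec_queryProg (hm : 0 < E.m) : ∃ τ c, Exec E queryProg σ τ c ∧
    τ.reg .res = ((σ.arr .tab (E.h1 σ.trial (E.key 0)) : ZMod E.m) +
      (σ.arr .tab (E.h2 σ.trial (E.key 0)) : ZMod E.m) + (E.h3 (E.key 0) : ZMod E.m)).val ∧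
    (τ.reg .bot = 0 ↔ τ.reg .res < σ.reg .numVals) ∧
    c.steps ≤ 20 ∧ c.hashes = 3 ∧ c.reads = 2 := by
  by_cases hb : Expr.eval E (σ.setReg .res (Expr.eval E σ (.bin .addMod
    (.bin .addMod (.get .tab (.hash1 (.lit 0))) (.get .tab (.hash2 (.lit 0))))
    (.hash3 (.lit 0))))) (ltVar .res .numVals) = 0
  · have h := hb
    refine ⟨_, _, .seq (.set _ _ _) (.ite_false hb (.set _ _ _)), ?_, ?_, ?_⟩
    · have : NeZero E.m := ⟨hm.ne'⟩
      simp
    · simp at h ⊢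
      exact h
    · simp [Cost.add_hashes, Cost.add_reads]
  · have h := hb
    refine ⟨_, _, .seq (.set _ _ _) (.ite_true hb (.set _ _ _)), ?_, ?_, ?_⟩
    · have : NeZero E.m := ⟨hm.ne'⟩
      simp
    · simp at h ⊢
      exact h
    · simp [Cost.add_hashes, Cost.add_reads]

end

/-! ## The data structure -/

section

variable {D : Type uD} {n N m k : ℕ} {S : Finset D} {ω : HashSpace N m D} {st : Store n N m}

theorem arrayOf_of_lt {l : ℕ} {x : Fin l → ℕ} {j : ℕ} (h : j < l) : arrayOf x j = x ⟨j, h⟩ :=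
  dif_pos h

theorem AdjLists.congr {a b : ℕ → ℕ} {K : ℕ} {head head' next next' tgt tgt' : ℕ → ℕ}
    (h : AdjLists a b N K head next tgt) (h1 : ∀ w < N, head' w = head w)
    (h2 : ∀ e ≤ K, next' e = next e) (h3 : ∀ e ≤ K, tgt' e = tgt e) :
    AdjLists a b N K head' next' tgt' := by
  constructor
  · intro w hw
    rw [h1 w hw]
    exact (h.chain w hw).congr fun x hx => h2 x (mem_outList.1 hx).2.1
  · intro e he heK
    rw [h3 e heK]
    exact h.tgt_eq e he heK

theorem Solves.congr {a b h3 val val' tab tab' : ℕ → ℕ} (h : Solves m a b n N h3 val tab)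
    (ha : ∀ i < n, a i < N) (hb : ∀ i < n, b i < N)
    (h1 : ∀ i < n, val' i = val i) (h2 : ∀ w < N, tab' w = tab w) :
    Solves m a b n N h3 val' tab' := by
  constructor
  · intro w hw
    rw [h2 w hw]; exact h.lt w hw
  · intro i hi
    rw [h2 _ (ha i hi), h2 _ (hb i hi), h1 i hi]
    exact h.eq i hi

/-- Residues are below `m`, so cells of `⌈log₂ m⌉` bits store them without loss. -/
theorem toNat_ofNat_clog {x : ℕ} (h : x < m) : (BitVec.ofNat (Nat.clog 2 m) x).toNat = x := by
  rw [BitVec.toNat_ofNat, Nat.mod_eq_of_lt]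
  exact h.trans_le (Nat.le_pow_clog one_lt_two m)

theorem Updates.det {w : BitVec k} {y : D} {st₁ st₂ : Store n N m} {c₁ c₂ : Cost}
    (h₁ : Updates ω st y w st₁ c₁) (h₂ : Updates ω st y w st₂ c₂) : st₁ = st₂ := by
  obtain ⟨σ, h, rfl⟩ := h₁
  obtain ⟨σ', h', rfl⟩ := h₂
  obtain ⟨rfl, rfl⟩ := h.det h'
  rfl

theorem UpdateSeq.det {us : List (S × BitVec k)} {st₁ st₂ : Store n N m}
    (h₁ : UpdateSeq ω us st st₁) (h₂ : UpdateSeq ω us st st₂) : st₁ = st₂ := by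
  induction h₁ with
  | nil => cases h₂; rfl
  | cons u _ ih =>
    cases h₂ with
    | cons u' h' =>
      obtain rfl := u.det u'
      exact ih h'

/-- The sum that is computed in a query. -/
def answer (ω : HashSpace N m D) (F : Filter N (Nat.clog 2 m)) (x : D) : ZMod m :=
  ((F.table (ω.h1 F.trial x)).toNat : ZMod m) + ((F.table (ω.h2 F.trial x)).toNat : ZMod m) +
    ((ω.h3 x : ℕ) : ZMod m)

theorem Queries.det {w : ℕ} {F : Filter N w} {x : D} {o₁ o₂ : Option (BitVec k)} {c₁ c₂ : Cost}
    (h₁ : Queries k ω F x o₁ c₁) (h₂ : Queries k ω F x o₂ c₂) : o₁ = o₂ := by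
  obtain ⟨σ, h, rfl⟩ := h₁
  obtain ⟨σ', h', rfl⟩ := h₂
  obtain ⟨rfl, rfl⟩ := h.det h'
  rfl

theorem exists_queries [NeZero m] (ω : HashSpace N m D) (F : Filter N (Nat.clog 2 m)) (x : D) :
    ∃ c, Queries k ω F x (if (answer ω F x).val < 2 ^ k then
      some (BitVec.ofNat k (answer ω F x).val) else none) c ∧
      c.steps ≤ 20 ∧ c.hashes = 3 ∧ c.reads = 2 := by
  obtain ⟨σ, c, h, h1, h2, h3⟩ := exec_queryProg (E := ω.env fun _ => x) (σ := F.load k)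
    (NeZero.pos m)
  refine ⟨c, ⟨σ, h, ?_⟩, h3⟩
  have hres : σ.reg .res = (answer ω F x).val := by
    rw [h1]
    change (((arrayOf (fun v => (F.table v).toNat) (ω.h1 F.trial x : ℕ) : ℕ) : ZMod m) +
      ((arrayOf (fun v => (F.table v).toNat) (ω.h2 F.trial x : ℕ) : ℕ) : ZMod m) + _).val = _
    rw [arrayOf_of_lt (ω.h1 F.trial x).2, arrayOf_of_lt (ω.h2 F.trial x).2]
    rfl
  have hbot : σ.reg .bot = 0 ↔ (answer ω F x).val < 2 ^ k := by rw [h2, hres]; rfl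
  rw [if_congr hbot rfl rfl, hres]

theorem Filter.length_bits {w : ℕ} (F : Filter N w) : F.bits.length = N * w := by
  simp [Filter.bits, List.length_flatMap, List.sum_ofFn]

end

/-! ### Valid stores: creation, updates and queries -/

section

variable {D : Type uD} {n N m k L : ℕ} [NeZero n] {S : Finset D} {enum : Fin n ≃ S}
  {f : S → BitVec k} {ω : HashSpace N m D} {st : Store n N m} {c : Cost}

/-- The environment of the creation. -/
def HashSpace.createEnv (ω : HashSpace N m D) (enum : Fin n ≃ S) : Env D :=
  ω.env fun j => (enum (Fin.ofNat n j) : D)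

theorem enum_ofNat (i : Fin n) : enum (Fin.ofNat n i) = enum i := by
  congr 1
  ext
  simp [Fin.ofNat, Nat.mod_eq_of_lt i.2]

/-- Identifies the multigraph seen by the machine, with vertices and edges numbered in `ℕ`, with the
one on `Fin N` and `S`. Key numbers wrap around modulo `n`, so the numbering is injective only on
`Set.Iio n`. -/
theorem goodTrial_iff {t : ℕ} :
    GoodTrial (ω.createEnv enum) n N L t ↔ GoodPair (ω.h1 t) (ω.h2 t) S L := by
  have hψ : Set.InjOn (fun i => (enum (Fin.ofNat n i) : D)) (Set.Iio n) := by
    intro i hi j hj hij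
    have h := enum.injective (Subtype.ext hij)
    have hi : i < n := hi
    have hj : j < n := hj
    have := congrArg Fin.val h
    simpa [Fin.ofNat, Nat.mod_eq_of_lt hi, Nat.mod_eq_of_lt hj] using this
  have himg : (fun i => (enum (Fin.ofNat n i) : D)) '' Set.Iio n = (S : Set D) := by
    ext s
    constructor
    · rintro ⟨i, _, rfl⟩
      exact (enum _).2
    · intro hs
      refine ⟨enum.symm ⟨s, hs⟩, (enum.symm ⟨s, hs⟩).2, ?_⟩
      simp only [enum_ofNat, Equiv.apply_symm_apply]
  rw [goodPair_iff, GoodTrial]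
  refine and_congr ?_ ?_
  · exact Forest.map_iff (φ := Fin.val) Fin.val_injective hψ (fun _ _ => rfl) (fun _ _ => rfl) himg
  · have e : ∀ v : Fin N, {w | Link (fun i => (ω.createEnv enum).h1 t ((ω.createEnv enum).key i))
        (fun i => (ω.createEnv enum).h2 t ((ω.createEnv enum).key i)) (Set.Iio n) (v : ℕ) w} =
        Fin.val '' {w | Link (ω.h1 t) (ω.h2 t) (S : Set D) v w} := by
      intro v
      ext y
      refine (Link.map_iff (φ := Fin.val) (a := ω.h1 t) (b := ω.h2 t) Fin.val_injective
        (fun _ _ => rfl) (fun _ _ => rfl) himg).trans ?_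
      exact ⟨fun ⟨w, h1, h2⟩ => ⟨w, h2, h1.symm⟩, fun ⟨w, h1, h2⟩ => ⟨w, h2.symm, h1⟩⟩
    constructor
    · intro h v
      have := h v v.2
      rwa [e, Set.ncard_image_of_injective _ Fin.val_injective] at this
    · intro h v hv
      have := e ⟨v, hv⟩
      simp only at this
      rw [this, Set.ncard_image_of_injective _ Fin.val_injective]
      exact h _

/-- The store consists of adjacency lists for the graph of a pair of hash functions as required, and
of a table for the function `f`. -/
structure Valid (enum : Fin n ≃ S) (L : ℕ) (f : S → BitVec k) (ω : HashSpace N m D)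
    (st : Store n N m) : Prop where
  good : GoodTrial (ω.createEnv enum) n N L st.filter.trial
  adj : AdjLists (fun i => (ω.createEnv enum).h1 st.filter.trial ((ω.createEnv enum).key i))
    (fun i => (ω.createEnv enum).h2 st.filter.trial ((ω.createEnv enum).key i)) N (2 * n)
    (arrayOf st.head) (arrayOf st.next) (arrayOf st.tgt)
  solves : Solves m (fun i => (ω.createEnv enum).h1 st.filter.trial ((ω.createEnv enum).key i))
    (fun i => (ω.createEnv enum).h2 st.filter.trial ((ω.createEnv enum).key i)) n N
    (fun i => (ω.createEnv enum).h3 ((ω.createEnv enum).key i))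
    (fun j => (f (enum (Fin.ofNat n j))).toNat) (arrayOf fun v => (st.filter.table v).toNat)

theorem createEnv_h1_lt (t i : ℕ) :
    (ω.createEnv enum).h1 t ((ω.createEnv enum).key i) < N := (ω.h1 t _).2

theorem createEnv_h2_lt (t i : ℕ) :
    (ω.createEnv enum).h2 t ((ω.createEnv enum).key i) < N := (ω.h2 t _).2

/-- Cutting the arrays to finite ranges and the table to bits loses nothing: only entries in range
are used, and the values are below `m`. -/
theorem valid_toStore {σ : State} {val : ℕ → ℕ}
    (good : GoodTrial (ω.createEnv enum) n N L σ.trial)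
    (adj : AdjLists (fun i => (ω.createEnv enum).h1 σ.trial ((ω.createEnv enum).key i))
      (fun i => (ω.createEnv enum).h2 σ.trial ((ω.createEnv enum).key i)) N (2 * n)
      (σ.arr .head) (σ.arr .next) (σ.arr .tgt))
    (solves : Solves m (fun i => (ω.createEnv enum).h1 σ.trial ((ω.createEnv enum).key i))
      (fun i => (ω.createEnv enum).h2 σ.trial ((ω.createEnv enum).key i)) n N
      (fun i => (ω.createEnv enum).h3 ((ω.createEnv enum).key i)) val (σ.arr .tab))
    (hval : ∀ j < n, (f (enum (Fin.ofNat n j))).toNat = val j) :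
    Valid enum L f ω (σ.toStore n N m) := by
  refine ⟨good, adj.congr ?_ ?_ ?_, solves.congr (fun i _ => createEnv_h1_lt _ i)
    (fun i _ => createEnv_h2_lt _ i) hval ?_⟩
  · exact fun w hw => arrayOf_of_lt hw
  · exact fun e he => arrayOf_of_lt (Nat.lt_succ_of_le he)
  · exact fun e he => arrayOf_of_lt (Nat.lt_succ_of_le he)
  · intro w hw
    rw [arrayOf_of_lt hw]
    exact toNat_ofNat_clog (solves.lt w hw)

theorem exists_creates [NeZero m] {t : ℕ}
    (ht : IsLeast {t : ℕ | 1 ≤ t ∧ GoodPair (ω.h1 t) (ω.h2 t) S L} t) :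
    ∃ st c, Creates L enum f ω st c ∧ st.filter.trial = t ∧ Valid enum L f ω st ∧
      c.steps ≤ t * (300 * (n + N) + 200) := by
  have ht' : IsLeast {t | 1 ≤ t ∧ GoodTrial (ω.createEnv enum) n N L t} t := by
    simpa only [goodTrial_iff] using ht
  obtain ⟨σ, c, h, h1, h2, h3, h4⟩ := runs_createProg (E := ω.createEnv enum)
    (σ := createState N L enum f) (NeZero.pos m) rfl createEnv_h1_lt createEnv_h2_lt ht'
  subst h1
  refine ⟨_, c, ⟨σ, h, rfl⟩, rfl, valid_toStore ht'.1.2 h2 h3 ?_, h4⟩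
  intro j hj
  refine Eq.trans ?_ (arrayOf_of_lt (x := fun j => (f (enum j)).toNat) hj).symm
  exact congrArg (fun s => (f s).toNat) (enum_ofNat ⟨j, hj⟩)

theorem Creates.det {st' : Store n N m} {c' : Cost} (h : Creates L enum f ω st c)
    (h' : Creates L enum f ω st' c') : st = st' ∧ c = c' := by
  obtain ⟨σ, h, rfl⟩ := h
  obtain ⟨σ', h', rfl⟩ := h'
  obtain ⟨rfl, rfl⟩ := h.det h'
  exact ⟨rfl, rfl⟩

/-- A halting creation guarantees that a good pair exists. The verified run for the first such pair
then coincides with the given one, by determinism. -/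
theorem Creates.isLeast [NeZero m] (h : Creates L enum f ω st c) :
    IsLeast {t : ℕ | 1 ≤ t ∧ GoodPair (ω.h1 t) (ω.h2 t) S L} st.filter.trial ∧
      Valid enum L f ω st := by
  obtain ⟨t, ht⟩ : ∃ t, IsLeast {t : ℕ | 1 ≤ t ∧ GoodPair (ω.h1 t) (ω.h2 t) S L} t := by
    obtain ⟨σ, h, _⟩ := h
    obtain ⟨t, ht⟩ := Exec.exists_goodTrial (E := ω.createEnv enum)
      (σ := createState N L enum f) rfl createEnv_h1_lt
      createEnv_h2_lt h
    exact ⟨t, by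
      have ht' : IsLeast {t | 1 ≤ t ∧ GoodTrial (ω.createEnv enum) n N L t} t := ht
      simpa only [goodTrial_iff] using ht'⟩
  obtain ⟨st', c', h', h1, h2, _⟩ := exists_creates (f := f) (enum := enum) ht
  obtain ⟨rfl, rfl⟩ := h.det h'
  rw [h1]
  exact ⟨ht, h2⟩

theorem Valid.exists_updates [NeZero m] [DecidableEq S] (h : Valid enum L f ω st) (y : S)
    (z : BitVec k) :
    ∃ st' d, Updates ω st (y : D) z st' d ∧ st'.filter.trial = st.filter.trial ∧
      Valid enum L (Function.update f y z) ω st' ∧ d.steps ≤ 170 * L + 100 := by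
  -- The update program knows `y` as its key number `0`; among the keys of the creation it has the
  -- number `enum.symm y`.
  have hy : (enum (Fin.ofNat n (enum.symm y)) : D) = y := by
    rw [enum_ofNat, Equiv.apply_symm_apply]
  obtain ⟨σ, d, hE, h1, h2, h3, h4, h5, h6⟩ := runs_updateProg (E := ω.env fun _ => (y : D))
    (σ := st.load k z.toNat) (i₀ := enum.symm y)
    (h3 := fun i => (ω.createEnv enum).h3 ((ω.createEnv enum).key i)) (NeZero.pos m) h.adj
    (fun i _ => createEnv_h1_lt _ i) (fun i _ => createEnv_h2_lt _ i) h.good.1 (enum.symm y).2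
    h.good.2 (congrArg (fun s => (ω.h1 st.filter.trial s : ℕ)) hy.symm)
    (congrArg (fun s => (ω.h2 st.filter.trial s : ℕ)) hy.symm)
    (congrArg (fun s => (ω.h3 s : ℕ)) hy.symm) h.solves
  have htr : σ.trial = st.filter.trial := h1
  refine ⟨_, d, ⟨σ, hE, rfl⟩, htr, valid_toStore
    (val := Function.update (fun j => (f (enum (Fin.ofNat n j))).toNat) (enum.symm y) z.toNat)
    ?_ ?_ ?_ ?_, h6⟩
  · rw [htr]; exact h.good
  · rw [htr, h2, h3, h4]; exact h.adj
  · rw [htr]; exact h5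
  · intro j hj
    have e := enum_ofNat (enum := enum) ⟨j, hj⟩
    simp only at e
    by_cases hjy : j = enum.symm y
    · subst hjy
      rw [Function.update_self, e]
      simp
    · rw [Function.update_of_ne hjy, Function.update_of_ne]
      intro h
      rw [e] at h
      exact hjy (congrArg Fin.val (enum.eq_symm_apply.2 h))

theorem Valid.exists_updateSeq [NeZero m] (h : Valid enum L f ω st) (us : List (S × BitVec k)) :
    ∃ st', UpdateSeq ω us st st' ∧ st'.filter.trial = st.filter.trial ∧
      Valid enum L (changed f us) ω st' := by
  classical
  induction us generalizing st f with
  | nil => exact ⟨st, .nil st, rfl, h⟩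
  | cons u us ih =>
    obtain ⟨st₁, d, h1, h2, h3, _⟩ := h.exists_updates u.1 u.2
    obtain ⟨st₂, h4, h5, h6⟩ := ih h3
    refine ⟨st₂, .cons h1 h4, h5.trans h2, ?_⟩
    convert h6 using 1
    rw [changed, changed, List.foldl_cons]

theorem Valid.answer_eq (h : Valid enum L f ω st) (s : S) :
    answer ω st.filter (s : D) = ((f s).toNat : ZMod m) := by
  have h1 := h.solves.eq _ (enum.symm s).2
  have hs : enum (Fin.ofNat n (enum.symm s)) = s := by
    rw [enum_ofNat, Equiv.apply_symm_apply]
  have h2 : (ω.createEnv enum).h1 st.filter.trial ((ω.createEnv enum).key (enum.symm s)) =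
      (ω.h1 st.filter.trial s : ℕ) := congrArg (fun s : S => (ω.h1 st.filter.trial s : ℕ)) hs
  have h3 : (ω.createEnv enum).h2 st.filter.trial ((ω.createEnv enum).key (enum.symm s)) =
      (ω.h2 st.filter.trial s : ℕ) := congrArg (fun s : S => (ω.h2 st.filter.trial s : ℕ)) hs
  have h4 : (ω.createEnv enum).h3 ((ω.createEnv enum).key (enum.symm s)) = (ω.h3 s : ℕ) :=
    congrArg (fun s : S => (ω.h3 s : ℕ)) hs
  simp only [h2, h3, h4, hs] at h1
  rw [arrayOf_of_lt (ω.h1 st.filter.trial s).2, arrayOf_of_lt (ω.h2 st.filter.trial s).2] at h1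
  exact h1

theorem Valid.queries [NeZero m] (hk : 2 ^ k ≤ m) (h : Valid enum L f ω st) (s : S) :
    ∃ c, Queries k ω st.filter (s : D) (some (f s)) c := by
  obtain ⟨c, hq, _⟩ := exists_queries (k := k) ω st.filter (s : D)
  refine ⟨c, ?_⟩
  have hlt : (f s).toNat < 2 ^ k := (f s).isLt
  rw [h.answer_eq, ZMod.val_natCast_of_lt (hlt.trans_le hk), if_pos hlt, BitVec.ofNat_toNat,
    BitVec.setWidth_eq] at hq
  exact hq

end

/-! ## Random forests -/

section RandomForest

open scoped Classical in
/-- Averaging over the value at one argument. -/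
theorem sum_apply_eq_sum_sum {ι X : Type*} [Fintype ι] [Fintype X] (i : ι)
    (g : (ι → X) → X → ℝ) (hg : ∀ h x y, g (Function.update h i y) x = g h x) :
    Fintype.card X * ∑ h, g h (h i) = ∑ h, ∑ x, g h x := by
  -- Exchanging `h i` with the extra value `x` is an involution, and `g` does not see the change in
  -- its first argument.
  have e : ∑ p : (ι → X) × X, g p.1 p.2 = ∑ p : (ι → X) × X, g p.1 (p.1 i) := by
    refine Finset.sum_nbij' (fun p => (Function.update p.1 i p.2, p.1 i))
      (fun p => (Function.update p.1 i p.2, p.1 i)) ?_ ?_ ?_ ?_ ?_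
    · simp
    · simp
    · rintro ⟨h, x⟩ _; simp
    · rintro ⟨h, x⟩ _; simp
    · rintro ⟨h, x⟩ _; simp [hg]
  rw [← Fintype.sum_prod_type' g, e, Fintype.sum_prod_type]
  simp [Finset.mul_sum]

variable {ι V : Type*}

/-- The relation `Link` for a function that gives the ends of the edges. -/
def PLink (h : ι → V × V) (J : Finset ι) (u v : V) : Prop :=
  Link (fun i => (h i).1) (fun i => (h i).2) (J : Set ι) u v

/-- The property `Forest` for a function that gives the ends of the edges. -/
def PForest (h : ι → V × V) (J : Finset ι) : Prop :=
  Forest (fun i => (h i).1) (fun i => (h i).2) (J : Set ι)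

theorem Link.congr_of_eqOn {a b a' b' : ι → V} {J : Set ι} {u v : V} (ha : ∀ i ∈ J, a i = a' i)
    (hb : ∀ i ∈ J, b i = b' i) (h : Link a b J u v) : Link a' b' J u v := by
  refine Relation.ReflTransGen.mono (fun x y ⟨i, hi, k⟩ => ⟨i, hi, ?_⟩) _ _ h
  rwa [Joins, ← ha i hi, ← hb i hi]

theorem PLink.congr {h h' : ι → V × V} {J : Finset ι} (e : ∀ i ∈ J, h i = h' i) (u v : V) :
    PLink h J u v ↔ PLink h' J u v :=
  ⟨Link.congr_of_eqOn (fun i hi => by rw [e i hi]) (fun i hi => by rw [e i hi]),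
    Link.congr_of_eqOn (fun i hi => by rw [e i hi]) (fun i hi => by rw [e i hi])⟩

theorem PForest.congr {h h' : ι → V × V} {J : Finset ι} (e : ∀ i ∈ J, h i = h' i) :
    PForest h J ↔ PForest h' J := by
  refine forall₂_congr fun i hi => not_congr ?_
  have hi' : i ∈ J := hi
  simp only [e i hi']
  exact ⟨Link.congr_of_eqOn (fun j hj => by rw [e j hj.1]) (fun j hj => by rw [e j hj.1]),
    Link.congr_of_eqOn (fun j hj => by rw [e j hj.1]) (fun j hj => by rw [e j hj.1])⟩

open scoped Classical in
theorem update_eqOn (h : ι → V × V) {J : Finset ι} {i : ι} (hi : i ∉ J) (y : V × V) :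
    ∀ j ∈ J, Function.update h i y j = h j := fun j hj =>
  Function.update_of_ne (fun e : j = i => hi (e ▸ hj)) y h

variable [Fintype V]

open scoped Classical in
/-- The component of `v`. -/
noncomputable def comp (h : ι → V × V) (J : Finset ι) (v : V) : Finset V :=
  Finset.univ.filter fun w => PLink h J v w

theorem mem_comp {h : ι → V × V} {J : Finset ι} {v w : V} : w ∈ comp h J v ↔ PLink h J v w := by
  simp [comp]

theorem comp_congr {h h' : ι → V × V} {J : Finset ι} (e : ∀ i ∈ J, h i = h' i) :
    comp h J = comp h' J := by
  ext v w; rw [mem_comp, mem_comp, PLink.congr e]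

/-- The number of linked pairs of vertices. -/
noncomputable def linkedPairs (h : ι → V × V) (J : Finset ι) : ℝ := ∑ v, ((comp h J v).card : ℝ)

open scoped Classical in
-- The pairs `(v, v)` contribute the number of vertices. For different ends, some path does not
-- reuse its first edge `i`, so that the end of the path is in the component of the other end of `i`
-- without `i`.
theorem linkedPairs_le (h : ι → V × V) (J : Finset ι) :
    linkedPairs h J ≤ Fintype.card V + ∑ i ∈ J,
      (((comp h (J.erase i) (h i).1).card : ℝ) + (comp h (J.erase i) (h i).2).card) := by
  have key : (Finset.univ.filter fun p : V × V => PLink h J p.1 p.2) ⊆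
      Finset.univ.image (fun v : V => (v, v)) ∪ J.biUnion fun i =>
        (comp h (J.erase i) (h i).1).image (fun w => ((h i).2, w)) ∪
          (comp h (J.erase i) (h i).2).image (fun w => ((h i).1, w)) := by
    rintro ⟨u, v⟩ huv
    have huv : PLink h J u v := by simpa using huv
    by_cases e : u = v
    · subst e; simp
    · obtain ⟨i, hi, w, hw, hl⟩ := Link.exists_first J huv e
      refine Finset.mem_union_right _ (Finset.mem_biUnion.2 ⟨i, hi, ?_⟩)
      rcases hw with ⟨rfl, rfl⟩ | ⟨rfl, rfl⟩
      · exact Finset.mem_union_right _ (Finset.mem_image.2 ⟨v, mem_comp.2 hl, rfl⟩)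
      · exact Finset.mem_union_left _ (Finset.mem_image.2 ⟨v, mem_comp.2 hl, rfl⟩)
  have e : linkedPairs h J =
      ((Finset.univ.filter fun p : V × V => PLink h J p.1 p.2).card : ℝ) := by
    rw [Finset.card_filter, Fintype.sum_prod_type, linkedPairs]
    push_cast
    refine Finset.sum_congr rfl fun v _ => ?_
    rw [comp, Finset.card_filter]; push_cast; rfl
  rw [e]
  have := (Finset.card_le_card key).trans ((Finset.card_union_le _ _).trans (add_le_add
    Finset.card_image_le (Finset.card_biUnion_le.trans (Finset.sum_le_sum fun i _ =>
      (Finset.card_union_le _ _).trans (add_le_add Finset.card_image_le Finset.card_image_le)))))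
  exact_mod_cast this

variable [Fintype ι]

open scoped Classical in
/-- The number of functions that give a forest. -/
noncomputable def forestCount (V : Type*) [Fintype V] (J : Finset ι) : ℝ :=
  ∑ h : ι → V × V, if PForest h J then 1 else 0

open scoped Classical in
/-- The sum of the number of linked pairs over all forests. -/
noncomputable def forestLinks (V : Type*) [Fintype V] (J : Finset ι) : ℝ :=
  ∑ h : ι → V × V, if PForest h J then linkedPairs h J else 0

open scoped Classical in
-- The ends of the new edge are uniform and do not influence the edges in `J`; the linked pairs are
-- exactly the forbidden choices.
theorem forestCount_insert {J : Finset ι} {i : ι} (hi : i ∉ J) :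
    (Fintype.card V : ℝ) ^ 2 * forestCount V (insert i J) =
      (Fintype.card V : ℝ) ^ 2 * forestCount V J - forestLinks V J := by
  have h1 : forestCount V (insert i J) = ∑ h : ι → V × V,
      (fun (h : ι → V × V) (x : V × V) =>
        if PForest h J then (if PLink h J x.1 x.2 then (0 : ℝ) else 1) else 0) h (h i) := by
    refine Finset.sum_congr rfl fun h _ => ?_
    have : PForest h (insert i J) ↔ PForest h J ∧ ¬ PLink h J (h i).1 (h i).2 := by
      rw [PForest, Finset.coe_insert]
      exact Forest.insert_iff (by simpa using hi)
    by_cases hF : PForest h J <;> by_cases hL : PLink h J (h i).1 (h i).2 <;> simp [this, hF, hL]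
  have h2 := sum_apply_eq_sum_sum i (fun (h : ι → V × V) (x : V × V) =>
        if PForest h J then (if PLink h J x.1 x.2 then (0 : ℝ) else 1) else 0) (by
    intro h x y
    simp only [PForest.congr (update_eqOn h hi y), PLink.congr (update_eqOn h hi y)])
  rw [Fintype.card_prod, Nat.cast_mul, ← sq, ← h1] at h2
  rw [h2, forestCount, forestLinks, Finset.mul_sum, ← Finset.sum_sub_distrib]
  refine Finset.sum_congr rfl fun h _ => ?_
  by_cases hF : PForest h J
  · simp only [hF, if_true]
    have : ∀ x : V × V, (if PLink h J x.1 x.2 then (0 : ℝ) else 1) =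
        1 - if PLink h J x.1 x.2 then (1 : ℝ) else 0 := by
      intro x; split_ifs <;> simp
    simp only [this, Finset.sum_sub_distrib, Fintype.sum_prod_type]
    congr 1
    · simp; ring
    · rw [linkedPairs]
      refine Finset.sum_congr rfl fun v _ => ?_
      rw [comp, Finset.card_filter]; push_cast; rfl
  · simp [hF]

open scoped Classical in
-- Sum `linkedPairs_le` over forests, weakening the condition on `J` to one on `J.erase i`. Then the
-- ends of `i` are free, and each averages the component size to `linkedPairs / N`.
theorem forestLinks_le (J : Finset ι) (hV : 0 < Fintype.card V) :
    forestLinks V J ≤ Fintype.card V * forestCount V J +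
      2 / Fintype.card V * ∑ i ∈ J, forestLinks V (J.erase i) := by
  set N := (Fintype.card V : ℝ) with hN
  have hN0 : 0 < N := by rw [hN]; exact_mod_cast hV
  have step : ∀ i ∈ J, ∑ h : ι → V × V, (if PForest h (J.erase i) then
      (((comp h (J.erase i) (h i).1).card : ℝ) + (comp h (J.erase i) (h i).2).card) else 0) =
      2 / N * forestLinks V (J.erase i) := by
    intro i _
    have hi : i ∉ J.erase i := Finset.notMem_erase i J
    have h2 := sum_apply_eq_sum_sum i (fun (h : ι → V × V) (x : V × V) =>
        if PForest h (J.erase i) then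
          (((comp h (J.erase i) x.1).card : ℝ) + (comp h (J.erase i) x.2).card) else 0) (by
      intro h x y
      simp only [PForest.congr (update_eqOn h hi y), comp_congr (update_eqOn h hi y)])
    rw [Fintype.card_prod, Nat.cast_mul, ← hN] at h2
    have h3 : ∑ h : ι → V × V, ∑ x : V × V, (if PForest h (J.erase i) then
        (((comp h (J.erase i) x.1).card : ℝ) + (comp h (J.erase i) x.2).card) else 0) =
        2 * N * forestLinks V (J.erase i) := by
      rw [forestLinks, Finset.mul_sum]
      refine Finset.sum_congr rfl fun h _ => ?_
      by_cases hF : PForest h (J.erase i)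
      · simp only [hF, if_true, Fintype.sum_prod_type, Finset.sum_add_distrib, linkedPairs]
        simp only [Finset.sum_const, Finset.card_univ, nsmul_eq_mul, ← hN, ← Finset.mul_sum]
        ring
      · simp [hF]
    rw [h3] at h2
    have : N * N ≠ 0 := by positivity
    apply mul_left_cancel₀ this
    rw [h2]
    field_simp
  calc forestLinks V J ≤ ∑ h : ι → V × V, (N * (if PForest h J then 1 else 0) +
        ∑ i ∈ J, if PForest h (J.erase i) then
          (((comp h (J.erase i) (h i).1).card : ℝ) + (comp h (J.erase i) (h i).2).card) else 0) := by
        refine Finset.sum_le_sum fun h _ => ?_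
        by_cases hF : PForest h J
        · have hF' : ∀ i ∈ J, PForest h (J.erase i) := fun i _ =>
            Forest.mono (by simp) hF
          simp only [hF, if_true, mul_one]
          rw [Finset.sum_congr rfl fun i hi => if_pos (hF' i hi)]
          exact linkedPairs_le h J
        · simp only [hF, if_false, mul_zero, zero_add]
          refine Finset.sum_nonneg fun i _ => ?_
          split_ifs <;> positivity
    _ = _ := by
        rw [Finset.sum_add_distrib, Finset.sum_comm, Finset.sum_congr rfl step, forestCount,
          Finset.mul_sum, Finset.mul_sum]

theorem forestCount_nonneg (J : Finset ι) : 0 ≤ forestCount V J :=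
  Finset.sum_nonneg fun h _ => by split_ifs <;> norm_num

theorem forestCount_empty : forestCount V (∅ : Finset ι) =
    ((Fintype.card V : ℝ) ^ 2) ^ Fintype.card ι := by
  classical
  have : ∀ h : ι → V × V, PForest h ∅ := fun h i hi => by simp at hi
  simp [forestCount, this, sq, Finset.card_univ]

/-- The sum of the numbers of linked pairs in forests is at most `B * N` times the number of forests,
if the average degree is at most `ρ < 1`. -/
theorem forestLinks_le_mul {ρ B : ℝ} (hρ : 0 < ρ) (hB : B * (1 - ρ) = 2)
    (hn : 2 * (Fintype.card ι : ℝ) ≤ ρ * Fintype.card V) (hV : 0 < Fintype.card V) (hρ1 : ρ < 1)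
    (hBN : B / Fintype.card V ≤ (1 - ρ) / (1 + ρ)) (J : Finset ι) :
    forestLinks V J ≤ B * Fintype.card V * forestCount V J := by
  classical
  set N := (Fintype.card V : ℝ) with hN
  have hN0 : 0 < N := by rw [hN]; exact_mod_cast hV
  have hB0 : 0 < B := by
    by_contra hc
    push Not at hc
    nlinarith
  -- For large `N` an edge keeps at least the fraction `2ρ / (1 + ρ)` of the forests. This worsens
  -- the factor `ρ` in the recursion to `(1 + ρ) / 2`, which is still below `1`.
  have hfac : 2 * ρ / (1 + ρ) ≤ 1 - B / N := by
    have : (1 - ρ) / (1 + ρ) + 2 * ρ / (1 + ρ) = 1 := by field_simp; ring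
    linarith
  induction hk : J.card generalizing J with
  | zero =>
    rw [Finset.card_eq_zero] at hk
    subst hk
    have := forestLinks_le (ι := ι) (V := V) ∅ hV
    simp only [Finset.sum_empty, mul_zero, add_zero, ← hN] at this
    refine this.trans (mul_le_mul_of_nonneg_right ?_ (forestCount_nonneg _))
    have : 1 ≤ B := by nlinarith
    nlinarith
  | succ k ih =>
    have h1 := forestLinks_le (V := V) J hV
    rw [← hN] at h1
    have h2 : ∀ i ∈ J, forestLinks V (J.erase i) ≤
        B * N * ((1 + ρ) / (2 * ρ)) * forestCount V J := by
      intro i hi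
      have h3 := ih (J.erase i) (by rw [Finset.card_erase_of_mem hi]; omega)
      have h4 := forestCount_insert (V := V) (Finset.notMem_erase i J)
      rw [Finset.insert_erase hi, ← hN] at h4
      have h5 : (1 - B / N) * forestCount V (J.erase i) ≤ forestCount V J := by
        have : N ^ 2 * ((1 - B / N) * forestCount V (J.erase i)) ≤ N ^ 2 * forestCount V J := by
          have e : N ^ 2 * ((1 - B / N) * forestCount V (J.erase i)) =
              N ^ 2 * forestCount V (J.erase i) - B * N * forestCount V (J.erase i) := by
            field_simp
          linarith
        exact le_of_mul_le_mul_left this (by positivity)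
      have h6 : 2 * ρ / (1 + ρ) * forestCount V (J.erase i) ≤ forestCount V J :=
        (mul_le_mul_of_nonneg_right hfac (forestCount_nonneg _)).trans h5
      have h7 : forestCount V (J.erase i) ≤ (1 + ρ) / (2 * ρ) * forestCount V J := by
        rw [div_mul_eq_mul_div, le_div_iff₀ (by positivity)]
        rw [div_mul_eq_mul_div, div_le_iff₀ (by positivity)] at h6
        linarith
      calc _ ≤ B * N * forestCount V (J.erase i) := h3
        _ ≤ B * N * ((1 + ρ) / (2 * ρ) * forestCount V J) := by gcongr
        _ = _ := by ring
    have h8 : ∑ i ∈ J, forestLinks V (J.erase i) ≤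
        ρ * N / 2 * (B * N * ((1 + ρ) / (2 * ρ)) * forestCount V J) := by
      refine (Finset.sum_le_card_nsmul J _ _ h2).trans ?_
      rw [nsmul_eq_mul]
      have hJ : (J.card : ℝ) ≤ Fintype.card ι := by exact_mod_cast Finset.card_le_univ J
      have := forestCount_nonneg (V := V) J
      gcongr
      linarith
    calc forestLinks V J ≤ N * forestCount V J + 2 / N *
          (ρ * N / 2 * (B * N * ((1 + ρ) / (2 * ρ)) * forestCount V J)) := by
          refine h1.trans ?_; gcongr
      _ = (1 + B * (1 + ρ) / 2) * N * forestCount V J := by field_simp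
      _ = B * N * forestCount V J := by
          -- `B` is the fixed point of the recursion; this is the meaning of `B * (1 - ρ) = 2`.
          have : 1 + B * (1 + ρ) / 2 = B := by linarith
          rw [this]

/-- By the bound for linked pairs, a random new edge closes a cycle with probability at most `B /
N`, given that there is a forest so far. -/
theorem forestCount_ge {ρ B : ℝ} (hρ : 0 < ρ) (hB : B * (1 - ρ) = 2)
    (hn : 2 * (Fintype.card ι : ℝ) ≤ ρ * Fintype.card V) (hV : 0 < Fintype.card V) (hρ1 : ρ < 1)
    (hBN : B / Fintype.card V ≤ (1 - ρ) / (1 + ρ)) (J : Finset ι) :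
    (1 - B / Fintype.card V) ^ J.card * ((Fintype.card V : ℝ) ^ 2) ^ Fintype.card ι ≤
      forestCount V J := by
  classical
  set N := (Fintype.card V : ℝ) with hN
  have hN0 : 0 < N := by rw [hN]; exact_mod_cast hV
  have hp : 0 ≤ 1 - B / N := by
    have : (1 - ρ) / (1 + ρ) ≤ 1 := by rw [div_le_one (by linarith)]; linarith
    linarith
  induction J using Finset.induction_on with
  | empty => rw [forestCount_empty, hN]; simp
  | insert i J hi ih =>
    rw [Finset.card_insert_of_notMem hi, pow_succ', mul_assoc]
    refine (mul_le_mul_of_nonneg_left ih hp).trans ?_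
    have h1 := forestCount_insert (V := V) hi
    have h2 := forestLinks_le_mul (V := V) hρ hB hn hV hρ1 hBN J
    rw [← hN] at h1 h2
    have : N ^ 2 * ((1 - B / N) * forestCount V J) ≤ N ^ 2 * forestCount V (insert i J) := by
      have e : N ^ 2 * ((1 - B / N) * forestCount V J) =
          N ^ 2 * forestCount V J - B * N * forestCount V J := by
        field_simp
      linarith
    exact le_of_mul_le_mul_left this (by positivity)

end RandomForest

/-! ## Large components -/

section LargeComponents

open scoped Classical

variable {ι V : Type*} [Fintype ι] [Fintype V]

/-- The vertices that are linked to an element of `U`. -/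
noncomputable def cover (h : ι → V × V) (J : Finset ι) (U : Finset V) : Finset V :=
  U.biUnion (comp h J)

omit [Fintype ι] in
theorem mem_cover {h : ι → V × V} {J : Finset ι} {U : Finset V} {w : V} :
    w ∈ cover h J U ↔ ∃ u ∈ U, PLink h J u w := by
  simp [cover, mem_comp]

/-- The functions that agree with `h₀` outside `J`, and have values in `E` on `J`. -/
noncomputable def variants (h₀ : ι → V × V) (J : Finset ι) (E : Finset (V × V)) :
    Finset (ι → V × V) :=
  Fintype.piFinset fun i => if i ∈ J then E else {h₀ i}

omit [Fintype V] in
theorem mem_variants {h₀ h : ι → V × V} {J : Finset ι} {E : Finset (V × V)} :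
    h ∈ variants h₀ J E ↔ ∀ i, (i ∈ J → h i ∈ E) ∧ (i ∉ J → h i = h₀ i) := by
  rw [variants, Fintype.mem_piFinset]
  refine forall_congr' fun i => ?_
  by_cases hi : i ∈ J <;> simp [hi]

omit [Fintype V] in
theorem card_variants (h₀ : ι → V × V) (J : Finset ι) (E : Finset (V × V)) :
    (variants h₀ J E).card = E.card ^ J.card := by
  rw [variants, Fintype.card_piFinset]
  have : ∀ i, (if i ∈ J then E else {h₀ i}).card = if i ∈ J then E.card else 1 := by
    intro i; split_ifs <;> simp
  simp only [this, Finset.prod_ite_mem, Finset.univ_inter, Finset.prod_const]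

/-- The end of an edge that is different from the given one. -/
noncomputable def otherEnd (u : V) (p : V × V) : V := if p.1 = u then p.2 else p.1

/-- The neighbours of the vertex `u` through the edges with numbers in `I`. -/
noncomputable def neighbours (h : ι → V × V) (I : Finset ι) (u : V) : Finset V :=
  I.image fun i => otherEnd u (h i)

omit [Fintype ι] in
-- The hypotheses make `I` the set of edges at `u`. A path from `U` that ends outside `u` can be
-- started anew after its last visit to `u`, at a neighbour of `u`.
theorem cover_subset (h : ι → V × V) (J I : Finset ι) (U : Finset V) (u : V)
    (hI : ∀ i ∈ J, i ∉ I → (h i).1 ≠ u ∧ (h i).2 ≠ u)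
    (hI' : ∀ i ∈ I, (h i).1 = u ∨ (h i).2 = u) :
    cover h J U ⊆ insert u (cover h (J \ I) ((U ∪ neighbours h I u).erase u)) := by
  intro w hw
  obtain ⟨x, hx, hxw⟩ := mem_cover.1 hw
  rw [Finset.mem_insert]
  induction hxw with
  | refl =>
    by_cases hxu : x = u
    · exact Or.inl hxu
    · exact Or.inr (mem_cover.2 ⟨x, by simp [hx, hxu], Link.refl _⟩)
  | @tail y z hxy hyz ih =>
    obtain ⟨i, hi, hj⟩ := hyz
    have hiJ : i ∈ J := hi
    by_cases hz : z = u
    · exact Or.inl hz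
    right
    have ih := ih (mem_cover.2 ⟨x, hx, hxy⟩)
    by_cases hiI : i ∈ I
    · by_cases hy : y = u
      · refine mem_cover.2 ⟨z, ?_, Link.refl _⟩
        refine Finset.mem_erase.2 ⟨hz, Finset.mem_union_right _
          (Finset.mem_image.2 ⟨i, hiI, ?_⟩)⟩
        rcases hj with ⟨h1, h2⟩ | ⟨h1, h2⟩
        · rw [otherEnd, if_pos (h1.symm.trans hy)]
          exact h2.symm
        · rw [otherEnd]
          split_ifs with hc
          · exact absurd (h2.trans hc) hz
          · exact h2.symm
      · exfalso
        rcases hj with ⟨h1, h2⟩ | ⟨h1, h2⟩ <;> rcases hI' i hiI with h3 | h3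
        · exact hy (h1.trans h3)
        · exact hz (h2.trans h3)
        · exact hz (h2.trans h3)
        · exact hy (h1.trans h3)
    · have hne := hI i hiJ hiI
      have hy : y ≠ u := by
        rcases hj with ⟨h1, _⟩ | ⟨h1, _⟩
        · rw [h1]; exact hne.1
        · rw [h1]; exact hne.2
      obtain ⟨x', hx', hl⟩ := mem_cover.1 (ih.resolve_left hy)
      exact mem_cover.2 ⟨x', hx', hl.tail ⟨i, by simp [hiJ, hiI], hj⟩⟩

/-- The power is the generating function of the number of edges at a given vertex, as `M ^ 2 - (M -
1) ^ 2` pairs contain it. With `1 + x ≤ exp x` it is at most that of a Poisson variable of mean `ρ`.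
-/
theorem step_bound {ρ y z M : ℝ} {j : ℕ} (hy : 1 ≤ y) (hz : 0 < z)
    (hyz : z * Real.exp (ρ * (y - 1)) ≤ y) (hM : 1 ≤ M) (hj : 2 * (j : ℝ) ≤ ρ * M) :
    z * ((M ^ 2 - (M - 1) ^ 2) * y + (M - 1) ^ 2) ^ j ≤ y * (M ^ 2) ^ j := by
  have h1 : (M ^ 2 - (M - 1) ^ 2) * y + (M - 1) ^ 2 ≤ M ^ 2 * Real.exp (2 * (y - 1) / M) := by
    have h2 := Real.add_one_le_exp (2 * (y - 1) / M)
    have h3 : M ^ 2 * (2 * (y - 1) / M + 1) = 2 * (y - 1) * M + M ^ 2 := by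
      field_simp
    nlinarith [mul_le_mul_of_nonneg_left h2 (sq_nonneg M)]
  have h0 : 0 ≤ (M ^ 2 - (M - 1) ^ 2) * y + (M - 1) ^ 2 := by
    nlinarith [sq_nonneg (M - 1), mul_nonneg (by linarith : (0 : ℝ) ≤ 2 * M - 1)
      (by linarith : (0 : ℝ) ≤ y)]
  calc z * ((M ^ 2 - (M - 1) ^ 2) * y + (M - 1) ^ 2) ^ j
      ≤ z * (M ^ 2 * Real.exp (2 * (y - 1) / M)) ^ j := by gcongr
    _ = z * Real.exp (j * (2 * (y - 1) / M)) * (M ^ 2) ^ j := by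
        rw [mul_pow, ← Real.exp_nat_mul]; ring
    _ ≤ z * Real.exp (ρ * (y - 1)) * (M ^ 2) ^ j := by
        refine mul_le_mul_of_nonneg_right (mul_le_mul_of_nonneg_left (Real.exp_le_exp.2 ?_) hz.le)
          (by positivity)
        rw [mul_div_assoc', div_le_iff₀ (by linarith)]
        nlinarith [mul_le_mul_of_nonneg_right hj (by linarith : (0 : ℝ) ≤ y - 1)]
    _ ≤ _ := by gcongr

omit [Fintype ι] [Fintype V] in
theorem card_neighbours_union_le (h : ι → V × V) (I : Finset ι) {U : Finset V} {u : V}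
    (hu : u ∈ U) : ((U ∪ neighbours h I u).erase u).card ≤ U.card - 1 + I.card := by
  rw [Finset.erase_union_distrib]
  refine (Finset.card_union_le _ _).trans (add_le_add (Finset.card_erase_of_mem hu).le ?_)
  exact (Finset.card_le_card (Finset.erase_subset _ _)).trans Finset.card_image_le

omit [Fintype V] in
/-- The step in the exploration of components: the edges at the vertex `u` are uncovered. -/
theorem filter_cover_subset [Fintype V] (h₀ : ι → V × V) (J : Finset ι) (W U : Finset V) (u : V)
    (t : ℕ) :
    (variants h₀ J (W ×ˢ W)).filter (fun h => t + 1 ≤ (cover h J U).card) ⊆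
      J.powerset.biUnion fun I =>
        (variants h₀ I ((W ×ˢ W).filter fun p => p.1 = u ∨ p.2 = u)).biUnion fun h₁ =>
          (variants h₁ (J \ I) (W.erase u ×ˢ W.erase u)).filter fun h =>
            t ≤ (cover h (J \ I) ((U ∪ neighbours h₁ I u).erase u)).card := by
  intro h hh
  rw [Finset.mem_filter, mem_variants] at hh
  obtain ⟨h1, h2⟩ := hh
  -- The edges at `u` are revealed: `h₁` records their ends, and the other edges of `J` are still
  -- free on the vertices without `u`.
  set I := J.filter fun i => (h i).1 = u ∨ (h i).2 = u with hIdef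
  have hIJ : ∀ i ∈ I, i ∈ J := fun i hi => (Finset.mem_filter.1 hi).1
  have hIu : ∀ i ∈ I, (h i).1 = u ∨ (h i).2 = u := fun i hi => (Finset.mem_filter.1 hi).2
  have hnI : ∀ i ∈ J, i ∉ I → (h i).1 ≠ u ∧ (h i).2 ≠ u := by
    intro i hi hiI
    rw [← not_or]
    exact fun hc => hiI (Finset.mem_filter.2 ⟨hi, hc⟩)
  have hnb : neighbours (fun i => if i ∈ I then h i else h₀ i) I u = neighbours h I u :=
    Finset.image_congr fun i hi => by
      have hi : i ∈ I := hi
      simp [hi]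
  refine Finset.mem_biUnion.2 ⟨I, Finset.mem_powerset.2 (Finset.filter_subset _ _),
    Finset.mem_biUnion.2 ⟨fun i => if i ∈ I then h i else h₀ i, mem_variants.2 fun i => ?_,
      Finset.mem_filter.2 ⟨mem_variants.2 fun i => ?_, ?_⟩⟩⟩
  · refine ⟨fun hi => ?_, fun hi => by simp [hi]⟩
    simp only [hi, if_true]
    exact Finset.mem_filter.2 ⟨(h1 i).1 (hIJ i hi), hIu i hi⟩
  · refine ⟨fun hi => ?_, fun hi => ?_⟩
    · rw [Finset.mem_sdiff] at hi
      have h3 := Finset.mem_product.1 ((h1 i).1 hi.1)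
      have h4 := hnI i hi.1 hi.2
      exact Finset.mem_product.2 ⟨Finset.mem_erase.2 ⟨h4.1, h3.1⟩, Finset.mem_erase.2 ⟨h4.2, h3.2⟩⟩
    · by_cases hiI : i ∈ I
      · simp [hiI]
      · have hiJ : i ∉ J := fun hc => hi (Finset.mem_sdiff.2 ⟨hc, hiI⟩)
        simp only [hiI, if_false]
        exact (h1 i).2 hiJ
  · rw [hnb]
    have h3 := Finset.card_le_card (cover_subset h J I U u hnI hIu)
    have h4 := Finset.card_insert_le u (cover h (J \ I) ((U ∪ neighbours h I u).erase u))
    omega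

omit [Fintype ι] [Fintype V] in
theorem card_edges_at (W : Finset V) {u : V} (hu : u ∈ W) :
    ((((W ×ˢ W).filter fun p => p.1 = u ∨ p.2 = u).card : ℕ) : ℝ) =
      (W.card : ℝ) ^ 2 - ((W.card : ℝ) - 1) ^ 2 := by
  have h1 := Finset.card_filter_add_card_filter_not (s := W ×ˢ W) (fun p => p.1 = u ∨ p.2 = u)
  have h2 : (W ×ˢ W).filter (fun p => ¬ (p.1 = u ∨ p.2 = u)) = W.erase u ×ˢ W.erase u := by
    ext ⟨a, b⟩
    simp only [Finset.mem_filter, Finset.mem_product, Finset.mem_erase, not_or]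
    tauto
  rw [h2, Finset.card_product, Finset.card_product] at h1
  have h3 : ((W.erase u).card : ℝ) = W.card - 1 := by
    rw [Finset.card_erase_of_mem hu, Nat.cast_sub (Finset.card_pos.2 ⟨u, hu⟩)]; simp
  have h4 := congrArg (Nat.cast : ℕ → ℝ) h1
  push_cast at h4
  rw [h3] at h4
  linarith

/-- Among the functions with values in `W × W` on `J`, a fraction of at most `y ^ |U| / z ^ t` has
at least `t` vertices linked to `U`. -/
theorem card_filter_cover_le {ρ y z : ℝ} (hρ : 0 ≤ ρ) (hy : 1 ≤ y) (hz : 0 < z)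
    (hyz : z * Real.exp (ρ * (y - 1)) ≤ y) (t : ℕ) (h₀ : ι → V × V) (J : Finset ι)
    (W U : Finset V) (hW : U ⊆ W) (hJ : 2 * (J.card : ℝ) ≤ ρ * (W.card - t)) :
    (((variants h₀ J (W ×ˢ W)).filter fun h => t ≤ (cover h J U).card).card : ℝ) * z ^ t ≤
      y ^ U.card * ((W.card : ℝ) ^ 2) ^ J.card := by
  induction t generalizing h₀ J W U with
  | zero =>
    have h1 := Finset.card_filter_le (variants h₀ J (W ×ˢ W)) fun h => 0 ≤ (cover h J U).card
    rw [card_variants, Finset.card_product, ← sq] at h1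
    have h2 : (((variants h₀ J (W ×ˢ W)).filter fun h => 0 ≤ (cover h J U).card).card : ℝ) ≤
        ((W.card : ℝ) ^ 2) ^ J.card := by exact_mod_cast h1
    rw [pow_zero, mul_one]
    exact h2.trans (le_mul_of_one_le_left (by positivity) (one_le_pow₀ hy))
  | succ t ih =>
    rcases U.eq_empty_or_nonempty with rfl | ⟨u, hu⟩
    · have : ∀ h : ι → V × V, cover h J ∅ = ∅ := fun h => rfl
      simp only [this, Finset.card_empty, Nat.le_zero, Nat.succ_ne_zero, Finset.filter_false,
        Nat.cast_zero, zero_mul]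
      positivity
    have huW := hW hu
    have hM1 : 1 ≤ W.card := Finset.card_pos.2 ⟨u, huW⟩
    have hM : (1 : ℝ) ≤ W.card := by exact_mod_cast hM1
    set M : ℝ := (W.card : ℝ) with hMdef
    have hWe : ((W.erase u).card : ℝ) = M - 1 := by
      rw [Finset.card_erase_of_mem huW, Nat.cast_sub hM1, hMdef]; simp
    have h1 : ((((variants h₀ J (W ×ˢ W)).filter
        fun h => t + 1 ≤ (cover h J U).card).card : ℕ) : ℝ) ≤
        ∑ I ∈ J.powerset, ∑ h₁ ∈ variants h₀ I ((W ×ˢ W).filter fun p => p.1 = u ∨ p.2 = u),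
          (((variants h₁ (J \ I) (W.erase u ×ˢ W.erase u)).filter fun h =>
            t ≤ (cover h (J \ I) ((U ∪ neighbours h₁ I u).erase u)).card).card : ℝ) := by
      have := (Finset.card_le_card (filter_cover_subset h₀ J W U u t)).trans
        (Finset.card_biUnion_le.trans (Finset.sum_le_sum fun I _ => Finset.card_biUnion_le))
      exact_mod_cast this
    -- Removing `u` costs one vertex, and each edge at `u` activates at most one new vertex, at the
    -- price of a factor `y`.
    have h2 : ∀ I ∈ J.powerset, ∀ h₁ ∈ variants h₀ I ((W ×ˢ W).filter
        fun p => p.1 = u ∨ p.2 = u),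
        (((variants h₁ (J \ I) (W.erase u ×ˢ W.erase u)).filter fun h =>
            t ≤ (cover h (J \ I) ((U ∪ neighbours h₁ I u).erase u)).card).card : ℝ) * z ^ t ≤
        y ^ (U.card - 1 + I.card) * ((M - 1) ^ 2) ^ (J.card - I.card) := by
      intro I hI h₁ hh₁
      rw [Finset.mem_powerset] at hI
      have hsub : (U ∪ neighbours h₁ I u).erase u ⊆ W.erase u := by
        refine Finset.erase_subset_erase _ (Finset.union_subset hW ?_)
        intro x hx
        obtain ⟨i, hi, rfl⟩ := Finset.mem_image.1 hx
        have := Finset.mem_product.1 (Finset.mem_filter.1 ((mem_variants.1 hh₁ i).1 hi)).1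
        rw [otherEnd]
        split_ifs
        exacts [this.2, this.1]
      have hcard : (J \ I).card = J.card - I.card := Finset.card_sdiff_of_subset hI
      have := ih h₁ (J \ I) (W.erase u) _ hsub (by
        rw [hWe]
        have : ((J \ I).card : ℝ) ≤ J.card := by
          exact_mod_cast Finset.card_le_card Finset.sdiff_subset
        push_cast at hJ
        have e : M - 1 - t = M - (t + 1) := by ring
        rw [e]
        linarith)
      rw [hWe, hcard] at this
      refine this.trans ?_
      gcongr
      exact card_neighbours_union_le h₁ I hu
    have h3 := step_bound (j := J.card) hy hz hyz hM (by
      push_cast at hJ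
      have : 0 ≤ ρ * ((t : ℝ) + 1) := by positivity
      linarith)
    calc _ ≤ (∑ I ∈ J.powerset, ∑ h₁ ∈ variants h₀ I ((W ×ˢ W).filter
          fun p => p.1 = u ∨ p.2 = u),
          (((variants h₁ (J \ I) (W.erase u ×ˢ W.erase u)).filter fun h =>
            t ≤ (cover h (J \ I) ((U ∪ neighbours h₁ I u).erase u)).card).card : ℝ)) *
          z ^ (t + 1) := by gcongr
      _ = z * ∑ I ∈ J.powerset, ∑ h₁ ∈ variants h₀ I ((W ×ˢ W).filter
          fun p => p.1 = u ∨ p.2 = u),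
          (((variants h₁ (J \ I) (W.erase u ×ˢ W.erase u)).filter fun h =>
            t ≤ (cover h (J \ I) ((U ∪ neighbours h₁ I u).erase u)).card).card : ℝ) * z ^ t := by
          simp only [← Finset.sum_mul]; ring
      _ ≤ z * ∑ I ∈ J.powerset, ∑ h₁ ∈ variants h₀ I ((W ×ˢ W).filter
          fun p => p.1 = u ∨ p.2 = u),
          y ^ (U.card - 1 + I.card) * ((M - 1) ^ 2) ^ (J.card - I.card) := by
          exact mul_le_mul_of_nonneg_left (Finset.sum_le_sum fun I hI =>
            Finset.sum_le_sum fun h₁ hh₁ => h2 I hI h₁ hh₁) hz.le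
      _ = y ^ (U.card - 1) * (z * ∑ I ∈ J.powerset, ((M ^ 2 - (M - 1) ^ 2) * y) ^ I.card *
          ((M - 1) ^ 2) ^ (J.card - I.card)) := by
          simp only [Finset.sum_const, card_variants, nsmul_eq_mul, Nat.cast_pow,
            card_edges_at W huW, Finset.mul_sum, ← hMdef]
          refine Finset.sum_congr rfl fun I _ => ?_
          rw [mul_pow, pow_add]; ring
      _ ≤ y ^ (U.card - 1) * (y * (M ^ 2) ^ J.card) := by
          -- The sum over the sets of edges at `u` is a binomial expansion; `step_bound` trades the
          -- factor `z` for the weight `y` of the removed vertex.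
          rw [Finset.sum_pow_mul_eq_add_pow]
          gcongr
      _ = _ := by
          rw [← mul_assoc, ← pow_succ, Nat.sub_add_cancel (Finset.card_pos.2 ⟨u, hu⟩)]

end LargeComponents

/-! ## The number of good pairs -/

section GoodCount

open scoped Classical

variable {ι V : Type*} [Fintype ι] [Fintype V]

/-- The functions that give a forest with components of at most `L` vertices. -/
noncomputable def goodFunctions (ι V : Type*) [Fintype ι] [Fintype V] (L : ℕ) :
    Finset (ι → V × V) :=
  Finset.univ.filter fun h => PForest h Finset.univ ∧ ∀ v, (comp h Finset.univ v).card ≤ L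

theorem mem_goodFunctions {L : ℕ} {h : ι → V × V} : h ∈ goodFunctions ι V L ↔
    PForest h Finset.univ ∧ ∀ v, (comp h Finset.univ v).card ≤ L := by
  simp [goodFunctions]

theorem card_large_comp_le {ρ y z : ℝ} (hρ : 0 ≤ ρ) (hy : 1 ≤ y) (hz : 0 < z)
    (hyz : z * Real.exp (ρ * (y - 1)) ≤ y) (t : ℕ)
    (hn : 2 * (Fintype.card ι : ℝ) ≤ ρ * (Fintype.card V - t)) (v : V) :
    ((Finset.univ.filter fun h : ι → V × V => t ≤ (comp h Finset.univ v).card).card : ℝ) * z ^ t ≤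
      y * ((Fintype.card V : ℝ) ^ 2) ^ Fintype.card ι := by
  have h := card_filter_cover_le hρ hy hz hyz t (fun _ : ι => (v, v)) Finset.univ Finset.univ {v}
    (Finset.subset_univ _) (by simpa using hn)
  have e : variants (fun _ : ι => (v, v)) Finset.univ (Finset.univ ×ˢ Finset.univ) =
      (Finset.univ : Finset (ι → V × V)) := by
    ext h; simp [mem_variants]
  have e2 : ∀ h : ι → V × V, cover h Finset.univ {v} = comp h Finset.univ v := fun h => by
    simp [cover]
  simpa only [e, e2, Finset.card_singleton, pow_one, Finset.card_univ] using h

/-- Forests minus a union bound over the vertices whose component is too large. The second density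
`ρ'` may exceed `ρ`, to make room for the vertices removed by the exploration. -/
theorem card_goodFunctions_ge {ρ ρ' B y z : ℝ} (hρ : 0 < ρ) (hB : B * (1 - ρ) = 2)
    (hn : 2 * (Fintype.card ι : ℝ) ≤ ρ * Fintype.card V) (hV : 0 < Fintype.card V) (hρ1 : ρ < 1)
    (hBN : B / Fintype.card V ≤ (1 - ρ) / (1 + ρ))
    (hρ' : 0 ≤ ρ') (hy : 1 ≤ y) (hz : 0 < z) (hyz : z * Real.exp (ρ' * (y - 1)) ≤ y) (L : ℕ)
    (hL : 2 * (Fintype.card ι : ℝ) ≤ ρ' * (Fintype.card V - (L + 1 : ℕ))) :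
    ((1 - B / Fintype.card V) ^ Fintype.card ι - Fintype.card V * (y / z ^ (L + 1))) *
      ((Fintype.card V : ℝ) ^ 2) ^ Fintype.card ι ≤ (goodFunctions ι V L).card := by
  have h1 := forestCount_ge (ι := ι) (V := V) hρ hB hn hV hρ1 hBN Finset.univ
  rw [Finset.card_univ] at h1
  have h2 : forestCount V (Finset.univ : Finset ι) ≤ ((goodFunctions ι V L).card : ℝ) +
      ∑ v : V, ((Finset.univ.filter
        fun h : ι → V × V => L + 1 ≤ (comp h Finset.univ v).card).card : ℝ) := by
    have e : forestCount V (Finset.univ : Finset ι) =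
        ((Finset.univ.filter fun h : ι → V × V => PForest h Finset.univ).card : ℝ) := by
      rw [forestCount, Finset.card_filter]; push_cast; rfl
    have hsub : (Finset.univ.filter fun h : ι → V × V => PForest h Finset.univ) ⊆
        goodFunctions ι V L ∪ Finset.univ.biUnion fun v => Finset.univ.filter
          fun h : ι → V × V => L + 1 ≤ (comp h Finset.univ v).card := by
      intro h hh
      by_cases hg : ∀ v, (comp h Finset.univ v).card ≤ L
      · exact Finset.mem_union_left _
          (Finset.mem_filter.2 ⟨Finset.mem_univ _, (Finset.mem_filter.1 hh).2, hg⟩)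
      · push Not at hg
        obtain ⟨v, hv⟩ := hg
        exact Finset.mem_union_right _ (Finset.mem_biUnion.2
          ⟨v, Finset.mem_univ _, Finset.mem_filter.2 ⟨Finset.mem_univ _, hv⟩⟩)
    rw [e]
    exact_mod_cast (Finset.card_le_card hsub).trans ((Finset.card_union_le _ _).trans
      (add_le_add le_rfl Finset.card_biUnion_le))
  have h3 : ∑ v : V, ((Finset.univ.filter
        fun h : ι → V × V => L + 1 ≤ (comp h Finset.univ v).card).card : ℝ) ≤
      ∑ _v : V, y / z ^ (L + 1) * ((Fintype.card V : ℝ) ^ 2) ^ Fintype.card ι := by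
    refine Finset.sum_le_sum fun v _ => ?_
    have := card_large_comp_le hρ' hy hz hyz (L + 1) hL v
    rw [div_mul_eq_mul_div, le_div_iff₀ (by positivity)]
    exact this
  rw [Finset.sum_const, Finset.card_univ, nsmul_eq_mul] at h3
  linarith

theorem exp_le_one_sub {x : ℝ} (h0 : 0 ≤ x) (h1 : x ≤ 1 / 2) : Real.exp (-(2 * x)) ≤ 1 - x := by
  rw [Real.exp_neg, inv_le_comm₀ (Real.exp_pos _) (by linarith)]
  refine le_trans ?_ (Real.add_one_le_exp _)
  rw [inv_le_iff_one_le_mul₀ (by linarith)]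
  nlinarith

/-- The choice `y = 1 / ρ` maximises `y * exp (-ρ * (y - 1))`; the maximum `exp (ρ - 1) / ρ` exceeds
`1` since `exp x > 1 + x` for `x ≠ 0`. -/
theorem exists_rate {ρ : ℝ} (h0 : 0 < ρ) (h1 : ρ < 1) :
    ∃ y z : ℝ, 1 ≤ y ∧ 1 < z ∧ z * Real.exp (ρ * (y - 1)) ≤ y := by
  refine ⟨1 / ρ, 1 / ρ * Real.exp (ρ - 1), by rw [le_div_iff₀ h0]; linarith, ?_, ?_⟩
  · have := Real.add_one_lt_exp (x := ρ - 1) (by linarith)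
    rw [one_div, inv_mul_eq_div, lt_div_iff₀ h0]
    linarith
  · have e : ρ * (1 / ρ - 1) = -(ρ - 1) := by field_simp; ring
    rw [e, mul_assoc, ← Real.exp_add]; simp

theorem eventually_log_le (K : ℕ) {δ : ℝ} (hδ : 0 < δ) :
    ∀ᶠ n : ℕ in Filter.atTop, ((K * (Nat.log 2 n + 1) + 1 : ℕ) : ℝ) ≤ δ * n := by
  have h1 : ∀ᶠ n : ℕ in Filter.atTop, K * (Real.log n / Real.log 2) ≤ δ / 2 * n := by
    have h := (Real.isLittleO_log_id_atTop.comp_tendsto tendsto_natCast_atTop_atTop).def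
      (c := δ / 2 * Real.log 2 / (K + 1)) (by have := Real.log_pos one_lt_two; positivity)
    filter_upwards [h] with n hn
    simp only [Function.comp, id, Real.norm_eq_abs] at hn
    have h2 := (le_abs_self _).trans hn
    rw [abs_of_nonneg (Nat.cast_nonneg n)] at h2
    have hl := Real.log_pos one_lt_two
    rw [← mul_div_assoc, div_le_iff₀ hl]
    calc (K : ℝ) * Real.log n ≤ (K + 1) * (δ / 2 * Real.log 2 / (K + 1) * n) :=
          mul_le_mul (by linarith) h2 (Real.log_natCast_nonneg n) (by positivity)
      _ = δ / 2 * n * Real.log 2 := by field_simp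
  filter_upwards [h1, tendsto_natCast_atTop_atTop.eventually_ge_atTop ((K + 1) / (δ / 2))]
    with n h2 h3
  rw [div_le_iff₀ (by positivity)] at h3
  have h4 : (Nat.log 2 n : ℝ) ≤ Real.log n / Real.log 2 := Real.natLog_le_logb n 2
  push_cast
  have h5 : (K : ℝ) * Nat.log 2 n ≤ K * (Real.log n / Real.log 2) := by gcongr
  linarith

theorem eventually_goodFunctions {c : ℝ} (hc : 2 < c) : ∃ K₁ : ℕ, ∃ p : ℝ, 0 < p ∧
    ∀ᶠ n : ℕ in Filter.atTop, p * (((⌈c * n⌉₊ : ℕ) : ℝ) ^ 2) ^ n ≤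
      (goodFunctions (Fin n) (Fin ⌈c * n⌉₊) (K₁ * (Nat.log 2 n + 1))).card := by
  set ρ := 2 / c with hρdef
  have hc0 : 0 < c := by linarith
  have hρ : 0 < ρ := by positivity
  have hρ1 : ρ < 1 := by rw [hρdef, div_lt_one hc0]; exact hc
  set ρ' := (1 + ρ) / 2 with hρ'def
  obtain ⟨y, z, hy, hz, hyz⟩ := exists_rate (ρ := ρ') (by linarith) (by linarith)
  -- With `z ^ K₁ > 4` the size bound makes `z ^ (L + 1)` at least `n ^ 2`, which beats the `N =
  -- O(n)` terms of the union bound.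
  obtain ⟨K₁, hK⟩ := pow_unbounded_of_one_lt 4 hz
  set B := 2 / (1 - ρ) with hBdef
  have hB : B * (1 - ρ) = 2 := div_mul_cancel₀ _ (by linarith)
  have hB0 : 0 < B := div_pos two_pos (by linarith)
  -- The forests have proportion at least `exp (-2B)`; half of it is given up for large components.
  refine ⟨K₁, Real.exp (-(2 * B)) / 2, by positivity, ?_⟩
  filter_upwards [Filter.eventually_ge_atTop 1,
    tendsto_natCast_atTop_atTop.eventually_ge_atTop (B / ((1 - ρ) / (1 + ρ))),
    tendsto_natCast_atTop_atTop.eventually_ge_atTop (B / (1 / 2)),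
    eventually_log_le K₁ (δ := (c - 2) / 2) (by linarith),
    tendsto_natCast_atTop_atTop.eventually_ge_atTop ((c + 1) * y / (Real.exp (-(2 * B)) / 2))]
    with n hn1 h1 h2 h3 h4
  have hn0 : (0 : ℝ) < n := by exact_mod_cast hn1
  have hn1' : (1 : ℝ) ≤ n := by exact_mod_cast hn1
  set N := ⌈c * n⌉₊ with hN
  have hNge : c * n ≤ N := Nat.le_ceil _
  have hNle : (N : ℝ) ≤ (c + 1) * n := by
    have := (Nat.ceil_lt_add_one (by positivity : 0 ≤ c * n)).le
    linarith
  have hnN : (n : ℝ) ≤ N := by nlinarith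
  have hN0 : (0 : ℝ) < N := by linarith
  have q1 : B / N ≤ (1 - ρ) / (1 + ρ) := by
    have : 0 < (1 - ρ) / (1 + ρ) := div_pos (by linarith) (by linarith)
    rw [div_le_iff₀ hN0]
    rw [div_le_iff₀ this] at h1
    nlinarith
  have q2 : B / N ≤ 1 / 2 := by
    rw [div_le_iff₀ hN0]
    rw [div_le_iff₀ (by norm_num)] at h2
    linarith
  -- With `L + 1 ≤ (c - 2) n / 2` the claim reduces to `(c + 2) ^ 2 / (4c) ≥ 2`, that is, `(c - 2) ^
  -- 2 ≥ 0`.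
  have q3 : 2 * (n : ℝ) ≤ ρ' * (N - (K₁ * (Nat.log 2 n + 1) + 1 : ℕ)) := by
    have e : ρ' * c = (c + 2) / 2 := by rw [hρ'def, hρdef]; field_simp
    have h5 : ρ' * (c * n - (c - 2) / 2 * n) ≤
        ρ' * (N - (K₁ * (Nat.log 2 n + 1) + 1 : ℕ)) := by
      gcongr
    refine le_trans ?_ h5
    have e2 : ρ' * (c * n - (c - 2) / 2 * n) = ((c + 2) / 2 - ρ' * ((c - 2) / 2)) * n := by
      rw [← e]; ring
    rw [e2]
    gcongr
    nlinarith
  have h5 := card_goodFunctions_ge (ι := Fin n) (V := Fin N) hρ hB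
    (by
      simp only [Fintype.card_fin]
      calc 2 * (n : ℝ) = ρ * (c * n) := by rw [hρdef]; field_simp
        _ ≤ ρ * N := by gcongr)
    (by simpa using hN0) hρ1 (by simpa using q1) (by linarith) hy (by linarith) hyz
    (K₁ * (Nat.log 2 n + 1)) (by simpa using q3)
  simp only [Fintype.card_fin] at h5
  refine le_trans (mul_le_mul_of_nonneg_right ?_ (by positivity)) h5
  have h6 : Real.exp (-(2 * B)) ≤ (1 - B / N) ^ n := by
    calc Real.exp (-(2 * B)) ≤ Real.exp (n * -(2 * (B / N))) := by
          rw [Real.exp_le_exp]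
          have : (n : ℝ) * -(2 * (B / N)) = -(2 * B * (n / N)) := by ring
          rw [this]
          have : (n : ℝ) / N ≤ 1 := by rw [div_le_one hN0]; exact hnN
          nlinarith
      _ = Real.exp (-(2 * (B / N))) ^ n := Real.exp_nat_mul _ _
      _ ≤ _ := by gcongr; exact exp_le_one_sub (by positivity) q2
  have h7 : N * (y / z ^ (K₁ * (Nat.log 2 n + 1) + 1)) ≤ Real.exp (-(2 * B)) / 2 := by
    have h8 : (n : ℝ) ^ 2 ≤ z ^ (K₁ * (Nat.log 2 n + 1) + 1) := by
      have h9 : (n : ℝ) ≤ 2 ^ (Nat.log 2 n + 1) := by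
        exact_mod_cast (Nat.lt_pow_succ_log_self one_lt_two n).le
      calc (n : ℝ) ^ 2 ≤ (2 ^ (Nat.log 2 n + 1)) ^ 2 := by gcongr
        _ = 4 ^ (Nat.log 2 n + 1) := by rw [← pow_mul, mul_comm, pow_mul]; norm_num
        _ ≤ (z ^ K₁) ^ (Nat.log 2 n + 1) := by gcongr
        _ = z ^ (K₁ * (Nat.log 2 n + 1)) := (pow_mul _ _ _).symm
        _ ≤ _ := pow_le_pow_right₀ hz.le (Nat.le_succ _)
    rw [div_le_iff₀ (by positivity)] at h4
    calc N * (y / z ^ (K₁ * (Nat.log 2 n + 1) + 1)) ≤ (c + 1) * n * (y / (n : ℝ) ^ 2) := by gcongr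
      _ = (c + 1) * y / n := by field_simp
      _ ≤ _ := by rw [div_le_iff₀ hn0]; linarith
  linarith

theorem exists_forest {n N : ℕ} (h : n < N) : ∃ h : Fin n → Fin N × Fin N, PForest h Finset.univ := by
  -- A star with centre `0`.
  refine ⟨fun i => (⟨0, by omega⟩, ⟨i + 1, by omega⟩), ?_⟩
  refine forest_of_rank (fun v : Fin N => (v : ℕ)) (fun _ => ⟨0, by omega⟩)
    (fun i : Fin n => ⟨i + 1, by omega⟩) Finset.univ (fun i _ => Or.inl ⟨rfl, rfl⟩)
    (fun i _ => Nat.succ_pos _) ?_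
  intro i _ j _ hij
  simpa [Fin.ext_iff] using hij

/-- If `c > 2` and `K` is large, then the probability of a good pair is bounded from below. -/
theorem exists_goodFunctions_ge {c : ℝ} (hc : 2 < c) : ∃ K₀ : ℕ, ∀ K : ℕ, K₀ ≤ K → ∃ p : ℝ, 0 < p ∧
    ∀ n : ℕ, 1 ≤ n → p * (((⌈c * n⌉₊ : ℕ) : ℝ) ^ 2) ^ n ≤
      (goodFunctions (Fin n) (Fin ⌈c * n⌉₊) (K * (Nat.log 2 n + 1))).card := by
  obtain ⟨K₁, p, hp, h⟩ := eventually_goodFunctions hc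
  obtain ⟨n₁, h⟩ := Filter.eventually_atTop.1 h
  have hc0 : 0 < c := by linarith
  set M := ⌈c * n₁⌉₊ with hM
  -- For `n < n₁` the bound `K ≥ M ≥ N` makes the size condition void, and a single forest among the
  -- `(N ^ 2) ^ n` functions suffices. `M + 1` instead of `M` keeps the base of the power at least
  -- `1`.
  refine ⟨max K₁ M, fun K hK => ⟨min p (1 / (((M : ℝ) + 1) ^ 2) ^ n₁), lt_min hp (by positivity),
    fun n hn => ?_⟩⟩
  rw [max_le_iff] at hK
  rcases le_or_gt n₁ n with hn1 | hn1
  · refine (mul_le_mul_of_nonneg_right (min_le_left _ _) (by positivity)).trans ((h n hn1).trans ?_)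
    rw [Nat.cast_le]
    refine Finset.card_le_card fun g hg => ?_
    rw [mem_goodFunctions] at hg ⊢
    exact ⟨hg.1, fun v => (hg.2 v).trans (Nat.mul_le_mul_right _ hK.1)⟩
  · refine (mul_le_mul_of_nonneg_right (min_le_right _ _) (by positivity)).trans ?_
    set N := ⌈c * n⌉₊ with hN
    have hNM : N ≤ M := Nat.ceil_mono (by gcongr)
    have hnN : n < N := by
      rw [hN, Nat.lt_ceil]
      have : (1 : ℝ) ≤ n := by exact_mod_cast hn
      nlinarith
    obtain ⟨g, hg⟩ := exists_forest hnN
    have h1 : (1 : ℝ) ≤ ((goodFunctions (Fin n) (Fin N) (K * (Nat.log 2 n + 1))).card : ℝ) := by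
      rw [Nat.one_le_cast, Nat.succ_le_iff, Finset.card_pos]
      refine ⟨g, mem_goodFunctions.2 ⟨hg, fun v => ?_⟩⟩
      calc (comp g Finset.univ v).card ≤ N := by simpa using Finset.card_le_univ (comp g Finset.univ v)
        _ ≤ K := hNM.trans hK.2
        _ ≤ _ := Nat.le_mul_of_pos_right _ (Nat.succ_pos _)
    refine le_trans ?_ h1
    rw [one_div, inv_mul_le_iff₀ (by positivity), mul_one]
    calc ((N : ℝ) ^ 2) ^ n ≤ (((M : ℝ) + 1) ^ 2) ^ n := by
          have : (N : ℝ) ≤ M := by exact_mod_cast hNM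
          gcongr; linarith
      _ ≤ (((M : ℝ) + 1) ^ 2) ^ n₁ := by
          refine pow_le_pow_right₀ ?_ hn1.le
          have : (0 : ℝ) ≤ M := Nat.cast_nonneg _
          nlinarith

end GoodCount

/-! ## Dependence on the hash values -/

section Dependence

variable {D : Type uD} {n N m k L : ℕ} {S : Finset D}

/-- The hash values on `X`, for the pairs with numbers up to `T`, are the same. -/
structure HashSpace.AgreeOn (ω ω' : HashSpace N m D) (X : Set D) (T : ℕ) : Prop where
  h1 : ∀ t ≤ T, ∀ x ∈ X, ω.h1 t x = ω'.h1 t x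
  h2 : ∀ t ≤ T, ∀ x ∈ X, ω.h2 t x = ω'.h2 t x
  h3 : ∀ x ∈ X, ω.h3 x = ω'.h3 x

theorem HashSpace.AgreeOn.env {ω ω' : HashSpace N m D} {X : Set D} {T : ℕ}
    (h : ω.AgreeOn ω' X T) {key : ℕ → D} (hk : ∀ j, key j ∈ X) :
    (ω.env key).Agree (ω'.env key) T where
  m := rfl
  h1 t ht j := congrArg Fin.val (h.h1 t ht _ (hk j))
  h2 t ht j := congrArg Fin.val (h.h2 t ht _ (hk j))
  h3 j := congrArg Fin.val (h.h3 _ (hk j))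

theorem Creates.congr [NeZero n] {enum : Fin n ≃ S} {f : S → BitVec k} {ω ω' : HashSpace N m D}
    {st : Store n N m} {c : Cost} (h : Creates L enum f ω st c)
    (hω : ω.AgreeOn ω' S st.filter.trial) : Creates L enum f ω' st c := by
  obtain ⟨σ, hσ, rfl⟩ := h
  exact ⟨σ, hσ.congr (hω.env fun j => (enum _).2) le_rfl, rfl⟩

theorem Valid.updateSeq_congr [NeZero n] [NeZero m] {enum : Fin n ≃ S} {f : S → BitVec k}
    {ω ω' : HashSpace N m D} {st st' : Store n N m} {us : List (S × BitVec k)}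
    (hv : Valid enum L f ω st) (h : UpdateSeq ω us st st')
    (hω : ω.AgreeOn ω' S st.filter.trial) : UpdateSeq ω' us st st' := by
  classical
  induction h generalizing f with
  | nil => exact .nil _
  | @cons y z us st st₁ st₂ c h1 _ ih =>
    obtain ⟨st', d, h2, h3, h4, _⟩ := hv.exists_updates y z
    obtain rfl := h1.det h2
    refine .cons (c := c) ?_ (ih h4 (by rwa [h3]))
    obtain ⟨σ, hσ, rfl⟩ := h1
    exact ⟨σ, hσ.congr (hω.env fun j => y.2) h3.le, rfl⟩

/-- The result of creation and updates. -/
def Reaches [NeZero n] (L : ℕ) (enum : Fin n ≃ S) (f : S → BitVec k) (us : List (S × BitVec k))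
    (ω : HashSpace N m D) (st : Store n N m) : Prop :=
  ∃ st₀ c, Creates L enum f ω st₀ c ∧ UpdateSeq ω us st₀ st

variable [NeZero n] [NeZero m] {enum : Fin n ≃ S} {f : S → BitVec k} {us : List (S × BitVec k)}
  {ω ω' : HashSpace N m D} {st st' : Store n N m}

theorem Creates.exists_reaches {c : Cost} (h : Creates L enum f ω st c)
    (us : List (S × BitVec k)) : ∃ st', Reaches L enum f us ω st' := by
  obtain ⟨st', h1, _⟩ := h.isLeast.2.exists_updateSeq us
  exact ⟨st', st, c, h, h1⟩

omit [NeZero m] in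
theorem Reaches.det (h : Reaches L enum f us ω st) (h' : Reaches L enum f us ω st') : st = st' := by
  obtain ⟨st₀, c, h1, h2⟩ := h
  obtain ⟨st₁, c', h3, h4⟩ := h'
  obtain ⟨rfl, rfl⟩ := h1.det h3
  exact h2.det h4

/-- Updates keep the pair number, so creation and updates together read only values on `S` up to the
final pair number. -/
theorem Reaches.congr (h : Reaches L enum f us ω st) (hω : ω.AgreeOn ω' S st.filter.trial) :
    Reaches L enum f us ω' st := by
  obtain ⟨st₀, c, h1, h2⟩ := h
  obtain ⟨st', h3, h4, _⟩ := h1.isLeast.2.exists_updateSeq us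
  obtain rfl := h2.det h3
  rw [h4] at hω
  exact ⟨st₀, c, h1.congr hω, h1.isLeast.2.updateSeq_congr h2 hω⟩

end Dependence

/-! ### Measurability of the events and of the creation time -/

section Measurability

variable {D : Type uD} {n N m k L : ℕ} {S : Finset D}

/-- An event that depends on finitely many hash values is measurable. -/
theorem measurableSet_of_agreeOn (X : Finset D) (T : ℕ) {E : Set (HashSpace N m D)}
    (hE : ∀ ω ω' : HashSpace N m D, ω.AgreeOn ω' X T → ω ∈ E → ω' ∈ E) : MeasurableSet E := by
  -- The projection to the finitely many relevant hash values has a finite range, and the event is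
  -- the preimage of its image.
  let π : HashSpace N m D → (Fin (T + 1) × Bool × X → Fin N) × (X → Fin m) := fun ω =>
    (fun p => ω.1 (p.1, p.2.1, p.2.2), fun x => ω.2 x)
  have hπ : Measurable π := by
    refine Measurable.prodMk ?_ ?_
    · exact measurable_pi_iff.2 fun p => (measurable_pi_apply _).comp measurable_fst
    · exact measurable_pi_iff.2 fun x => (measurable_pi_apply _).comp measurable_snd
  have e : E = π ⁻¹' (π '' E) := by
    refine Set.Subset.antisymm (Set.subset_preimage_image π E) ?_
    rintro ω' ⟨ω, hω, hh⟩
    refine hE ω ω' ⟨fun t ht x hx => ?_, fun t ht x hx => ?_, fun x hx => ?_⟩ hω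
    · exact congrFun (congrArg Prod.fst hh) (⟨t, by omega⟩, false, ⟨x, hx⟩)
    · exact congrFun (congrArg Prod.fst hh) (⟨t, by omega⟩, true, ⟨x, hx⟩)
    · exact congrFun (congrArg Prod.snd hh) ⟨x, hx⟩
  rw [e]
  exact hπ (Set.toFinite _).measurableSet

/-- Countably many results and costs turn events and the creation time into countable unions and
infima. -/
instance : Countable Cost :=
  Function.Injective.countable (f := fun c : Cost => (c.steps, c.hashes, c.reads)) (by
    rintro ⟨x, y, z⟩ ⟨x', y', z'⟩ h
    simpa using h)

instance {w : ℕ} : Finite (BitVec w) := Finite.of_injective BitVec.toFin BitVec.toFin_injective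

instance : Countable (Store n N m) :=
  Function.Injective.countable
    (f := fun st : Store n N m => (st.filter.trial, st.filter.table, st.head, st.next, st.tgt)) (by
    rintro ⟨⟨x, y⟩, z, v, w⟩ ⟨⟨x', y'⟩, z', v', w'⟩ h
    simp only [Prod.mk.injEq] at h
    obtain ⟨rfl, rfl, rfl, rfl, rfl⟩ := h
    rfl)

variable [NeZero n] {enum : Fin n ≃ S} {f : S → BitVec k}

theorem measurableSet_creates (st : Store n N m) (c : Cost) :
    MeasurableSet {ω : HashSpace N m D | Creates L enum f ω st c} :=
  measurableSet_of_agreeOn S st.filter.trial fun _ _ h hω => Creates.congr hω h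

theorem measurable_creationTime :
    Measurable (creationTime (N := N) (m := m) L enum f) := by
  classical
  refine Measurable.iInf fun st => Measurable.iInf fun c => ?_
  have : (fun ω : HashSpace N m D => ⨅ _ : Creates L enum f ω st c, (c.steps : ℝ≥0∞)) =
      fun ω => if Creates L enum f ω st c then (c.steps : ℝ≥0∞) else ⊤ := by
    funext ω
    by_cases h : Creates L enum f ω st c <;> simp [h]
  rw [this]
  exact Measurable.ite (measurableSet_creates st c) measurable_const measurable_const

variable [NeZero m]

/-- The event that the sum computed in a query at `x`, after creation and updates, is `j`. -/
def answerEvent (L : ℕ) (enum : Fin n ≃ S) (f : S → BitVec k) (us : List (S × BitVec k)) (x : D)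
    (j : ZMod m) : Set (HashSpace N m D) :=
  {ω | ∃ st, Reaches L enum f us ω st ∧ answer ω st.filter x = j}

theorem measurableSet_answerEvent (us : List (S × BitVec k)) (x : D) (j : ZMod m) :
    MeasurableSet (answerEvent (N := N) L enum f us x j) := by
  classical
  have : answerEvent (N := N) L enum f us x j =
      ⋃ st : Store n N m, {ω | Reaches L enum f us ω st ∧ answer ω st.filter x = j} := by
    ext ω; simp [answerEvent]
  rw [this]
  refine MeasurableSet.iUnion fun st => measurableSet_of_agreeOn (insert x S) st.filter.trial ?_
  rintro ω ω' h ⟨h1, h2⟩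
  refine ⟨h1.congr ⟨fun t ht y hy => h.h1 t ht y ?_, fun t ht y hy => h.h2 t ht y ?_,
    fun y hy => h.h3 y ?_⟩, ?_⟩
  · simp [Finset.mem_coe.1 hy]
  · simp [Finset.mem_coe.1 hy]
  · simp [Finset.mem_coe.1 hy]
  · have hx : x ∈ ((insert x S : Finset D) : Set D) := by simp
    rw [← h2, answer, answer, h.h1 _ le_rfl x hx, h.h2 _ le_rfl x hx, h.h3 x hx]

theorem bottomEvent_eq (us : List (S × BitVec k)) (x : D) :
    bottomEvent N m L enum f us x =
      ⋃ j ∈ {j : ZMod m | 2 ^ k ≤ j.val}, answerEvent L enum f us x j := by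
  ext ω
  simp only [bottomEvent, answerEvent, Set.mem_ofPred_eq, Set.mem_iUnion, exists_prop]
  constructor
  · rintro ⟨st, st₂, c, c₂, h1, h2, h3⟩
    refine ⟨_, ?_, st₂, ⟨st, c, h1, h2⟩, rfl⟩
    obtain ⟨d, h4, _⟩ := exists_queries (k := k) ω st₂.filter x
    have := h3.det h4
    by_contra hc
    rw [if_pos (not_le.1 hc)] at this
    simp at this
  · rintro ⟨_, h0, st₂, ⟨st, c, h1, h2⟩, rfl⟩
    obtain ⟨d, h4, _⟩ := exists_queries (k := k) ω st₂.filter x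
    rw [if_neg (not_lt.2 h0)] at h4
    exact ⟨st, st₂, c, d, h1, h2, h4⟩

theorem measurableSet_bottomEvent (us : List (S × BitVec k)) (x : D) :
    MeasurableSet (bottomEvent N m L enum f us x) := by
  rw [bottomEvent_eq]
  exact MeasurableSet.biUnion (Set.to_countable _) fun j _ => measurableSet_answerEvent us x j

end Measurability

/-! ## The answer outside of `S` -/

section Bottom

variable {D : Type uD} {n N m k L : ℕ} {S : Finset D} [NeZero n] [NeZero m] {enum : Fin n ≃ S}
  {f : S → BitVec k}

open scoped Classical in
/-- The change of `h₃(x)` by `1`. -/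
noncomputable def shiftAt (x : D) (ω : HashSpace N m D) : HashSpace N m D :=
  (ω.1, fun y => if y = x then ω.2 y + 1 else ω.2 y)

theorem map_add_one_uniform : (PMF.uniformOfFintype (Fin m)).toMeasure.map (fun y => y + 1) =
    (PMF.uniformOfFintype (Fin m)).toMeasure := by
  have hmeas : Measurable (fun y : Fin m => y + 1) := measurable_of_finite _
  refine Measure.ext_of_singleton fun y => ?_
  rw [Measure.map_apply hmeas (measurableSet_singleton _)]
  have : (fun y : Fin m => y + 1) ⁻¹' {y} = {y - 1} := by
    ext z
    exact eq_sub_iff_add_eq.symm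
  rw [this, PMF.toMeasure_apply_singleton _ _ (measurableSet_singleton _),
    PMF.toMeasure_apply_singleton _ _ (measurableSet_singleton _)]
  simp

theorem measurePreserving_shiftAt [NeZero N] (x : D) :
    MeasurePreserving (shiftAt x) (hashLaw N m D) (hashLaw N m D) := by
  classical
  have h : MeasurePreserving
      (fun (g : D → Fin m) y => if y = x then g y + 1 else g y)
      (Measure.infinitePi fun _ : D => (PMF.uniformOfFintype (Fin m)).toMeasure)
      (Measure.infinitePi fun _ : D => (PMF.uniformOfFintype (Fin m)).toMeasure) := by
    refine ⟨measurable_pi_iff.2 fun y => ?_, ?_⟩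
    · exact (measurable_of_finite fun z : Fin m => if y = x then z + 1 else z).comp
        (measurable_pi_apply y)
    · rw [Measure.infinitePi_map_pi (fun _ : D => (PMF.uniformOfFintype (Fin m)).toMeasure)
        (f := fun y (z : Fin m) => if y = x then z + 1 else z)
        (hf := fun y => measurable_of_finite _)]
      congr 1
      funext y
      by_cases hy : y = x
      · simp only [hy, if_true]; exact map_add_one_uniform
      · simp only [hy, if_false]; exact Measure.map_id
  exact (MeasurePreserving.id (Measure.infinitePi fun _ : ℕ × Bool × D =>
    (PMF.uniformOfFintype (Fin N)).toMeasure)).prod h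

theorem shiftAt_agreeOn {x : D} (hx : x ∉ S) (ω : HashSpace N m D) (T : ℕ) :
    (shiftAt x ω).AgreeOn ω S T where
  h1 _ _ _ _ := rfl
  h2 _ _ _ _ := rfl
  h3 y hy := if_neg fun e : y = x => hx (e ▸ hy)

omit [NeZero m] in
theorem HashSpace.AgreeOn.symm {ω ω' : HashSpace N m D} {X : Set D} {T : ℕ}
    (h : ω.AgreeOn ω' X T) : ω'.AgreeOn ω X T where
  h1 t ht x hx := (h.h1 t ht x hx).symm
  h2 t ht x hx := (h.h2 t ht x hx).symm
  h3 x hx := (h.h3 x hx).symm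

theorem answer_shiftAt (x : D) (ω : HashSpace N m D) (F : Filter N (Nat.clog 2 m)) :
    answer (shiftAt x ω) F x = answer ω F x + 1 := by
  have h3 : (((shiftAt x ω).h3 x : ℕ) : ZMod m) = ((ω.h3 x : ℕ) : ZMod m) + 1 := by
    have : (shiftAt x ω).h3 x = ω.h3 x + 1 := if_pos rfl
    rw [this, Fin.val_add, ZMod.natCast_mod, Nat.cast_add]
    congr 1
    rw [Fin.val_one', ZMod.natCast_mod, Nat.cast_one]
  rw [answer, answer, h3]
  change _ + (_ + 1) = _ + _ + 1
  rw [← add_assoc]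
  rfl

/-- For `x ∉ S`, rotating `h₃(x)` leaves the store unchanged, because its construction does not read
this value; only the sum in the query moves by `1`. -/
theorem preimage_answerEvent {x : D} (hx : x ∉ S) (us : List (S × BitVec k)) (j : ZMod m) :
    shiftAt x ⁻¹' answerEvent (N := N) L enum f us x (j + 1) = answerEvent L enum f us x j := by
  ext ω
  simp only [Set.mem_preimage, answerEvent, Set.mem_ofPred_eq, answer_shiftAt, add_left_inj]
  refine exists_congr fun st => and_congr_left fun _ => ⟨fun h => ?_, fun h => ?_⟩
  · exact h.congr (shiftAt_agreeOn hx ω _)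
  · exact h.congr (shiftAt_agreeOn hx ω _).symm

theorem hashLaw_answerEvent_eq [NeZero N] {x : D} (hx : x ∉ S) (us : List (S × BitVec k))
    (j : ZMod m) : hashLaw N m D (answerEvent L enum f us x j) =
      hashLaw N m D (answerEvent L enum f us x 0) := by
  have step : ∀ i : ℕ, hashLaw N m D (answerEvent L enum f us x (i : ZMod m)) =
      hashLaw N m D (answerEvent L enum f us x 0) := by
    intro i
    induction i with
    | zero => rw [Nat.cast_zero]
    | succ i ih =>
      rw [Nat.cast_succ, ← ih, ← preimage_answerEvent hx us (i : ZMod m),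
        (measurePreserving_shiftAt x).measure_preimage
          (measurableSet_answerEvent us x _).nullMeasurableSet]
  have := step j.val
  rwa [ZMod.natCast_zmod_val] at this

instance [NeZero N] : IsProbabilityMeasure (hashLaw N m D) := by
  unfold hashLaw; infer_instance

omit [NeZero m] in
theorem disjoint_answerEvent (us : List (S × BitVec k)) (x : D) :
    Pairwise (Function.onFun Disjoint (answerEvent (N := N) (m := m) L enum f us x)) := by
  intro i j hij
  refine Set.disjoint_left.2 ?_
  rintro ω ⟨st, h1, h2⟩ ⟨st', h3, h4⟩
  obtain rfl := h1.det h3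
  exact hij (h2.symm.trans h4)

/-- The `m` events are disjoint, equally likely by rotation, and cover almost everything because
creation halts almost surely. -/
theorem hashLaw_answerEvent [NeZero N]
    (hcr : ∀ᵐ ω ∂hashLaw N m D, ∃ (st : Store n N m) (c : Cost), Creates L enum f ω st c)
    {x : D} (hx : x ∉ S) (us : List (S × BitVec k)) (j : ZMod m) :
    (hashLaw N m D).real (answerEvent L enum f us x j) = 1 / m := by
  have h1 : (hashLaw N m D).real (⋃ j : ZMod m, answerEvent L enum f us x j) = 1 := by
    rw [measureReal_def, (prob_compl_eq_zero_iff
      (MeasurableSet.iUnion fun j => measurableSet_answerEvent us x j)).1, ENNReal.toReal_one]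
    rw [← mem_ae_iff]
    filter_upwards [hcr] with ω ⟨st, c, h⟩
    obtain ⟨st', h'⟩ := h.exists_reaches us
    exact Set.mem_iUnion.2 ⟨_, st', h', rfl⟩
  rw [measureReal_iUnion_fintype (disjoint_answerEvent us x)
    (fun j => measurableSet_answerEvent us x j)] at h1
  have h2 : ∀ i : ZMod m, (hashLaw N m D).real (answerEvent L enum f us x i) =
      (hashLaw N m D).real (answerEvent L enum f us x j) := fun i => by
    rw [measureReal_def, measureReal_def, hashLaw_answerEvent_eq hx, hashLaw_answerEvent_eq hx us j]
  simp only [h2, Finset.sum_const, Finset.card_univ, ZMod.card, nsmul_eq_mul] at h1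
  have hm : (m : ℝ) ≠ 0 := Nat.cast_ne_zero.2 (NeZero.ne m)
  field_simp
  linarith

theorem card_le_val :
    (Finset.univ.filter fun j : ZMod m => 2 ^ k ≤ j.val).card = m - 2 ^ k := by
  have : (Finset.univ.filter fun j : ZMod m => 2 ^ k ≤ j.val).card = (Finset.Ico (2 ^ k) m).card := by
    refine Finset.card_bij' (fun j _ => j.val) (fun i _ => (i : ZMod m)) ?_ ?_ ?_ ?_
    · intro j hj
      simp only [Finset.mem_filter, Finset.mem_univ, true_and] at hj
      exact Finset.mem_Ico.2 ⟨hj, ZMod.val_lt j⟩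
    · intro i hi
      rw [Finset.mem_Ico] at hi
      simpa [ZMod.val_natCast_of_lt hi.2] using hi.1
    · intro j _; exact ZMod.natCast_zmod_val j
    · intro i hi
      rw [Finset.mem_Ico] at hi
      exact ZMod.val_natCast_of_lt hi.2
  rw [this, Nat.card_Ico]

theorem hashLaw_bottomEvent [NeZero N] (hk : 2 ^ k ≤ m)
    (hcr : ∀ᵐ ω ∂hashLaw N m D, ∃ (st : Store n N m) (c : Cost), Creates L enum f ω st c)
    {x : D} (hx : x ∉ S) (us : List (S × BitVec k)) :
    (hashLaw N m D).real (bottomEvent N m L enum f us x) = 1 - 2 ^ k / (m : ℝ) := by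
  have e : bottomEvent N m L enum f us x = ⋃ j ∈ Finset.univ.filter fun j : ZMod m => 2 ^ k ≤ j.val,
      answerEvent L enum f us x j := by
    rw [bottomEvent_eq]; simp
  rw [e, measureReal_biUnion_finset ((disjoint_answerEvent us x).set_pairwise _)
    (fun j _ => measurableSet_answerEvent us x j),
    Finset.sum_congr rfl fun j _ => hashLaw_answerEvent hcr hx us j, Finset.sum_const, card_le_val,
    nsmul_eq_mul, Nat.cast_sub hk]
  have hm : (m : ℝ) ≠ 0 := Nat.cast_ne_zero.2 (NeZero.ne m)
  push_cast
  field_simp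

end Bottom

/-! ## The expected time of the creation -/

section CreationTime

variable {D : Type uD} {n N m k L : ℕ} {S : Finset D} {enum : Fin n ≃ S}

/-- The edges of the graph for the pair number `t`. -/
def pairs (enum : Fin n ≃ S) (ω : HashSpace N m D) (t : ℕ) (i : Fin n) : Fin N × Fin N :=
  (ω.h1 t (enum i), ω.h2 t (enum i))

theorem goodPair_iff_mem {ω : HashSpace N m D} {t : ℕ} :
    GoodPair (ω.h1 t) (ω.h2 t) S L ↔ pairs enum ω t ∈ goodFunctions (Fin n) (Fin N) L := by
  have himg : (fun i => (enum i : D)) '' ((Finset.univ : Finset (Fin n)) : Set (Fin n)) =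
      (S : Set D) := by
    ext s
    simp only [Finset.coe_univ, Set.image_univ, Set.mem_range]
    exact ⟨fun ⟨i, hi⟩ => hi ▸ (enum i).2, fun hs => ⟨enum.symm ⟨s, hs⟩, by simp⟩⟩
  have hψ : Set.InjOn (fun i => (enum i : D)) ((Finset.univ : Finset (Fin n)) : Set (Fin n)) :=
    fun i _ j _ hij => enum.injective (Subtype.ext hij)
  rw [goodPair_iff, mem_goodFunctions]
  refine and_congr ?_ (forall_congr' fun v => ?_)
  · exact (Forest.map_iff (φ := id) Function.injective_id hψ (fun _ _ => rfl) (fun _ _ => rfl)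
      himg).symm
  · have : {w | Link (ω.h1 t) (ω.h2 t) (S : Set D) v w} =
        (comp (pairs enum ω t) Finset.univ v : Set (Fin N)) := by
      ext w
      rw [Finset.mem_coe, mem_comp]
      exact (Link.map_iff' (φ := id) Function.injective_id (fun _ _ => rfl) (fun _ _ => rfl)
        himg).symm
    rw [this, Set.ncard_coe_finset]

/-- The event that the first `T` pairs of hash functions are rejected. -/
def rejectEvent (N m : ℕ) (S : Finset D) (L T : ℕ) : Set (HashSpace N m D) :=
  {ω | ∀ t < T, ¬ GoodPair (ω.h1 (t + 1)) (ω.h2 (t + 1)) S L}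

theorem measurableSet_rejectEvent (enum : Fin n ≃ S) (T : ℕ) :
    MeasurableSet (rejectEvent N m S L T) := by
  refine measurableSet_of_agreeOn S T fun ω ω' h hω t ht => ?_
  have : pairs enum ω' (t + 1) = pairs enum ω (t + 1) := by
    funext i
    exact Prod.ext (h.h1 _ ht _ (enum i).2).symm (h.h2 _ ht _ (enum i).2).symm
  rw [goodPair_iff_mem (enum := enum), this, ← goodPair_iff_mem]
  exact hω t ht

variable [NeZero N] [NeZero m]

theorem hashLaw_pairs_eq (enum : Fin n ≃ S) {T : ℕ} (y : Fin T → Fin n → Fin N × Fin N) :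
    hashLaw N m D {ω | ∀ t : Fin T, pairs enum ω (t + 1) = y t} = ((N : ℝ≥0∞)⁻¹ ^ (2 * n)) ^ T := by
  -- The `2nT` hash values concerned are different coordinates. The pairs count from `1`, since a
  -- fresh pair is drawn before the first round.
  let g : Fin T × Bool × Fin n → ℕ × Bool × D := fun p => (p.1 + 1, p.2.1, enum p.2.2)
  have hg : Function.Injective g := by
    rintro ⟨t, b, i⟩ ⟨t', b', i'⟩ h
    simp only [g, Prod.mk.injEq, add_left_inj] at h
    obtain ⟨h1, rfl, h3⟩ := h
    rw [Fin.ext h1, enum.injective (Subtype.ext h3)]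
  let y' : Fin T × Bool × Fin n → Fin N := fun p => if p.2.1 then (y p.1 p.2.2).2 else (y p.1 p.2.2).1
  have e : {ω : HashSpace N m D | ∀ t : Fin T, pairs enum ω (t + 1) = y t} =
      ((fun (ω : ℕ × Bool × D → Fin N) p => ω (g p)) ⁻¹' {y'}) ×ˢ Set.univ := by
    ext ω
    simp only [Set.mem_ofPred_eq, Set.mem_prod, Set.mem_preimage, Set.mem_singleton_iff,
      Set.mem_univ, and_true]
    constructor
    · intro h
      funext ⟨t, b, i⟩
      have := congrFun (h t) i
      cases b
      · exact congrArg Prod.fst this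
      · exact congrArg Prod.snd this
    · intro h t
      funext i
      exact Prod.ext (congrFun h (t, false, i)) (congrFun h (t, true, i))
  have hmeas : Measurable (fun (ω : ℕ × Bool × D → Fin N) p => ω (g p)) := by fun_prop
  rw [e, hashLaw, Measure.prod_prod, measure_univ, mul_one,
    ← Measure.map_apply hmeas (measurableSet_singleton _),
    Measure.map_infinitePi_infinitePi_of_inj hg, Measure.infinitePi_singleton_of_fintype]
  simp only [PMF.toMeasure_apply_singleton _ _ (measurableSet_singleton _),
    PMF.uniformOfFintype_apply, Fintype.card_fin, Finset.prod_const, Finset.card_univ,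
    Fintype.card_prod, Fintype.card_bool, ← pow_mul]
  congr 1
  ring

/-- Independence enters by counting: a rejection of all `T` pairs is one of `bad.card ^ T` equally
likely patterns. -/
theorem hashLaw_rejectEvent_le (enum : Fin n ≃ S) {p : ℝ}
    (hp : p * ((N : ℝ) ^ 2) ^ n ≤ (goodFunctions (Fin n) (Fin N) L).card) (T : ℕ) :
    hashLaw N m D (rejectEvent N m S L T) ≤ ENNReal.ofReal (1 - p) ^ T := by
  classical
  set bad : Finset (Fin n → Fin N × Fin N) := (goodFunctions (Fin n) (Fin N) L)ᶜ with hbad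
  have hsub : rejectEvent N m S L T ⊆ ⋃ y ∈ Fintype.piFinset fun _ : Fin T => bad,
      {ω : HashSpace N m D | ∀ t : Fin T, pairs enum ω (t + 1) = y t} := by
    intro ω hω
    refine Set.mem_iUnion₂.2 ⟨fun t => pairs enum ω (t + 1), ?_, fun t => rfl⟩
    rw [Fintype.mem_piFinset]
    intro t
    rw [hbad, Finset.mem_compl, ← goodPair_iff_mem]
    exact hω t t.2
  have hN : (0 : ℝ) < N := Nat.cast_pos.2 (NeZero.pos N)
  have hcard : (bad.card : ℝ) ≤ (1 - p) * (N : ℝ) ^ (2 * n) := by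
    rw [hbad, Finset.card_compl, Nat.cast_sub (Finset.card_le_univ _)]
    simp only [Fintype.card_pi_const, Fintype.card_prod, Fintype.card_fin]
    push_cast
    rw [← sq, pow_mul]
    linarith
  have hq : (bad.card : ℝ≥0∞) * (N : ℝ≥0∞)⁻¹ ^ (2 * n) ≤ ENNReal.ofReal (1 - p) := by
    rw [← ENNReal.inv_pow, ← div_eq_mul_inv]
    refine ENNReal.div_le_of_le_mul ?_
    rw [← ENNReal.ofReal_natCast, ← ENNReal.ofReal_natCast N, ← ENNReal.ofReal_pow hN.le,
      ← ENNReal.ofReal_mul' (by positivity)]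
    exact ENNReal.ofReal_le_ofReal hcard
  calc _ ≤ ∑ y ∈ Fintype.piFinset fun _ : Fin T => bad,
        hashLaw N m D {ω | ∀ t : Fin T, pairs enum ω (t + 1) = y t} :=
        (measure_mono hsub).trans (measure_biUnion_finset_le _ _)
    _ = ((bad.card : ℝ≥0∞) * (N : ℝ≥0∞)⁻¹ ^ (2 * n)) ^ T := by
        simp only [hashLaw_pairs_eq, Finset.sum_const, Fintype.card_piFinset_const, nsmul_eq_mul,
          mul_pow, Nat.cast_pow]
    _ ≤ _ := by gcongr

variable [NeZero n] {f : S → BitVec k}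

omit [NeZero N] in
-- If the first good pair has number `t + 1`, then exactly the events with `T ≤ t` occur, one for
-- each round. If there is no good pair, then the series is infinite.
theorem creationTime_le_tsum (ω : HashSpace N m D) : creationTime L enum f ω ≤
    ∑' T, (rejectEvent N m S L T).indicator (fun _ => ((300 * (n + N) + 200 : ℕ) : ℝ≥0∞)) ω := by
  classical
  by_cases h : ∃ t : ℕ, GoodPair (ω.h1 (t + 1)) (ω.h2 (t + 1)) S L
  · obtain ⟨hg, hmin⟩ := Nat.isLeast_find h
    set t := Nat.find h
    have ht : IsLeast {t : ℕ | 1 ≤ t ∧ GoodPair (ω.h1 t) (ω.h2 t) S L} (t + 1) := by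
      refine ⟨⟨Nat.succ_pos _, hg⟩, fun s ⟨hs1, hs2⟩ => ?_⟩
      obtain ⟨s, rfl⟩ := Nat.exists_eq_succ_of_ne_zero (Nat.pos_iff_ne_zero.1 hs1)
      exact Nat.succ_le_succ (hmin hs2)
    obtain ⟨st, c, h1, _, _, h2⟩ := exists_creates (f := f) (enum := enum) ht
    calc creationTime L enum f ω ≤ (c.steps : ℝ≥0∞) :=
          iInf_le_of_le st (iInf_le_of_le c (iInf_le _ h1))
      _ ≤ (((t + 1) * (300 * (n + N) + 200) : ℕ) : ℝ≥0∞) := Nat.cast_le.2 h2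
      _ = ∑ T ∈ Finset.range (t + 1), (rejectEvent N m S L T).indicator
            (fun _ => ((300 * (n + N) + 200 : ℕ) : ℝ≥0∞)) ω := by
          rw [Finset.sum_congr rfl fun T hT => Set.indicator_of_mem
            (show ω ∈ rejectEvent N m S L T from fun s hs hc => ?_) _]
          · rw [Finset.sum_const, Finset.card_range, nsmul_eq_mul, Nat.cast_mul]
          · have := hmin hc
            rw [Finset.mem_range] at hT
            omega
      _ ≤ _ := ENNReal.sum_le_tsum _
  · push Not at h
    rw [tsum_congr fun T => Set.indicator_of_mem
      (show ω ∈ rejectEvent N m S L T from fun s _ => h s) _,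
      ENNReal.tsum_const_eq_top_of_ne_zero (by simp)]
    exact le_top

theorem lintegral_creationTime_le {p : ℝ} (hp0 : 0 < p)
    (hp : p * ((N : ℝ) ^ 2) ^ n ≤ (goodFunctions (Fin n) (Fin N) L).card) :
    ∫⁻ ω, creationTime L enum f ω ∂hashLaw N m D ≤
      ENNReal.ofReal ((300 * (n + N) + 200) / p) := by
  -- Needed so that `1 - (1 - p) = p` under truncated subtraction in the geometric series.
  have hp1 : p ≤ 1 := by
    have hN : (0 : ℝ) < N := Nat.cast_pos.2 (NeZero.pos N)
    have h1 : ((goodFunctions (Fin n) (Fin N) L).card : ℝ) ≤ ((N : ℝ) ^ 2) ^ n := by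
      have := Finset.card_le_univ (goodFunctions (Fin n) (Fin N) L)
      simp only [Fintype.card_pi_const, Fintype.card_prod, Fintype.card_fin, ← sq] at this
      exact_mod_cast this
    have h2 : (0 : ℝ) < ((N : ℝ) ^ 2) ^ n := by positivity
    exact le_of_mul_le_mul_right ((hp.trans h1).trans (one_mul _).ge) h2
  calc _ ≤ ∫⁻ ω, ∑' T, (rejectEvent N m S L T).indicator
          (fun _ => ((300 * (n + N) + 200 : ℕ) : ℝ≥0∞)) ω ∂hashLaw N m D :=
        lintegral_mono creationTime_le_tsum
    _ = ∑' T, ((300 * (n + N) + 200 : ℕ) : ℝ≥0∞) * hashLaw N m D (rejectEvent N m S L T) := by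
        rw [lintegral_tsum fun T =>
          (measurable_const.indicator (measurableSet_rejectEvent enum T)).aemeasurable]
        exact tsum_congr fun T => lintegral_indicator_const (measurableSet_rejectEvent enum T) _
    _ ≤ ∑' T, ((300 * (n + N) + 200 : ℕ) : ℝ≥0∞) * ENNReal.ofReal (1 - p) ^ T := by
        refine ENNReal.tsum_le_tsum fun T => ?_
        gcongr
        exact hashLaw_rejectEvent_le enum hp T
    _ = _ := by
        rw [ENNReal.tsum_mul_left, ENNReal.tsum_geometric,
          ENNReal.ofReal_sub _ hp0.le, ENNReal.ofReal_one,
          ENNReal.sub_sub_cancel ENNReal.one_ne_top (by simpa using hp1),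
          ENNReal.ofReal_div_of_pos hp0, div_eq_mul_inv]
        congr 1
        rw [← ENNReal.ofReal_natCast]
        push_cast
        rfl

/-- A function with finite integral is finite almost everywhere, and the creation time is `⊤` where
no run halts. -/
theorem ae_exists_creates {p : ℝ} (hp0 : 0 < p)
    (hp : p * ((N : ℝ) ^ 2) ^ n ≤ (goodFunctions (Fin n) (Fin N) L).card) :
    ∀ᵐ ω ∂hashLaw N m D, ∃ (st : Store n N m) (c : Cost), Creates L enum f ω st c := by
  filter_upwards [ae_lt_top measurable_creationTime
    ((lintegral_creationTime_le (m := m) (enum := enum) (f := f) hp0 hp).trans_lt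
      ENNReal.ofReal_lt_top).ne] with ω hω
  by_contra hc
  push Not at hc
  refine hω.ne ?_
  simp only [creationTime, iInf_eq_top]
  exact fun st c h => absurd h (hc st c)

end CreationTime

/-! ### Final estimates and the theorem -/

theorem componentBound_le_log {n : ℕ} (hn : 1 ≤ n) (K : ℕ) :
    ((170 * (K * (Nat.log 2 n + 1)) + 100 : ℕ) : ℝ) ≤
      (340 * K + 100) / Real.log 2 * Real.log (n + 1) := by
  have hl : 0 < Real.log 2 := Real.log_pos one_lt_two
  have hn' : (1 : ℝ) ≤ n := Nat.one_le_cast.2 hn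
  set r := Real.log (n + 1) / Real.log 2 with hr
  -- As `n ≥ 1`, the logarithm of `n + 1` to base `2` is at least `1` and absorbs the additive
  -- constants.
  have h1 : 1 ≤ r := by
    rw [hr, one_le_div hl]
    exact Real.log_le_log two_pos (by linarith)
  have h2 : (Nat.log 2 n : ℝ) ≤ r := by
    refine (Real.natLog_le_logb n 2).trans ?_
    rw [Real.logb, hr, Nat.cast_ofNat]
    have := Real.log_le_log (by linarith : (0 : ℝ) < n) (by linarith : (n : ℝ) ≤ n + 1)
    exact div_le_div_of_nonneg_right this hl.le
  have h3 : (K : ℝ) * (Nat.log 2 n + 1) ≤ K * (2 * r) := by gcongr; linarith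
  rw [div_mul_eq_mul_div, mul_div_assoc, ← hr]
  push_cast
  nlinarith

end Bloomier

theorem mainTheorem2 :
    ∃ Q : ℕ, ∀ c : ℝ, 2 < c → ∃ K₀ : ℕ, ∀ K : ℕ, K₀ ≤ K → ∃ A : ℝ,
      ∀ (n N m k : ℕ) [NeZero n] [NeZero N] [NeZero m], N = ⌈c * n⌉₊ → 2 ^ k ≤ m →
      ∀ L : ℕ, L = K * (Nat.log 2 n + 1) →
      ∀ (D : Type uD) (S : Finset D) (enum : Fin n ≃ S) (f : S → BitVec k),
        -- creation halts almost surely, in expected time `O(n)`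
        (∀ᵐ ω ∂Bloomier.hashLaw N m D, ∃ (st : Bloomier.Store n N m) (cost : Bloomier.Cost),
          Bloomier.Creates L enum f ω st cost) ∧
        Measurable (Bloomier.creationTime (N := N) (m := m) L enum f) ∧
        ∫⁻ ω, Bloomier.creationTime L enum f ω ∂Bloomier.hashLaw N m D
          ≤ ENNReal.ofReal (A * n) ∧
        -- whenever creation has halted
        (∀ (ω : Bloomier.HashSpace N m D) (st : Bloomier.Store n N m) (cost : Bloomier.Cost),
          Bloomier.Creates L enum f ω st cost →
          -- the pair in use is the first one in the sequence with a graph as required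
          IsLeast {t : ℕ | 1 ≤ t ∧ Bloomier.GoodPair (ω.h1 t) (ω.h2 t) S L} st.filter.trial ∧
          -- after any sequence of changes, the filter stores the current function
          ∀ us : List (S × BitVec k), ∃ st₂ : Bloomier.Store n N m,
            Bloomier.UpdateSeq ω us st st₂ ∧
            -- the hash functions are kept
            st₂.filter.trial = st.filter.trial ∧
            -- the table solves the system of equations
            (∀ s : S,
              ((st₂.filter.table (ω.h1 st.filter.trial s)).toNat : ZMod m) +
                ((st₂.filter.table (ω.h2 st.filter.trial s)).toNat : ZMod m) +
                ((ω.h3 s : ℕ) : ZMod m) = ((Bloomier.changed f us s).toNat : ZMod m)) ∧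
            -- space
            st₂.filter.bits.length = ⌈c * n⌉₊ * ⌈Real.logb 2 m⌉₊ ∧
            -- query time
            (∀ x : D, ∃ (out : Option (BitVec k)) (d : Bloomier.Cost),
              Bloomier.Queries k ω st₂.filter x out d ∧
                d.steps ≤ Q ∧ d.hashes = 3 ∧ d.reads = 2) ∧
            -- correct values on `S`
            (∀ s : S, ∃ d : Bloomier.Cost,
              Bloomier.Queries k ω st₂.filter s (some (Bloomier.changed f us s)) d) ∧
            -- the next change of a value takes time `O(log n)`
            (∀ (y : S) (z : BitVec k), ∃ (st₃ : Bloomier.Store n N m) (d : Bloomier.Cost),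
              Bloomier.Updates ω st₂ y z st₃ d ∧ (d.steps : ℝ) ≤ A * Real.log (n + 1))) ∧
        -- the answer outside `S`, after any sequence of changes
        (∀ (us : List (S × BitVec k)) (x : D), x ∉ S →
          MeasurableSet (Bloomier.bottomEvent N m L enum f us x) ∧
          (Bloomier.hashLaw N m D).real (Bloomier.bottomEvent N m L enum f us x)
            = 1 - 2 ^ k / (m : ℝ)) := by
  refine ⟨20, fun c hc => ?_⟩
  obtain ⟨K₀, hK₀⟩ := Bloomier.exists_goodFunctions_ge hc
  refine ⟨K₀, fun K hK => ?_⟩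
  obtain ⟨p, hp0, hp⟩ := hK₀ K hK
  have hl : 0 < Real.log 2 := Real.log_pos one_lt_two
  have hcr : 0 < (300 * (c + 2) + 200) / p := div_pos (by linarith) hp0
  have hup : 0 < (340 * K + 100) / Real.log 2 := by positivity
  -- The sum of the constants for creation and for updates serves both; it depends only on `c` and
  -- `K`, as `p` does.
  refine ⟨(300 * (c + 2) + 200) / p + (340 * K + 100) / Real.log 2, ?_⟩
  intro n N m k _ _ _ hN hk L hL D S enum f
  have hn : 1 ≤ n := NeZero.one_le
  have hn' : (1 : ℝ) ≤ n := Nat.one_le_cast.2 hn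
  have hgood : p * ((N : ℝ) ^ 2) ^ n ≤ (Bloomier.goodFunctions (Fin n) (Fin N) L).card := by
    subst hN hL
    exact hp n hn
  have hae := Bloomier.ae_exists_creates (m := m) (enum := enum) (f := f) hp0 hgood
  refine ⟨hae, Bloomier.measurable_creationTime, ?_, ?_, fun us x hx =>
    ⟨Bloomier.measurableSet_bottomEvent us x, Bloomier.hashLaw_bottomEvent hk hae hx us⟩⟩
  · refine (Bloomier.lintegral_creationTime_le hp0 hgood).trans (ENNReal.ofReal_le_ofReal ?_)
    have hNle : (N : ℝ) ≤ (c + 1) * n := by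
      rw [hN]
      have := (Nat.ceil_lt_add_one (by nlinarith : 0 ≤ c * n)).le
      linarith
    have h1 : (300 * ((n : ℝ) + N) + 200) / p ≤ (300 * (c + 2) + 200) * n / p := by
      refine div_le_div_of_nonneg_right ?_ hp0.le
      linarith
    rw [mul_div_right_comm] at h1
    refine h1.trans (mul_le_mul_of_nonneg_right ?_ (by linarith))
    linarith
  · intro ω st cost h
    obtain ⟨hleast, hv⟩ := h.isLeast
    refine ⟨hleast, fun us => ?_⟩
    obtain ⟨st₂, h1, h2, h3⟩ := hv.exists_updateSeq us
    refine ⟨st₂, h1, h2, fun s => ?_, ?_, fun x => ?_, fun s => h3.queries hk s, fun y z => ?_⟩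
    · rw [← h2]
      exact h3.answer_eq s
    · rw [Bloomier.Filter.length_bits, ← Real.natCeil_logb_natCast, Nat.cast_ofNat, hN]
    · obtain ⟨d, h4, h5⟩ := Bloomier.exists_queries (k := k) ω st₂.filter x
      exact ⟨_, d, h4, h5⟩
    · classical
      obtain ⟨st₃, d, h4, _, _, h5⟩ := h3.exists_updates y z
      refine ⟨st₃, d, h4, (Nat.cast_le.2 h5).trans ?_⟩
      rw [hL]
      refine (Bloomier.componentBound_le_log hn K).trans
        (mul_le_mul_of_nonneg_right ?_ (Real.log_nonneg (by linarith)))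
      linarith
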